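/- Setting. A two-player zero-sum imperfect-information game is a finite partially observable Markov game with horizon $H$, tree structure (each state of layer $h$ has a unique history of past states and actions leading to it) and perfect recall. The max-player (min-player) has $X$ ($Y$) information sets in total, all nonempty, and a nonempty set of $A$ ($B$) actions; the rewards $r_h(s_h,a_h,b_h)\in[0,1]$ are random, drawn independently given the states and actions. For policies $(\mu,\nu)$ let $V^{\mu,\nu}=\mathbb E_{\mu,\nu}[\sum_{h=1}^H r_h]$ and $\mathrm{NEGap}(\mu,\nu)=\max_{\mu^\dagger}V^{\mu^\dagger,\nu}-\min_{\nu^\dagger}V^{\mu,\nu^\dagger}$; $(\mu,\nu)$ is an $\varepsilon$-NE if $\mathrm{NEGap}(\mu,\nu)\le\varepsilon$. Write $\mu_{1:h}(x_h,a_h)$ for the product of the $\mu$-probabilities of $a_h$ at $x_h$ and of all the player's own earlier actions leading to $x_h$. For a layer $h$ let $\mu^{\star,h}$ be the balanced exploration policy: at an infoset $x_{h'}$ of layer $h'<h$ it plays $a$ with probability $|\mathcal C_h(x_{h'},a)|/|\mathcal C_h(x_{h'})|$, where $\mathcal C_h(\cdot)$ denotes the set of infosets of layer $h$ reachable from the argument,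 and at layers $h'\ge h$ it plays uniformly. Algorithm (self-play of Balanced CFR with Regret Matching). Start from uniform policies $\mu^1,\nu^1$. In round $t$, for each $h\in[H]$ an episode is played with $\mu^{\star,h}_{1:h}\mu^t_{h+1:H}$ (that is, $\mu^{\star,h}$ in layers $\le h$ and $\mu^t$ afterwards) against $\nu^t$, and symmetrically, for each $h\in[H]$, an episode is played with $\mu^t$ against $\nu^{\star,h}_{1:h}\nu^t_{h+1:H}$. From the $h$-th of her episodes the max-player forms, at every infoset $x_h$ of layer $h$, the estimator $$\widetilde L^t_h(x_h,a)=\frac{\mathbf 1\{(x_h,a)\text{ is visited}\}}{\mu^{\star,h}_{1:h}(x_h,a)}\Big(H-h+1-\sum_{h'=h}^H r_{h'}\Big),$$ and the min-player forms the analogous one, with $\sum_{h'=h}^H r_{h'}$ in place of the bracket. Each player then updates the policy at each infoset by regret matching: $\mu_h^{t+1}(a|x_h)\propto[R^t_{x_h}(a)]_+$ (uniform if all $[R^t_{x_h}(a)]_+$ vanish), where $R^t_{x_h}(a)=\sum_{\tau\le t}\big(\langle\mu^\tau_h(\cdot|x_h),\widetilde L^\tau_h(x_h,\cdot)\rangle-\widetilde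 L^\tau_h(x_h,a)\big)$, and analogously for $\nu^{t+1}$. Statement. There are absolute constants $C,C'>0$ such that for every such game, all $\delta\in(0,1)$ and $\varepsilon>0$, with $\iota=\log(10(XA+YB)/\delta)$: if $$T\ge C\,H^3(XA^2+YB^2)\,\iota/\varepsilon^2,$$ then after $T$ rounds the averages $\bar\mu,\bar\nu$, in sequence form, of the policies $\mu^1,\dots,\mu^T$ and $\nu^1,\dots,\nu^T$ form an $\varepsilon$-NE with probability at least $1-\delta$. The number of episodes played in $T$ rounds is $2HT$; for the smallest $T$ satisfying the above bound, and $\varepsilon\le H$, it is at most $C'H^4(XA^2+YB^2)\,\iota/\varepsilon^2$. -/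

import Mathlib

open MeasureTheory ProbabilityTheory
open scoped ENNReal

/-- The combinatorial structure of a game tree with `H` layers (layer `h` of the text is
`h - 1 : Fin H` here): every node below the first layer has a unique parent node, one layer above,
and a unique edge (action) that leads from this parent to it. Hence every node has a unique history
`(n₁, e₁, …, n_{h-1}, e_{h-1})` that leads to it. -/
structure LayeredTree (H : ℕ) (N E : Type*) where
  layer : N → Fin H
  parent : N → Option (N × E)
  parent_eq_none_iff : ∀ n, parent n = none ↔ (layer n : ℕ) = 0
  layer_parent : ∀ n m e, parent n = some (m, e) → (layer m : ℕ) + 1 = layer n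

namespace LayeredTree

variable {H : ℕ} {N E : Type*}

/-- `Leads m e n`: the pair `(m, e)` occurs in the history of `n`, i.e. `n` is reachable
from `(m, e)`. -/
inductive Leads (𝒯 : LayeredTree H N E) : N → E → N → Prop
  | child {m : N} {e : E} {n : N} : 𝒯.parent n = some (m, e) → Leads 𝒯 m e n
  | descend {m : N} {e : E} {k : N} {f : E} {n : N} :
      Leads 𝒯 m e k → 𝒯.parent n = some (k, f) → Leads 𝒯 m e n

/-- Product of the `μ`-probabilities of the actions in the history of `n`:
`μ_{1:h-1}(x_h)` for an infoset `x_h` of layer `h`. -/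
noncomputable def reach (𝒯 : LayeredTree H N E) (μ : N → E → ℝ) (n : N) : ℝ :=
  match _h : 𝒯.parent n with
  | none => 1
  | some (m, e) => reach 𝒯 μ m * μ m e
termination_by (𝒯.layer n : ℕ)
decreasing_by
  have := 𝒯.layer_parent _ _ _ _h
  omega

/-- The sequence form `μ_{1:h}(x_h, a_h)`. -/
noncomputable def seqForm (𝒯 : LayeredTree H N E) (μ : N → E → ℝ) (n : N) (e : E) : ℝ :=
  𝒯.reach μ n * μ n e

open Classical in
/-- `C_h(x, a)`: the nodes of layer `h` that are reachable from `(x, a)`. -/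
noncomputable def descEdge [Fintype N] (𝒯 : LayeredTree H N E) (h : Fin H) (n : N) (e : E) :
    Finset N :=
  Finset.univ.filter fun m => 𝒯.layer m = h ∧ 𝒯.Leads n e m

open Classical in
/-- `C_h(x) = ⋃ₐ C_h(x, a)`. -/
noncomputable def desc [Fintype N] [Fintype E] (𝒯 : LayeredTree H N E) (h : Fin H) (n : N) :
    Finset N :=
  Finset.univ.biUnion fun e => 𝒯.descEdge h n e

/-- The balanced exploration policy `μ^{⋆,h}`. -/
noncomputable def balanced [Fintype N] [Fintype E] (𝒯 : LayeredTree H N E) (h : Fin H)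
    (n : N) (e : E) : ℝ :=
  if 𝒯.layer n < h then ((𝒯.descEdge h n e).card : ℝ) / ((𝒯.desc h n).card : ℝ)
  else 1 / (Fintype.card E : ℝ)

/-- The sampling policy `μ^{⋆,h}_{1:h} μ_{h+1:H}`. -/
noncomputable def explore [Fintype N] [Fintype E] (𝒯 : LayeredTree H N E) (μ : N → E → ℝ)
    (h : Fin H) (n : N) (e : E) : ℝ :=
  if 𝒯.layer n ≤ h then 𝒯.balanced h n e else μ n e

open Classical in
/-- The importance-weighted estimator `L̃_h(x, a)`, `h` being the layer of `x`, computed from an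
episode in which the player sees infosets and plays actions `traj` and suffers the losses `g`. -/
noncomputable def lossEst [Fintype N] [Fintype E] (𝒯 : LayeredTree H N E)
    (traj : Fin H → N × E) (g : Fin H → ℝ) (n : N) (e : E) : ℝ :=
  (if traj (𝒯.layer n) = (n, e) then 1 else 0)
    / 𝒯.seqForm (𝒯.balanced (𝒯.layer n)) n e * ∑ h ∈ Finset.Ici (𝒯.layer n), g h

/-- The average of the policies `μ 0, …, μ (T - 1)` in sequence form, written as a
conditional policy. -/
noncomputable def avgPolicy (𝒯 : LayeredTree H N E) {T : ℕ} (μ : Fin T → N → E → ℝ)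
    (n : N) (e : E) : ℝ :=
  (∑ t, 𝒯.seqForm (μ t) n e) / ∑ t, 𝒯.reach (μ t) n

end LayeredTree

/-- `μ` is a policy: a probability distribution over the actions at every infoset. -/
def IsPolicy {X A : Type*} [Fintype A] (μ : X → A → ℝ) : Prop :=
  ∀ x, μ x ∈ stdSimplex ℝ A

open Classical in
/-- Regret matching: the distribution computed from cumulative regrets `R`. -/
noncomputable def rmDist {A : Type*} [Fintype A] (R : A → ℝ) (a : A) : ℝ :=
  if ∑ a', max (R a') 0 = 0 then 1 / (Fintype.card A : ℝ)
  else max (R a) 0 / ∑ a', max (R a') 0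

/-- Regret matching: the cumulative regrets `R_t` after receiving the loss vectors
`ℓ 0, …, ℓ (t - 1)`; the distribution played next is `rmDist` of it. -/
noncomputable def rmRegret {A : Type*} [Fintype A] : (t : ℕ) → (Fin t → A → ℝ) → A → ℝ
  | 0, _, _ => 0
  | t + 1, ℓ, a =>
      rmRegret t (fun τ => ℓ τ.castSucc) a
        + ((∑ a', rmDist (rmRegret t fun τ => ℓ τ.castSucc) a' * ℓ (Fin.last t) a')
          - ℓ (Fin.last t) a)

/-- A two-player zero-sum imperfect-information extensive-form game, i.e. a tree-structured
partially observable Markov game with perfect recall. -/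
structure IIEFG (H : ℕ) (S X Y A B : Type*) where
  /-- tree structure of the states, the edges being the pairs of actions -/
  stateTree : LayeredTree H S (A × B)
  /-- tree of the infosets of the max-player -/
  maxTree : LayeredTree H X A
  /-- tree of the infosets of the min-player -/
  minTree : LayeredTree H Y B
  /-- emission functions -/
  infoX : S → X
  infoY : S → Y
  infoX_surjective : Function.Surjective infoX
  infoY_surjective : Function.Surjective infoY
  layer_infoX : ∀ s, maxTree.layer (infoX s) = stateTree.layer s
  layer_infoY : ∀ s, minTree.layer (infoY s) = stateTree.layer s
  /-- perfect recall -/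
  recallX : ∀ s s' a b, stateTree.parent s = some (s', a, b) →
    maxTree.parent (infoX s) = some (infoX s', a)
  recallY : ∀ s s' a b, stateTree.parent s = some (s', a, b) →
    minTree.parent (infoY s) = some (infoY s', b)
  /-- initial distribution, on the first layer -/
  init : PMF S
  init_support : ∀ s, init s ≠ 0 → (stateTree.layer s : ℕ) = 0
  /-- transition probabilities, along the tree (the values at the last layer are never used) -/
  trans : S → A → B → PMF S
  trans_support : ∀ s a b s', (stateTree.layer s : ℕ) + 1 < H → trans s a b s' ≠ 0 →
    stateTree.parent s' = some (s, a, b)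
  /-- distribution of the random reward `r_h(s_h, a_h, b_h) ∈ [0, 1]` -/
  reward : S → A → B → Measure ℝ
  reward_prob : ∀ s a b, IsProbabilityMeasure (reward s a b)
  reward_mem : ∀ s a b, ∀ᵐ r ∂(reward s a b), r ∈ Set.Icc (0 : ℝ) 1

/-- The states and actions `(s_h, a_h, b_h)` of an episode (a discrete space). -/
def Play (H : ℕ) (S A B : Type*) : Type _ := Fin H → S × A × B

instance (H : ℕ) (S A B : Type*) : MeasurableSpace (Play H S A B) := ⊤

instance (H : ℕ) (S A B : Type*) [Fintype S] [Fintype A] [Fintype B] :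
    Fintype (Play H S A B) :=
  inferInstanceAs (Fintype (Fin H → S × A × B))

/-- An episode: states and actions, and the realized rewards. -/
abbrev Episode (H : ℕ) (S A B : Type*) : Type _ := Play H S A B × (Fin H → ℝ)

/-- The `2H` episodes of a round of self-play: in episode `inl h` the max-player explores layer
`h`, in episode `inr h` the min-player does. -/
abbrev Round (H : ℕ) (S A B : Type*) : Type _ := Fin H ⊕ Fin H → Episode H S A B

/-- Number of episodes played in `T` rounds of self-play. -/
def numEpisodes (H T : ℕ) : ℕ := Fintype.card (Fin T × (Fin H ⊕ Fin H))

namespace IIEFG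

variable {H : ℕ} {S X Y A B : Type*}

/-- Probability that step `h` of a play moves to its state, given the previous step. -/
noncomputable def stepProb (G : IIEFG H S X Y A B) (π : Play H S A B) (h : Fin H) : ℝ≥0∞ :=
  if (h : ℕ) = 0 then G.init (π h).1
  else
    let q := π ⟨(h : ℕ) - 1, by omega⟩
    G.trans q.1 q.2.1 q.2.2 (π h).1

/-- Probability of a play under the product policy `(μ, ν)`. -/
noncomputable def playProb (G : IIEFG H S X Y A B) (μ : X → A → ℝ) (ν : Y → B → ℝ)
    (π : Play H S A B) : ℝ≥0∞ :=
  ∏ h, G.stepProb π h * ENNReal.ofReal (μ (G.infoX (π h).1) (π h).2.1)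
    * ENNReal.ofReal (ν (G.infoY (π h).1) (π h).2.2)

/-- Law of an episode under `(μ, ν)`: given the play, each reward is drawn independently from the
reward distribution of its step. -/
noncomputable def episodeLaw [Fintype S] [Fintype A] [Fintype B] (G : IIEFG H S X Y A B)
    (μ : X → A → ℝ) (ν : Y → B → ℝ) : Measure (Episode H S A B) :=
  ∑ π : Play H S A B, G.playProb μ ν π •
    (Measure.dirac π).prod (Measure.pi fun h => G.reward (π h).1 (π h).2.1 (π h).2.2)

/-- The game value `V^{μ,ν}`. -/
noncomputable def value [Fintype S] [Fintype A] [Fintype B] (G : IIEFG H S X Y A B)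
    (μ : X → A → ℝ) (ν : Y → B → ℝ) : ℝ :=
  ∫ e, ∑ h, e.2 h ∂(G.episodeLaw μ ν)

noncomputable def NEGap [Fintype S] [Fintype A] [Fintype B] (G : IIEFG H S X Y A B)
    (μ : X → A → ℝ) (ν : Y → B → ℝ) : ℝ :=
  (⨆ μ' : {μ' : X → A → ℝ // IsPolicy μ'}, G.value μ' ν)
    - ⨅ ν' : {ν' : Y → B → ℝ // IsPolicy ν'}, G.value μ ν'

/-- `(μ, ν)` is an `ε`-approximate Nash equilibrium. -/
def IsApproxNE [Fintype S] [Fintype A] [Fintype B] (G : IIEFG H S X Y A B) (ε : ℝ)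
    (μ : X → A → ℝ) (ν : Y → B → ℝ) : Prop :=
  IsPolicy μ ∧ IsPolicy ν ∧ G.NEGap μ ν ≤ ε

/-- The max-player's estimator `L̃_h^t(x, a)` from the data of a round: it uses the episode in which
she explored the layer of `x`, with losses `1 - r_h`. -/
noncomputable def maxLossEst [Fintype X] [Fintype A] (G : IIEFG H S X Y A B)
    (ρ : Round H S A B) (x : X) (a : A) : ℝ :=
  let e := ρ (Sum.inl (G.maxTree.layer x))
  G.maxTree.lossEst (fun h => (G.infoX (e.1 h).1, (e.1 h).2.1)) (fun h => 1 - e.2 h) x a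

/-- The min-player's estimator, with losses `r_h`. -/
noncomputable def minLossEst [Fintype Y] [Fintype B] (G : IIEFG H S X Y A B)
    (ρ : Round H S A B) (y : Y) (b : B) : ℝ :=
  let e := ρ (Sum.inr (G.minTree.layer y))
  G.minTree.lossEst (fun h => (G.infoY (e.1 h).1, (e.1 h).2.2)) (fun h => e.2 h) y b

/-- The policy `μ^{t+1}` that Balanced CFR with regret matching maintains after `t` rounds. -/
noncomputable def maxPolicy [Fintype X] [Fintype A] (G : IIEFG H S X Y A B) (t : ℕ)
    (ω : Fin t → Round H S A B) (x : X) (a : A) : ℝ :=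
  rmDist (rmRegret t fun τ => G.maxLossEst (ω τ) x) a

/-- The policy `ν^{t+1}` maintained by the min-player after `t` rounds. -/
noncomputable def minPolicy [Fintype Y] [Fintype B] (G : IIEFG H S X Y A B) (t : ℕ)
    (ω : Fin t → Round H S A B) (y : Y) (b : B) : ℝ :=
  rmDist (rmRegret t fun τ => G.minLossEst (ω τ) y) b

/-- Policies used by the two players in episode `i` of a round, when they maintain `μ` and `ν`. -/
noncomputable def maxPlayed [Fintype X] [Fintype A] (G : IIEFG H S X Y A B) (μ : X → A → ℝ)
    (i : Fin H ⊕ Fin H) : X → A → ℝ :=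
  Sum.elim (fun h => G.maxTree.explore μ h) (fun _ => μ) i

noncomputable def minPlayed [Fintype Y] [Fintype B] (G : IIEFG H S X Y A B) (ν : Y → B → ℝ)
    (i : Fin H ⊕ Fin H) : Y → B → ℝ :=
  Sum.elim (fun _ => ν) (fun h => G.minTree.explore ν h) i

variable [Fintype S] [Fintype X] [Fintype Y] [Fintype A] [Fintype B]

/-- Law of the `2H` episodes of a round in which the players maintain `μ` and `ν`. -/
noncomputable def roundLaw (G : IIEFG H S X Y A B) (μ : X → A → ℝ) (ν : Y → B → ℝ) :
    Measure (Round H S A B) :=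
  Measure.pi fun i => G.episodeLaw (G.maxPlayed μ i) (G.minPlayed ν i)

theorem playProb_ne_top (G : IIEFG H S X Y A B) (μ : X → A → ℝ) (ν : Y → B → ℝ)
    (π : Play H S A B) : G.playProb μ ν π ≠ ⊤ := by
  refine ENNReal.prod_ne_top fun h _ => ?_
  refine ENNReal.mul_ne_top (ENNReal.mul_ne_top ?_ ENNReal.ofReal_ne_top) ENNReal.ofReal_ne_top
  unfold stepProb
  split_ifs
  · exact PMF.apply_ne_top _ _
  · exact PMF.apply_ne_top _ _

instance (G : IIEFG H S X Y A B) (s : S) (a : A) (b : B) :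
    IsProbabilityMeasure (G.reward s a b) := G.reward_prob s a b

instance (G : IIEFG H S X Y A B) (μ : X → A → ℝ) (ν : Y → B → ℝ) :
    IsFiniteMeasure (G.episodeLaw μ ν) := by
  refine ⟨?_⟩
  unfold episodeLaw
  rw [Measure.finsetSum_apply]
  refine ENNReal.sum_lt_top.2 fun π _ => ?_
  rw [Measure.smul_apply, smul_eq_mul]
  exact ENNReal.mul_lt_top (G.playProb_ne_top μ ν π).lt_top (measure_lt_top _ _)

instance (G : IIEFG H S X Y A B) (μ : X → A → ℝ) (ν : Y → B → ℝ) :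
    IsFiniteMeasure (G.roundLaw μ ν) := by
  unfold roundLaw; infer_instance

end IIEFG

theorem measurable_rmDist {Ω A : Type*} [MeasurableSpace Ω] [Fintype A] {R : Ω → A → ℝ}
    (hR : ∀ a, Measurable fun ω => R ω a) (a : A) : Measurable fun ω => rmDist (R ω) a := by
  have hs : Measurable fun ω => ∑ a', max (R ω a') 0 :=
    Finset.measurable_sum _ fun a' _ => (hR a').max measurable_const
  unfold rmDist
  exact Measurable.ite (hs (measurableSet_singleton 0)) measurable_const
    (((hR a).max measurable_const).div hs)

theorem measurable_rmRegret {Ω A : Type*} [MeasurableSpace Ω] [Fintype A] (t : ℕ)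
    {ℓ : Ω → Fin t → A → ℝ} (h : ∀ τ a, Measurable fun ω => ℓ ω τ a) (a : A) :
    Measurable fun ω => rmRegret t (ℓ ω) a := by
  induction t generalizing a with
  | zero => simp only [rmRegret]; exact measurable_const
  | succ t ih =>
    have h1 : ∀ a, Measurable fun ω => rmRegret t (fun τ => ℓ ω τ.castSucc) a := fun a =>
      ih (ℓ := fun ω τ => ℓ ω τ.castSucc) (fun τ a => h τ.castSucc a) a
    simp only [rmRegret]
    exact (h1 a).add ((Finset.measurable_sum _ fun a' _ =>
      (measurable_rmDist h1 a').mul (h _ a')).sub (h _ a))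

theorem LayeredTree.measurable_lossEst {Ω : Type*} [MeasurableSpace Ω] {H : ℕ} {N E : Type*}
    [Fintype N] [Fintype E] (𝒯 : LayeredTree H N E) {traj : Ω → Fin H → N × E}
    {g : Ω → Fin H → ℝ} (htraj : ∀ h q, MeasurableSet {ω | traj ω h = q})
    (hg : ∀ h, Measurable fun ω => g ω h) (n : N) (e : E) :
    Measurable fun ω => 𝒯.lossEst (traj ω) (g ω) n e := by
  unfold lossEst
  exact ((Measurable.ite (htraj _ _) measurable_const measurable_const).div
    measurable_const).mul (Finset.measurable_sum _ fun h _ => hg h)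

namespace IIEFG

variable {H : ℕ} {S X Y A B : Type*} [Fintype S] [Fintype X] [Fintype Y] [Fintype A] [Fintype B]

theorem measurableSet_play (P : Play H S A B → Prop) (i : Fin H ⊕ Fin H) :
    MeasurableSet {ρ : Round H S A B | P (ρ i).1} := by
  have h : Measurable fun ρ : Round H S A B => (ρ i).1 := measurable_fst.comp (measurable_pi_apply i)
  exact h (t := {π | P π}) trivial

theorem measurable_maxPolicy (G : IIEFG H S X Y A B) (t : ℕ) (x : X) (a : A) :
    Measurable fun ω : Fin t → Round H S A B => G.maxPolicy t ω x a := by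
  unfold maxPolicy
  refine measurable_rmDist (fun a => measurable_rmRegret t (fun τ a => ?_) a) a
  have h : Measurable fun ρ : Round H S A B => G.maxLossEst ρ x a := by
    unfold maxLossEst
    refine LayeredTree.measurable_lossEst _ (fun h q => measurableSet_play
      (fun π => (G.infoX (π h).1, (π h).2.1) = q) _) (fun h => ?_) x a
    exact measurable_const.sub
      ((measurable_pi_apply h).comp (measurable_snd.comp (measurable_pi_apply _)))
  exact h.comp (measurable_pi_apply τ)

theorem measurable_minPolicy (G : IIEFG H S X Y A B) (t : ℕ) (y : Y) (b : B) :
    Measurable fun ω : Fin t → Round H S A B => G.minPolicy t ω y b := by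
  unfold minPolicy
  refine measurable_rmDist (fun a => measurable_rmRegret t (fun τ b => ?_) a) b
  have h : Measurable fun ρ : Round H S A B => G.minLossEst ρ y b := by
    unfold minLossEst
    refine LayeredTree.measurable_lossEst _ (fun h q => measurableSet_play
      (fun π => (G.infoY (π h).1, (π h).2.2) = q) _) (fun h => ?_) y b
    exact (measurable_pi_apply h).comp (measurable_snd.comp (measurable_pi_apply _))
  exact h.comp (measurable_pi_apply τ)

theorem measurable_episodeLaw {Ω : Type*} [MeasurableSpace Ω] (G : IIEFG H S X Y A B)
    {μ : Ω → X → A → ℝ} {ν : Ω → Y → B → ℝ} (hμ : ∀ x a, Measurable fun ω => μ ω x a)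
    (hν : ∀ y b, Measurable fun ω => ν ω y b) {s : Set (Episode H S A B)} :
    Measurable fun ω => G.episodeLaw (μ ω) (ν ω) s := by
  unfold episodeLaw
  simp only [Measure.finsetSum_apply, Measure.smul_apply, smul_eq_mul]
  refine Finset.measurable_sum _ fun π _ => Measurable.mul_const ?_ _
  unfold playProb
  exact Finset.measurable_prod _ fun h _ =>
    ((hμ _ _).ennreal_ofReal.const_mul _).mul (hν _ _).ennreal_ofReal

theorem measurable_roundLaw {Ω : Type*} [MeasurableSpace Ω] (G : IIEFG H S X Y A B)
    {μ : Ω → X → A → ℝ} {ν : Ω → Y → B → ℝ} (hμ : ∀ x a, Measurable fun ω => μ ω x a)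
    (hν : ∀ y b, Measurable fun ω => ν ω y b) :
    Measurable fun ω => G.roundLaw (μ ω) (ν ω) := by
  have hX : ∀ i x a, Measurable fun ω => G.maxPlayed (μ ω) i x a := by
    rintro (h | h) x a
    · simp only [maxPlayed, Sum.elim_inl, LayeredTree.explore]
      split_ifs
      · exact measurable_const
      · exact hμ x a
    · exact hμ x a
  have hY : ∀ i y b, Measurable fun ω => G.minPlayed (ν ω) i y b := by
    rintro (h | h) y b
    · exact hν y b
    · simp only [minPlayed, Sum.elim_inr, LayeredTree.explore]
      split_ifs
      · exact measurable_const
      · exact hν y b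
  have hbox : ∀ s : Fin H ⊕ Fin H → Set (Episode H S A B),
      Measurable fun ω => G.roundLaw (μ ω) (ν ω) (Set.univ.pi s) := by
    intro s
    unfold roundLaw
    simp only [Measure.pi_pi]
    exact Finset.measurable_prod _ fun i _ => G.measurable_episodeLaw (hX i) (hY i)
  refine Measurable.measure_of_isPiSystem (generateFrom_pi (ι := Fin H ⊕ Fin H)).symm
    isPiSystem_pi ?_ ?_
  · rintro _ ⟨s, -, rfl⟩
    exact hbox s
  · simpa using hbox fun _ => Set.univ

/-- The conditional law of the next round given the previous `t` rounds. -/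
noncomputable def roundKernel (G : IIEFG H S X Y A B) (t : ℕ) :
    Kernel (Fin t → Round H S A B) (Round H S A B) where
  toFun ω := G.roundLaw (G.maxPolicy t ω) (G.minPolicy t ω)
  measurable' := G.measurable_roundLaw (G.measurable_maxPolicy t) (G.measurable_minPolicy t)

/-- Law of the data of `T` rounds of self-play of Balanced CFR with regret matching. -/
noncomputable def selfPlayLaw (G : IIEFG H S X Y A B) : (T : ℕ) → Measure (Fin T → Round H S A B)
  | 0 => Measure.dirac Fin.elim0
  | T + 1 => (selfPlayLaw G T ⊗ₘ G.roundKernel T).map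
      fun q => Fin.snoc (α := fun _ => Round H S A B) q.1 q.2

/-- The policy `μ^{t+1}` of the max-player in a run of `T` rounds. -/
noncomputable def maxIterate (G : IIEFG H S X Y A B) {T : ℕ} (ω : Fin T → Round H S A B)
    (t : Fin T) : X → A → ℝ :=
  G.maxPolicy t fun τ => ω (Fin.castLE t.isLt.le τ)

/-- The policy `ν^{t+1}` of the min-player in a run of `T` rounds. -/
noncomputable def minIterate (G : IIEFG H S X Y A B) {T : ℕ} (ω : Fin T → Round H S A B)
    (t : Fin T) : Y → B → ℝ :=
  G.minPolicy t fun τ => ω (Fin.castLE t.isLt.le τ)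

end IIEFG

/-! The expected loss is linear in the sequence form. Hence `T` times the duality gap of the
averaged policies, against fixed comparators, is the sum of the two players' regrets over the
iterates (`card_mul_sum_eq` type bookkeeping is in `card_mul_value_sub_value_eq`). It suffices to
bound each regret by `ε T / 2`, with chance and the opponent treated as one weight on plays
(`IsOpponentWeight`).

For one player, the regret against `μ'` is a sum over infosets `x` of local regrets for
counterfactual losses, weighted by the reach probability of `μ'` (`expLoss_sub_expLoss`). Each local
regret splits into the overestimation of the comparator's loss, the underestimation of the loss of
the iterates, and the regret of regret matching on the estimates. The last is controlled by the
squared estimated regrets (`rmRegret_le`). Importance weighting makes the estimators unbiased. With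
`m` the probability that balanced exploration reaches `x`, they are of size `A H / m`, but they are
nonzero only on visits, so their second moments carry a factor `1 / m` instead of `1 / m ^ 2`.

The random quantities are handled by exponential supermartingales, `A + 2` of them per infoset,
whose compensators are expressed through counterfactual visit probabilities
(`lintegral_exp_deviation_le`, `lintegral_exp_sum_le_one`). Outside the exceptional events the local
regret is at most a constant over `m` plus a multiple of visit probabilities that does not involve
`m` (`sum_regret_le_of_deviation_le`). Two identities then remove the dependence on the comparator.
The ratios of the reach of `μ'` to `m` sum to at most `X` (`sum_reach_div_balanced_le`), and the
weighted visit probabilities sum to `H` (`sum_reach_mul_visit`), since one infoset is visited per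
layer. So the number of infosets multiplies only the terms that do not grow with `T`.

The exceptional events do not mention `μ'`, so a union bound over infosets and actions suffices, and
all comparators are treated at once. Tuning the two free parameters to order `ε / (A H ^ 3)` and `ε
/ (A H ^ 2)` gives the stated number of rounds. -/

set_option linter.unusedSectionVars false

/-! ### Reach probabilities, sequence-form averages and histories in a layered tree. -/

namespace LayeredTree

variable {H : ℕ} {N E : Type*}

theorem reach_of_parent_none (𝒯 : LayeredTree H N E) (μ : N → E → ℝ) {n : N}
    (h : 𝒯.parent n = none) : 𝒯.reach μ n = 1 := by
  rw [reach]
  split <;> simp_all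

theorem reach_of_parent_some (𝒯 : LayeredTree H N E) (μ : N → E → ℝ) {n m : N} {e : E}
    (h : 𝒯.parent n = some (m, e)) : 𝒯.reach μ n = 𝒯.seqForm μ m e := by
  rw [reach, seqForm]
  split
  · simp_all
  · rename_i m' e' h'
    rw [h] at h'
    obtain ⟨rfl, rfl⟩ : m = m' ∧ e = e' := by simpa using h'
    rfl

/-- Induction along the histories of a tree. -/
theorem parent_induction (𝒯 : LayeredTree H N E) {P : N → Prop}
    (h0 : ∀ n, 𝒯.parent n = none → P n)
    (h1 : ∀ n m e, 𝒯.parent n = some (m, e) → P m → P n) (n : N) : P n := by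
  induction hk : (𝒯.layer n : ℕ) generalizing n with
  | zero => exact h0 n ((𝒯.parent_eq_none_iff n).2 hk)
  | succ k ih =>
    match hp : 𝒯.parent n with
    | none => exact h0 n hp
    | some (m, e) =>
      exact h1 n m e hp (ih m (by have := 𝒯.layer_parent _ _ _ hp; omega))

theorem reach_nonneg (𝒯 : LayeredTree H N E) {μ : N → E → ℝ} (hμ : ∀ n e, 0 ≤ μ n e) (n : N) :
    0 ≤ 𝒯.reach μ n := by
  induction n using 𝒯.parent_induction with
  | h0 n h => rw [𝒯.reach_of_parent_none μ h]; exact zero_le_one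
  | h1 n m e h ih => rw [𝒯.reach_of_parent_some μ h, seqForm]; exact mul_nonneg ih (hμ _ _)

theorem reach_pos (𝒯 : LayeredTree H N E) {μ : N → E → ℝ} (hμ : ∀ n e, 0 < μ n e) (n : N) :
    0 < 𝒯.reach μ n := by
  induction n using 𝒯.parent_induction with
  | h0 n h => rw [𝒯.reach_of_parent_none μ h]; exact zero_lt_one
  | h1 n m e h ih => rw [𝒯.reach_of_parent_some μ h, seqForm]; exact mul_pos ih (hμ _ _)

/-- A sequence of nodes and edges that descends through all layers of the tree. -/
structure IsPath (𝒯 : LayeredTree H N E) (o : Fin H → N × E) : Prop where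
  layer_eq : ∀ h, 𝒯.layer (o h).1 = h
  parent_eq : ∀ h h' : Fin H, (h : ℕ) + 1 = h' → 𝒯.parent (o h').1 = some (o h)

theorem IsPath.reach_eq_prod {𝒯 : LayeredTree H N E} {o : Fin H → N × E} (ho : 𝒯.IsPath o)
    (μ : N → E → ℝ) (h : Fin H) :
    𝒯.reach μ (o h).1 = ∏ j with j < h, μ (o j).1 (o j).2 := by
  obtain ⟨k, hk⟩ := h
  induction k with
  | zero =>
    rw [𝒯.reach_of_parent_none μ ((𝒯.parent_eq_none_iff _).2 (by rw [ho.layer_eq]))]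
    rw [Finset.filter_false_of_mem, Finset.prod_empty]
    intro j _
    simp [Fin.lt_def]
  | succ k ih =>
    have hk' : k < H := by omega
    rw [𝒯.reach_of_parent_some μ (ho.parent_eq ⟨k, hk'⟩ ⟨k + 1, hk⟩ rfl), seqForm, ih hk']
    have : (Finset.univ.filter fun j : Fin H => j < ⟨k + 1, hk⟩)
        = insert ⟨k, hk'⟩ (Finset.univ.filter fun j : Fin H => j < ⟨k, hk'⟩) := by
      ext j
      simp only [Finset.mem_filter, Finset.mem_univ, true_and, Finset.mem_insert, Fin.lt_def,
        Fin.ext_iff]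
      omega
    rw [this, Finset.prod_insert (by simp), mul_comm]

/-- The conditional probabilities of the average telescope along a history: each denominator cancels
the numerator of the previous layer. Positivity of the denominators excludes the convention `0 / 0 =
0`, which would break the cancellation. -/
theorem reach_avgPolicy (𝒯 : LayeredTree H N E) {T : ℕ} (hT : 0 < T) {μ : Fin T → N → E → ℝ}
    (hμ : ∀ n, 0 < ∑ t, 𝒯.reach (μ t) n) (n : N) :
    𝒯.reach (𝒯.avgPolicy μ) n = (∑ t, 𝒯.reach (μ t) n) / T := by
  have hT' : (T : ℝ) ≠ 0 := by positivity
  induction n using 𝒯.parent_induction with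
  | h0 n h => simp [𝒯.reach_of_parent_none _ h, hT']
  | h1 n m e h ih =>
    simp only [𝒯.reach_of_parent_some _ h]
    rw [seqForm, ih, avgPolicy]
    have := (hμ m).ne'
    field_simp

theorem seqForm_avgPolicy (𝒯 : LayeredTree H N E) {T : ℕ} (hT : 0 < T) {μ : Fin T → N → E → ℝ}
    (hμ : ∀ n, 0 < ∑ t, 𝒯.reach (μ t) n) (n : N) (e : E) :
    𝒯.seqForm (𝒯.avgPolicy μ) n e = (∑ t, 𝒯.seqForm (μ t) n e) / T := by
  have hT' : (T : ℝ) ≠ 0 := by positivity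
  rw [seqForm, 𝒯.reach_avgPolicy hT hμ, avgPolicy]
  have := (hμ n).ne'
  field_simp

theorem isPolicy_avgPolicy [Fintype E] (𝒯 : LayeredTree H N E) {T : ℕ} {μ : Fin T → N → E → ℝ}
    (hp : ∀ t, IsPolicy (μ t)) (hμ : ∀ n, 0 < ∑ t, 𝒯.reach (μ t) n) :
    IsPolicy (𝒯.avgPolicy μ) := by
  intro n
  refine ⟨fun e => ?_, ?_⟩
  · refine div_nonneg (Finset.sum_nonneg fun t _ => ?_) (hμ n).le
    exact mul_nonneg (𝒯.reach_nonneg (fun n e => (hp t n).1 e) n) ((hp t n).1 e)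
  · simp only [avgPolicy]
    rw [← Finset.sum_div, Finset.sum_comm, div_eq_one_iff_eq (hμ n).ne']
    refine Finset.sum_congr rfl fun t _ => ?_
    simp only [seqForm]
    rw [← Finset.mul_sum, (hp t n).2, mul_one]

/-- The product along a full path is the sequence form at its last node, which is where averaging is
linear. -/
theorem IsPath.prod_avgPolicy {𝒯 : LayeredTree H N E} {o : Fin H → N × E} (ho : 𝒯.IsPath o)
    {T : ℕ} (hT : 0 < T) {μ : Fin T → N → E → ℝ} (hμ : ∀ n, 0 < ∑ t, 𝒯.reach (μ t) n) :
    ∏ h, 𝒯.avgPolicy μ (o h).1 (o h).2 = (∑ t, ∏ h, μ t (o h).1 (o h).2) / T := by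
  rcases H with _ | H
  · have : (T : ℝ) ≠ 0 := by positivity
    simp [this]
  · have key : ∀ ν : N → E → ℝ, ∏ h, ν (o h).1 (o h).2
        = 𝒯.seqForm ν (o (Fin.last H)).1 (o (Fin.last H)).2 := by
      intro ν
      have hu : (Finset.univ : Finset (Fin (H + 1)))
          = insert (Fin.last H) (Finset.univ.filter (· < Fin.last H)) := by
        ext j
        simpa using (Fin.le_last j).eq_or_lt
      rw [seqForm, ho.reach_eq_prod, mul_comm, hu, Finset.prod_insert (by simp), ← hu]
    simp only [key]
    exact 𝒯.seqForm_avgPolicy hT hμ _ _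

theorem Leads.layer_lt {𝒯 : LayeredTree H N E} {m n : N} {e : E} (h : 𝒯.Leads m e n) :
    𝒯.layer m < 𝒯.layer n := by
  induction h with
  | child h => have := 𝒯.layer_parent _ _ _ h; rw [Fin.lt_def]; omega
  | descend _ h ih => have := 𝒯.layer_parent _ _ _ h; rw [Fin.lt_def] at *; omega

/-- Parents are unique, so two histories of the same node agree layer by layer; if one stops
earlier, the layers cannot match. -/
theorem Leads.unique {𝒯 : LayeredTree H N E} {m m' n : N} {e e' : E} (h : 𝒯.Leads m e n)
    (h' : 𝒯.Leads m' e' n) (hl : 𝒯.layer m = 𝒯.layer m') : m = m' ∧ e = e' := by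
  induction h with
  | child h =>
    cases h' with
    | child h' => rw [h] at h'; simpa using h'
    | descend h1 h' =>
      rw [h] at h'
      obtain ⟨rfl, rfl⟩ := by simpa using h'
      exact absurd (h1.layer_lt) (by rw [hl]; exact lt_irrefl _)
  | descend h1 h ih =>
    cases h' with
    | child h' =>
      rw [h] at h'
      obtain ⟨rfl, rfl⟩ := by simpa using h'
      exact absurd (h1.layer_lt) (by rw [hl]; exact lt_irrefl _)
    | descend h2 h' =>
      rw [h] at h'
      obtain ⟨rfl, rfl⟩ := by simpa using h'
      exact ih h2

theorem Leads.trans {𝒯 : LayeredTree H N E} {l m n : N} {e f : E} (h : 𝒯.Leads l e m)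
    (h' : 𝒯.Leads m f n) : 𝒯.Leads l e n := by
  induction h' with
  | child h' => exact .descend h h'
  | descend _ h' ih => exact .descend ih h'

theorem exists_leads (𝒯 : LayeredTree H N E) (n : N) (k : Fin H) (hk : k < 𝒯.layer n) :
    ∃ q : N × E, 𝒯.layer q.1 = k ∧ 𝒯.Leads q.1 q.2 n := by
  induction n using 𝒯.parent_induction with
  | h0 n h =>
    have := (𝒯.parent_eq_none_iff n).1 h
    rw [Fin.lt_def] at hk
    omega
  | h1 n m e h ih =>
    have hl := 𝒯.layer_parent _ _ _ h
    rcases lt_or_ge k (𝒯.layer m) with hlt | hge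
    · obtain ⟨q, h1, h2⟩ := ih hlt
      exact ⟨q, h1, .descend h2 h⟩
    · refine ⟨(m, e), ?_, .child h⟩
      rw [Fin.lt_def] at hk
      rw [Fin.le_def] at hge
      rw [Fin.ext_iff]
      simp only
      omega

/-! ### The balanced exploration policies and their balancing property. -/

section Balanced

variable [Fintype N] [Fintype E]

theorem mem_descEdge (𝒯 : LayeredTree H N E) {h : Fin H} {n m : N} {e : E} :
    m ∈ 𝒯.descEdge h n e ↔ 𝒯.layer m = h ∧ 𝒯.Leads n e m := by
  simp [descEdge]

theorem card_desc (𝒯 : LayeredTree H N E) (h : Fin H) (n : N) :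
    (𝒯.desc h n).card = ∑ e, (𝒯.descEdge h n e).card := by
  classical
  unfold desc
  rw [Finset.card_biUnion]
  · intro e _ e' _ hne
    refine Finset.disjoint_left.2 fun m hm hm' => hne ?_
    have := ((𝒯.mem_descEdge).1 hm).2.unique ((𝒯.mem_descEdge).1 hm').2 rfl
    simpa using this

theorem descEdge_subset_desc (𝒯 : LayeredTree H N E) (h : Fin H) (n : N) (e : E) :
    𝒯.descEdge h n e ⊆ 𝒯.desc h n := by
  classical
  intro m hm
  simp only [desc, Finset.mem_biUnion]
  exact ⟨e, Finset.mem_univ _, hm⟩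

/-- Each ancestor edge of `x` has `x` itself among its descendants in layer `h`, so no factor on the
way to `x` vanishes. The induction therefore runs over `x` and its ancestors only. -/
theorem reach_balanced_pos (𝒯 : LayeredTree H N E) {h : Fin H} {x : N} (hx : 𝒯.layer x = h) :
    0 < 𝒯.reach (𝒯.balanced h) x := by
  have key : ∀ n, (n = x ∨ ∃ e, 𝒯.Leads n e x) → 0 < 𝒯.reach (𝒯.balanced h) n := by
    intro n
    induction n using 𝒯.parent_induction with
    | h0 n h => intro _; rw [𝒯.reach_of_parent_none _ h]; exact zero_lt_one
    | h1 n m e hp ih =>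
      intro hn
      have hm : 𝒯.Leads m e x := by
        rcases hn with rfl | ⟨f, hf⟩
        · exact .child hp
        · exact (Leads.child hp).trans hf
      rw [𝒯.reach_of_parent_some _ hp, seqForm]
      refine mul_pos (ih (.inr ⟨e, hm⟩)) ?_
      have hmem : x ∈ 𝒯.descEdge h m e := 𝒯.mem_descEdge.2 ⟨hx, hm⟩
      rw [balanced, if_pos (hx ▸ hm.layer_lt)]
      refine div_pos ?_ ?_
      · exact_mod_cast Finset.card_pos.2 ⟨x, hmem⟩
      · exact_mod_cast Finset.card_pos.2 ⟨x, 𝒯.descEdge_subset_desc _ _ _ hmem⟩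
  exact key x (.inl rfl)

/-- The descendant counts of the edges add up to that of the node. The only danger is division by
zero, and `hc` excludes it: from any node the tree continues down to layer `h`. -/
theorem isPolicy_balanced [Nonempty E] (𝒯 : LayeredTree H N E)
    (hc : ∀ n e, (𝒯.layer n : ℕ) + 1 < H → ∃ c, 𝒯.parent c = some (n, e)) (h : Fin H) :
    IsPolicy (𝒯.balanced h) := by
  intro n
  refine ⟨fun e => ?_, ?_⟩
  · rw [balanced]
    split_ifs <;> positivity
  · simp only [balanced]
    split_ifs with hn
    · rw [← Finset.sum_div, ← Nat.cast_sum, ← card_desc]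
      refine div_self ?_
      have key : ∀ k : ℕ, (𝒯.layer n : ℕ) < k → ∀ hk : k < H, ∃ m e, 𝒯.layer m = ⟨k, hk⟩ ∧
          𝒯.Leads n e m := by
        intro k hk
        induction k, hk using Nat.le_induction with
        | base =>
          intro hk
          obtain ⟨c, hc⟩ := hc n (Classical.arbitrary E) hk
          exact ⟨c, _, by rw [Fin.ext_iff, ← 𝒯.layer_parent _ _ _ hc], .child hc⟩
        | succ k hk ih =>
          intro hk'
          obtain ⟨m, e, h1, h2⟩ := ih (by omega)
          obtain ⟨c, hc⟩ := hc m e (by rw [h1]; exact hk')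
          exact ⟨c, e, by rw [Fin.ext_iff, ← 𝒯.layer_parent _ _ _ hc, h1], .descend h2 hc⟩
      obtain ⟨m, e, h1, h2⟩ := key h hn h.2
      exact_mod_cast (Finset.card_pos.2
        ⟨m, 𝒯.descEdge_subset_desc _ _ _ (𝒯.mem_descEdge.2 ⟨h1, h2⟩)⟩).ne'
    · simp

theorem isPolicy_explore [Nonempty E] (𝒯 : LayeredTree H N E)
    (hc : ∀ n e, (𝒯.layer n : ℕ) + 1 < H → ∃ c, 𝒯.parent c = some (n, e)) {μ : N → E → ℝ}
    (hμ : IsPolicy μ) (h : Fin H) : IsPolicy (𝒯.explore μ h) := by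
  intro n
  unfold explore
  split_ifs
  · exact 𝒯.isPolicy_balanced hc h n
  · exact hμ n

/-- The balancing property of the exploration policy of layer `h`. -/
theorem sum_layer_reach_div_balanced_le [Nonempty E] (𝒯 : LayeredTree H N E) {μ : N → E → ℝ}
    (hμ : IsPolicy μ) (h : Fin H) :
    ∑ x with 𝒯.layer x = h, 𝒯.reach μ x / 𝒯.reach (𝒯.balanced h) x
      ≤ ((Finset.univ.filter fun x => 𝒯.layer x = h).card : ℝ) := by
  classical
  set β := 𝒯.balanced h
  set X := Finset.univ.filter fun x => 𝒯.layer x = h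
  have hμ0 : ∀ n e, 0 ≤ μ n e := fun n e => (hμ n).1 e
  have hβ0 : ∀ n e, 0 ≤ β n e := by
    intro n e
    simp only [β, balanced]
    split_ifs <;> positivity
  -- `up k x` will be the edge of layer `k` in the history of `x`; it has a junk value when `k` is
  -- not above `x`.
  have hex : ∀ (k : Fin H) (x : N), ∃ q : N × E, k < 𝒯.layer x →
      𝒯.layer q.1 = k ∧ 𝒯.Leads q.1 q.2 x := by
    intro k x
    by_cases hk : k < 𝒯.layer x
    · obtain ⟨q, hq⟩ := 𝒯.exists_leads x k hk
      exact ⟨q, fun _ => hq⟩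
    · exact ⟨(x, Classical.arbitrary E), fun h => absurd h hk⟩
  choose up hup using hex
  have hup1 := fun k x hk => (hup k x hk).1
  have hup2 := fun k x hk => (hup k x hk).2
  have hX : ∀ x ∈ X, 𝒯.layer x = h := fun x hx => (Finset.mem_filter.1 hx).2
  have hfib : ∀ k < h, ∀ q : N × E, 𝒯.layer q.1 = k →
      X.filter (fun x => up k x = q) = 𝒯.descEdge h q.1 q.2 := by
    intro k hk q hq
    ext x
    simp only [Finset.mem_filter, mem_descEdge, X, Finset.mem_univ, true_and]
    refine and_congr_right fun hx => ⟨?_, fun hl => ?_⟩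
    · rintro rfl; exact hup2 k x (hx ▸ hk)
    · exact Prod.ext_iff.2 ((hup2 k x (hx ▸ hk)).unique hl (by rw [hup1 k x (hx ▸ hk), hq]))
  -- Grouping the nodes of layer `h` by their ancestor edge in layer `k` turns a sum over them into
  -- a sum weighted by descendant counts, the weights that also define the balanced policy.
  have hgroup : ∀ k < h, ∀ f : N × E → ℝ, ∑ x ∈ X, f (up k x)
      = ∑ n with 𝒯.layer n = k, ∑ e, ((𝒯.descEdge h n e).card : ℝ) * f (n, e) := by
    intro k hk f
    rw [← Finset.sum_fiberwise_of_maps_to (t := (Finset.univ.filter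
      fun n => 𝒯.layer n = k) ×ˢ Finset.univ) (g := up k) ?_, Finset.sum_product]
    · refine Finset.sum_congr rfl fun n hn => Finset.sum_congr rfl fun e _ => ?_
      rw [Finset.sum_congr (g := fun _ => f (n, e)) rfl
        (fun x hx => by rw [(Finset.mem_filter.1 hx).2]), Finset.sum_const, nsmul_eq_mul,
        hfib k hk (n, e) (Finset.mem_filter.1 hn).2]
    · intro x hx
      simp only [Finset.mem_product, Finset.mem_filter, Finset.mem_univ, true_and, and_true]
      exact hup1 k x (hX x hx ▸ hk)
  -- Passing from a node to its edge `e` multiplies the ratio by `μ n e` times the descendants of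
  -- `n` over those of `e`. The weight of the edge cancels the latter count, and `μ n` sums to one.
  -- Edges without descendants contribute only on the right, hence an inequality.
  have hstep : ∀ k < h, ∑ x ∈ X, 𝒯.seqForm μ (up k x).1 (up k x).2
        / 𝒯.seqForm β (up k x).1 (up k x).2
      ≤ ∑ x ∈ X, 𝒯.reach μ (up k x).1 / 𝒯.reach β (up k x).1 := by
    intro k hk
    rw [hgroup k hk fun q => 𝒯.seqForm μ q.1 q.2 / 𝒯.seqForm β q.1 q.2,
      hgroup k hk fun q => 𝒯.reach μ q.1 / 𝒯.reach β q.1]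
    refine Finset.sum_le_sum fun n hn => ?_
    have hnk : 𝒯.layer n = k := (Finset.mem_filter.1 hn).2
    simp only
    rw [← Finset.sum_mul, ← Nat.cast_sum, ← card_desc]
    set c := 𝒯.reach μ n / 𝒯.reach β n
    have hc : 0 ≤ c := div_nonneg (𝒯.reach_nonneg hμ0 n) (𝒯.reach_nonneg hβ0 n)
    calc _ ≤ ∑ e, ((𝒯.desc h n).card : ℝ) * c * μ n e := by
          refine Finset.sum_le_sum fun e _ => ?_
          have hb : β n e = ((𝒯.descEdge h n e).card : ℝ) / ((𝒯.desc h n).card : ℝ) :=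
            if_pos (hnk ▸ hk)
          rw [seqForm, seqForm, mul_div_mul_comm, hb]
          rcases Nat.eq_zero_or_pos (𝒯.descEdge h n e).card with h0 | h0
          · rw [h0]
            simp only [CharP.cast_eq_zero, zero_mul]
            exact mul_nonneg (mul_nonneg (Nat.cast_nonneg _) hc) (hμ0 n e)
          · refine le_of_eq ?_
            have : ((𝒯.descEdge h n e).card : ℝ) ≠ 0 := by positivity
            simp only [c]
            field_simp
      _ = _ := by rw [← Finset.mul_sum, (hμ n).2, mul_one]
  -- Iterating `hstep` down the layers: the ratios are all `1` at the root layer, and the reach of a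
  -- node is the sequence form of its parent edge.
  have hmain : ∀ (k : ℕ) (hk : k < H), k < (h : ℕ) →
      ∑ x ∈ X, 𝒯.reach μ (up ⟨k, hk⟩ x).1 / 𝒯.reach β (up ⟨k, hk⟩ x).1 ≤ X.card := by
    intro k
    induction k with
    | zero =>
      intro hk hkh
      refine le_of_eq ?_
      rw [Finset.sum_congr (g := fun _ => (1 : ℝ)) rfl]
      · simp
      · intro x hx
        have hl := hup1 ⟨0, hk⟩ x (by rw [hX x hx]; exact hkh)
        have hp := (𝒯.parent_eq_none_iff _).2 (congrArg Fin.val hl)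
        rw [𝒯.reach_of_parent_none _ hp, 𝒯.reach_of_parent_none _ hp, div_one]
    | succ k ih =>
      intro hk hkh
      have hk' : k < H := by omega
      refine le_trans (le_of_eq ?_) ((hstep ⟨k, hk'⟩ (by rw [Fin.lt_def]; simp; omega)).trans
        (ih hk' (by omega)))
      refine Finset.sum_congr rfl fun x hx => ?_
      have hl := hup1 ⟨k + 1, hk⟩ x (by rw [hX x hx]; exact hkh)
      have hL := hup2 ⟨k + 1, hk⟩ x (by rw [hX x hx]; exact hkh)
      have hl' := hup1 ⟨k, hk'⟩ x (by rw [hX x hx, Fin.lt_def]; simp; omega)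
      have hL' := hup2 ⟨k, hk'⟩ x (by rw [hX x hx, Fin.lt_def]; simp; omega)
      match hp : 𝒯.parent (up ⟨k + 1, hk⟩ x).1 with
      | none =>
        have := (𝒯.parent_eq_none_iff _).1 hp
        rw [hl] at this
        simp at this
      | some (m, e) =>
        have hlm := 𝒯.layer_parent _ _ _ hp
        rw [hl] at hlm
        have := ((Leads.child hp).trans hL).unique hL' (by rw [hl', Fin.ext_iff]; simp at hlm; simpa)
        rw [𝒯.reach_of_parent_some _ hp, 𝒯.reach_of_parent_some _ hp, ← this.1, ← this.2]
  rcases Nat.eq_zero_or_pos (h : ℕ) with h0 | h0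
  · refine le_of_eq ?_
    rw [Finset.sum_congr (g := fun _ => (1 : ℝ)) rfl]
    · simp
    · intro x hx
      have hp := (𝒯.parent_eq_none_iff x).2 (by rw [hX x hx, h0])
      rw [𝒯.reach_of_parent_none _ hp, 𝒯.reach_of_parent_none _ hp, div_one]
  · have hk' : (h : ℕ) - 1 < H := by omega
    refine le_trans (le_of_eq ?_) ((hstep ⟨h - 1, hk'⟩ (by rw [Fin.lt_def]; simp; omega)).trans
      (hmain _ hk' (by omega)))
    refine Finset.sum_congr rfl fun x hx => ?_
    have hl' := hup1 ⟨h - 1, hk'⟩ x (by rw [hX x hx, Fin.lt_def]; simp; omega)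
    have hL' := hup2 ⟨h - 1, hk'⟩ x (by rw [hX x hx, Fin.lt_def]; simp; omega)
    match hp : 𝒯.parent x with
    | none =>
      have := (𝒯.parent_eq_none_iff _).1 hp
      rw [hX x hx] at this
      omega
    | some (m, e) =>
      have hlm := 𝒯.layer_parent _ _ _ hp
      rw [hX x hx] at hlm
      have := (Leads.child hp).unique hL' (by rw [hl', Fin.ext_iff]; simp; omega)
      rw [𝒯.reach_of_parent_some _ hp, 𝒯.reach_of_parent_some _ hp, ← this.1, ← this.2]

theorem sum_reach_div_balanced_le [Nonempty E] (𝒯 : LayeredTree H N E) {μ : N → E → ℝ}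
    (hμ : IsPolicy μ) :
    ∑ x, 𝒯.reach μ x / 𝒯.reach (𝒯.balanced (𝒯.layer x)) x ≤ Fintype.card N := by
  classical
  rw [← Finset.sum_fiberwise (s := Finset.univ) (g := 𝒯.layer), ← Finset.card_univ,
    Finset.card_eq_sum_card_fiberwise (f := 𝒯.layer) (s := Finset.univ) (t := Finset.univ)
      (fun _ _ => Finset.mem_univ _), Nat.cast_sum]
  refine Finset.sum_le_sum fun h _ => ?_
  refine le_trans (le_of_eq (Finset.sum_congr rfl fun x hx => ?_))
    (𝒯.sum_layer_reach_div_balanced_le hμ h)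
  rw [(Finset.mem_filter.1 hx).2]

end Balanced

end LayeredTree

/-! ### Deterministic regret bound for regret matching. -/

section RegretMatching

variable {A : Type*} [Fintype A]

theorem rmDist_mem_stdSimplex [Nonempty A] (R : A → ℝ) : rmDist R ∈ stdSimplex ℝ A := by
  refine ⟨fun a => ?_, ?_⟩
  · unfold rmDist
    split_ifs
    · positivity
    · exact div_nonneg (le_max_right _ _) (Finset.sum_nonneg fun _ _ => le_max_right _ _)
  · unfold rmDist
    split_ifs with h
    · simp
    · rw [← Finset.sum_div, div_self h]

/-- The regret vector of a regret matching step is orthogonal to the positive part of the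
cumulative regrets. -/
theorem sum_posPart_mul_regret_eq_zero (R ℓ : A → ℝ) :
    ∑ a, max (R a) 0 * ((∑ a', rmDist R a' * ℓ a') - ℓ a) = 0 := by
  by_cases h : ∑ a', max (R a') 0 = 0
  · refine Finset.sum_eq_zero fun a ha => ?_
    rw [(Finset.sum_eq_zero_iff_of_nonneg fun _ _ => le_max_right _ _).1 h a ha, zero_mul]
  · have h1 : ∑ a', rmDist R a' * ℓ a'
        = (∑ a', max (R a') 0 * ℓ a') / ∑ a', max (R a') 0 := by
      rw [Finset.sum_div]
      refine Finset.sum_congr rfl fun a _ => ?_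
      rw [rmDist, if_neg h, div_mul_eq_mul_div]
    simp only [mul_sub, Finset.sum_sub_distrib]
    rw [← Finset.sum_mul, h1, mul_div_cancel₀ _ h, sub_self]

theorem rmRegret_eq_sum (T : ℕ) (ℓ : Fin T → A → ℝ) (a : A) :
    rmRegret T ℓ a = ∑ t : Fin T, ((∑ a', rmDist
      (rmRegret t fun τ => ℓ (Fin.castLE t.isLt.le τ)) a' * ℓ t a') - ℓ t a) := by
  induction T with
  | zero => simp [rmRegret]
  | succ T ih =>
    rw [rmRegret, Fin.sum_univ_castSucc, ih]
    rfl

/-- Blackwell's potential argument. The positive part of `R + r` is dominated in square by `R₊ + r`,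
and after summing over actions the cross term vanishes by orthogonality, so the potential grows by
at most the squared norm of `r`. -/
theorem sum_sq_posPart_rmRegret_le (T : ℕ) (ℓ : Fin T → A → ℝ) :
    ∑ a, max (rmRegret T ℓ a) 0 ^ 2 ≤ ∑ t : Fin T, ∑ a, ((∑ a', rmDist
      (rmRegret t fun τ => ℓ (Fin.castLE t.isLt.le τ)) a' * ℓ t a') - ℓ t a) ^ 2 := by
  induction T with
  | zero => simp [rmRegret]
  | succ T ih =>
    rw [Fin.sum_univ_castSucc]
    set R := rmRegret T fun τ => ℓ τ.castSucc
    set r := fun a => (∑ a', rmDist R a' * ℓ (Fin.last T) a') - ℓ (Fin.last T) a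
    have hpt : ∀ a, max (rmRegret (T + 1) ℓ a) 0 ^ 2
        ≤ max (R a) 0 ^ 2 + 2 * (max (R a) 0 * r a) + r a ^ 2 := by
      intro a
      have h1 : rmRegret (T + 1) ℓ a = R a + r a := rfl
      have h2 : max (R a + r a) 0 ^ 2 ≤ (max (R a) 0 + r a) ^ 2 := by
        rcases le_total (R a + r a) 0 with h | h
        · rw [max_eq_right h, zero_pow two_ne_zero]; exact sq_nonneg _
        · rw [max_eq_left h]
          exact pow_le_pow_left₀ h (by linarith [le_max_left (R a) 0]) 2
      rw [h1]
      linarith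
    refine (Finset.sum_le_sum fun a _ => hpt a).trans ?_
    rw [Finset.sum_add_distrib, Finset.sum_add_distrib, ← Finset.mul_sum,
      sum_posPart_mul_regret_eq_zero, mul_zero, add_zero]
    exact add_le_add (ih _) le_rfl

/-- The square root of the potential is linearized by the arithmetic-geometric mean inequality. With
a free `κ` the bound stays linear in the squared regrets, so that one supermartingale can control
their sum. -/
theorem rmRegret_le (T : ℕ) (ℓ : Fin T → A → ℝ) (a : A) {κ : ℝ} (hκ : 0 < κ) :
    rmRegret T ℓ a ≤ κ / 2 * (∑ t : Fin T, ∑ a, ((∑ a', rmDist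
      (rmRegret t fun τ => ℓ (Fin.castLE t.isLt.le τ)) a' * ℓ t a') - ℓ t a) ^ 2)
      + 1 / (2 * κ) := by
  have h1 := (Finset.single_le_sum (f := fun a => max (rmRegret T ℓ a) 0 ^ 2)
    (fun _ _ => sq_nonneg _) (Finset.mem_univ a)).trans (sum_sq_posPart_rmRegret_le T ℓ)
  have h2 : max (rmRegret T ℓ a) 0
      ≤ κ / 2 * max (rmRegret T ℓ a) 0 ^ 2 + 1 / (2 * κ) := by
    rw [← sub_nonneg]
    have : κ / 2 * max (rmRegret T ℓ a) 0 ^ 2 + 1 / (2 * κ) - max (rmRegret T ℓ a) 0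
        = (κ * max (rmRegret T ℓ a) 0 - 1) ^ 2 / (2 * κ) := by
      field_simp
      ring
    rw [this]
    positivity
  refine (le_max_left _ 0).trans (h2.trans ?_)
  gcongr

end RegretMatching

/-! ### Summing out the future of a process given by transition weights. -/

section SequentialSum

variable {H : ℕ} {Z : Type*} [Fintype Z]

/-- Exchanging the coordinate `j` with a fresh value is an involution on pairs. -/
theorem card_mul_sum_eq_sum_update (Ψ : (Fin H → Z) → ℝ) (j : Fin H) :
    (Fintype.card Z : ℝ) * ∑ π, Ψ π = ∑ π, ∑ z, Ψ (Function.update π j z) := by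
  have h : ∑ p : (Fin H → Z) × Z, Ψ p.1 = ∑ p : (Fin H → Z) × Z, Ψ (Function.update p.1 j p.2) := by
    refine Fintype.sum_equiv (Function.Involutive.toPerm
      (fun p : (Fin H → Z) × Z => (Function.update p.1 j p.2, p.1 j)) fun p => ?_) _ _ fun p => ?_
    · simp
    · simp [Function.Involutive.toPerm]
  rw [Fintype.sum_prod_type, Fintype.sum_prod_type] at h
  rw [← h]
  simp [Finset.mul_sum]

/-- Summing out the last steps of a process given by transition weights. -/
theorem sum_mul_prod_kernel (K : Fin H → (Fin H → Z) → ℝ)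
    (hK : ∀ h π π', (∀ j ≤ h, π j = π' j) → K h π = K h π')
    (hK1 : ∀ h π, ∑ z, K h (Function.update π h z) = 1) (k i : ℕ) (hki : k + i ≤ H)
    (f : (Fin H → Z) → ℝ) (hf : ∀ π π', (∀ j : Fin H, (j : ℕ) < k → π j = π' j) → f π = f π') :
    (∑ π, f π * ∏ h ∈ Finset.univ.filter (fun h : Fin H => (h : ℕ) < k + i), K h π)
      * (Fintype.card Z : ℝ) ^ i
      = ∑ π, f π * ∏ h ∈ Finset.univ.filter (fun h : Fin H => (h : ℕ) < k), K h π := by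
  induction i with
  | zero => simp
  | succ i ih =>
    -- The plays still carry the coordinates whose kernels have been dropped. Each such coordinate
    -- is free and contributes a factor `Fintype.card Z`; here it serves to resample coordinate `k +
    -- i`, over which the kernel sums to one.
    rw [← ih (by omega), pow_succ', ← mul_assoc, mul_comm _ (Fintype.card Z : ℝ),
      card_mul_sum_eq_sum_update _ (⟨k + i, by omega⟩ : Fin H)]
    congr 1
    refine Finset.sum_congr rfl fun π _ => ?_
    set j : Fin H := ⟨k + i, by omega⟩
    have hins : (Finset.univ.filter fun h : Fin H => (h : ℕ) < k + (i + 1))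
        = insert j (Finset.univ.filter fun h : Fin H => (h : ℕ) < k + i) := by
      ext h
      simp only [Finset.mem_filter, Finset.mem_univ, true_and, Finset.mem_insert, j, Fin.ext_iff]
      omega
    have hz : ∀ z, f (Function.update π j z)
          * ∏ h ∈ Finset.univ.filter (fun h : Fin H => (h : ℕ) < k + (i + 1)),
            K h (Function.update π j z)
        = (f π * ∏ h ∈ Finset.univ.filter (fun h : Fin H => (h : ℕ) < k + i), K h π)
          * K j (Function.update π j z) := by
      intro z
      have hup : ∀ l : Fin H, (l : ℕ) < k + i → Function.update π j z l = π l := by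
        intro l hl
        refine Function.update_of_ne ?_ _ _
        rintro rfl
        exact lt_irrefl _ hl
      rw [hins, Finset.prod_insert (by simp [j]),
        hf _ π fun l hl => hup l (by omega), Finset.prod_congr (g := fun h => K h π) rfl]
      · ring
      · intro h hh
        refine hK h _ _ fun l hl => hup l ?_
        have := (Finset.mem_filter.1 hh).2
        rw [Fin.le_def] at hl
        omega
    simp only [hz]
    rw [← Finset.mul_sum, hK1, mul_one]

theorem sum_prod_kernel [Nonempty Z] (K : Fin H → (Fin H → Z) → ℝ)
    (hK : ∀ h π π', (∀ j ≤ h, π j = π' j) → K h π = K h π')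
    (hK1 : ∀ h π, ∑ z, K h (Function.update π h z) = 1) :
    ∑ π, ∏ h : Fin H, K h π = 1 := by
  have h := sum_mul_prod_kernel K hK hK1 0 H (by omega) (fun _ => 1) fun _ _ _ => rfl
  have hc : (Fintype.card Z : ℝ) ^ H ≠ 0 := by positivity
  simp only [zero_add, Fin.is_lt, Finset.filter_true, one_mul, not_lt_zero, Finset.filter_false,
    Finset.prod_empty] at h
  refine mul_right_cancel₀ hc (h.trans ?_)
  simp

/-- Causality: the law of step `k` does not depend on later kernels. -/
theorem sum_mul_prod_kernel_congr [Nonempty Z] {K K' : Fin H → (Fin H → Z) → ℝ}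
    (hK : ∀ h π π', (∀ j ≤ h, π j = π' j) → K h π = K h π')
    (hK1 : ∀ h π, ∑ z, K h (Function.update π h z) = 1)
    (hK' : ∀ h π π', (∀ j ≤ h, π j = π' j) → K' h π = K' h π')
    (hK1' : ∀ h π, ∑ z, K' h (Function.update π h z) = 1) (k : Fin H)
    (hKK' : ∀ h ≤ k, K h = K' h) (f : Z → ℝ) :
    ∑ π, f (π k) * ∏ h : Fin H, K h π = ∑ π, f (π k) * ∏ h : Fin H, K' h π := by
  have hf : ∀ π π' : Fin H → Z, (∀ j : Fin H, (j : ℕ) < k + 1 → π j = π' j) →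
      f (π k) = f (π' k) := fun π π' h => by rw [h k (by omega)]
  have h := sum_mul_prod_kernel K hK hK1 (k + 1) (H - (k + 1)) (by omega) (fun π => f (π k)) hf
  have h' := sum_mul_prod_kernel K' hK' hK1' (k + 1) (H - (k + 1)) (by omega) (fun π => f (π k)) hf
  have hu : (Finset.univ.filter fun h : Fin H => (h : ℕ) < k + 1 + (H - (k + 1))) = Finset.univ := by
    ext h
    simp only [Finset.mem_filter, Finset.mem_univ, true_and, iff_true]
    omega
  have hc : (Fintype.card Z : ℝ) ^ (H - (k + 1 : ℕ)) ≠ 0 := by positivity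
  rw [hu] at h h'
  refine mul_right_cancel₀ hc (h.trans (Eq.trans ?_ h'.symm))
  refine Finset.sum_congr rfl fun π _ => ?_
  congr 1
  refine Finset.prod_congr rfl fun h hh => ?_
  rw [hKK' h]
  have := (Finset.mem_filter.1 hh).2
  rw [Fin.le_def]
  omega

end SequentialSum

/-! ### The game seen by one player: counterfactual values and the regret decomposition. -/

section OneSided

variable {H : ℕ} {Z N E : Type*} [Fintype Z]

/-- `w` is the contribution of chance and of the opponent to the probability of a play, in a game
in which the player whose information is described by the tree `𝒯` sees `obs (π h)` in step `h`. -/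
structure IsOpponentWeight [Fintype E] (𝒯 : LayeredTree H N E) (obs : Z → N × E)
    (w : (Fin H → Z) → ℝ) : Prop where
  nonneg : ∀ π, 0 ≤ w π
  isPath : ∀ π, w π ≠ 0 → 𝒯.IsPath fun h => obs (π h)
  total : ∀ μ : Fin H → N → E → ℝ, (∀ h, IsPolicy (μ h)) →
    ∑ π, w π * ∏ h, μ h (obs (π h)).1 (obs (π h)).2 = 1
  marginal : ∀ μ μ' : Fin H → N → E → ℝ, (∀ h, IsPolicy (μ h)) → (∀ h, IsPolicy (μ' h)) →
    ∀ k, (∀ h ≤ k, μ h = μ' h) → ∀ f : Z → ℝ,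
    ∑ π, f (π k) * (w π * ∏ h, μ h (obs (π h)).1 (obs (π h)).2)
      = ∑ π, f (π k) * (w π * ∏ h, μ' h (obs (π h)).1 (obs (π h)).2)

open Classical in
/-- Counterfactual expectation of `f` at a node and an edge, when the player plays `μ` below. -/
noncomputable def counterfactual (𝒯 : LayeredTree H N E) (obs : Z → N × E)
    (w : (Fin H → Z) → ℝ) (μ : N → E → ℝ) (f : Fin H → (Fin H → Z) → ℝ) (n : N) (e : E) : ℝ :=
  ∑ π, if obs (π (𝒯.layer n)) = (n, e) then
    w π * (∏ j with 𝒯.layer n < j, μ (obs (π j)).1 (obs (π j)).2) * f (𝒯.layer n) π else 0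

/-- The loss from layer `h` on. -/
noncomputable def lossToGo (g : Z → ℝ) (h : Fin H) (π : Fin H → Z) : ℝ :=
  ∑ j ∈ Finset.Ici h, g (π j)

/-- Expected total loss of the player. -/
noncomputable def expLoss (obs : Z → N × E) (w : (Fin H → Z) → ℝ) (g : Z → ℝ)
    (μ : N → E → ℝ) : ℝ :=
  ∑ π, w π * (∏ h, μ (obs (π h)).1 (obs (π h)).2) * ∑ h, g (π h)

variable [Fintype N] [Fintype E] {𝒯 : LayeredTree H N E} {obs : Z → N × E}
  {w : (Fin H → Z) → ℝ}

/-- A play of nonzero weight visits exactly one node per layer, and the reach of that node under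
`μ'` is the product of the earlier action probabilities. Hence the sum over nodes and edges becomes
a sum over layers and plays. -/
theorem IsOpponentWeight.sum_reach_mul_counterfactual (hw : IsOpponentWeight 𝒯 obs w)
    (μ' μ φ : N → E → ℝ) (f : Fin H → (Fin H → Z) → ℝ) :
    ∑ n, ∑ e, 𝒯.reach μ' n * φ n e * counterfactual 𝒯 obs w μ f n e
      = ∑ h, ∑ π, w π * ((∏ j with j < h, μ' (obs (π j)).1 (obs (π j)).2)
          * φ (obs (π h)).1 (obs (π h)).2
          * ∏ j with h < j, μ (obs (π j)).1 (obs (π j)).2) * f h π := by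
  classical
  rw [← Fintype.sum_prod_type', Finset.sum_comm (s := (Finset.univ : Finset (Fin H)))]
  simp only [counterfactual, Finset.mul_sum]
  rw [Finset.sum_comm]
  refine Finset.sum_congr rfl fun π _ => ?_
  by_cases hπ : w π = 0
  · simp [hπ]
  have hp := hw.isPath π hπ
  set F : N × E → ℝ := fun q => 𝒯.reach μ' q.1 * φ q.1 q.2 * (w π
    * (∏ j with 𝒯.layer q.1 < j, μ (obs (π j)).1 (obs (π j)).2) * f (𝒯.layer q.1) π)
  have h1 : ∀ q : N × E, (𝒯.reach μ' q.1 * φ q.1 q.2 * if obs (π (𝒯.layer q.1)) = (q.1, q.2) then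
      w π * (∏ j with 𝒯.layer q.1 < j, μ (obs (π j)).1 (obs (π j)).2) * f (𝒯.layer q.1) π else 0)
      = ∑ h, if obs (π h) = q then F q else 0 := by
    intro q
    rw [Finset.sum_eq_single (𝒯.layer q.1)]
    · simp [F]
    · intro h _ hne
      rw [if_neg]
      rintro rfl
      exact hne (hp.layer_eq h).symm
    · simp
  simp only [h1]
  rw [Finset.sum_comm]
  refine Finset.sum_congr rfl fun h _ => ?_
  rw [Finset.sum_ite_eq, if_pos (Finset.mem_univ _)]
  simp only [F, hp.layer_eq h, hp.reach_eq_prod μ' h]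
  ring

theorem prod_eq_prod_lt_mul_prod_gt (h : Fin H) (φ : Fin H → ℝ) :
    ∏ j, φ j = (∏ j with j < h, φ j) * φ h * ∏ j with h < j, φ j := by
  rw [← Finset.prod_filter_mul_prod_filter_not Finset.univ (fun j => j < h), mul_assoc]
  congr 1
  have : (Finset.univ.filter fun j => ¬ j < h) = insert h (Finset.univ.filter fun j => h < j) := by
    ext j
    simp [le_iff_eq_or_lt, eq_comm]
  rw [this, Finset.prod_insert (by simp)]

theorem prod_splice (h : Fin H) (a b c : Fin H → ℝ) :
    (∏ j with j < h, a j) * b h * ∏ j with h < j, c j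
      = ∏ j, if j < h then a j else if j = h then b j else c j := by
  rw [prod_eq_prod_lt_mul_prod_gt h]
  congr 1
  · congr 1
    · refine Finset.prod_congr rfl fun j hj => ?_
      rw [if_pos (Finset.mem_filter.1 hj).2]
    · simp
  · refine Finset.prod_congr rfl fun j hj => ?_
    have := (Finset.mem_filter.1 hj).2
    rw [if_neg this.le.not_gt, if_neg this.ne']

/-- Play `μ'` before layer `h`, `φ` in layer `h` and `μ` after it. -/
def splice (h : Fin H) (μ' φ μ : N → E → ℝ) (j : Fin H) : N → E → ℝ :=
  if j < h then μ' else if j = h then φ else μ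

theorem isPolicy_splice {μ' φ μ : N → E → ℝ} (h1 : IsPolicy μ') (h2 : IsPolicy φ)
    (h3 : IsPolicy μ) (h j : Fin H) : IsPolicy (splice h μ' φ μ j) := by
  unfold splice
  split_ifs <;> assumption

theorem prod_splice_obs (h : Fin H) (μ' φ μ : N → E → ℝ) (π : Fin H → Z) :
    (∏ j with j < h, μ' (obs (π j)).1 (obs (π j)).2) * φ (obs (π h)).1 (obs (π h)).2
      * ∏ j with h < j, μ (obs (π j)).1 (obs (π j)).2
      = ∏ j, splice h μ' φ μ j (obs (π j)).1 (obs (π j)).2 := by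
  rw [prod_splice h (fun j => μ' (obs (π j)).1 (obs (π j)).2)
    (fun j => φ (obs (π j)).1 (obs (π j)).2) fun j => μ (obs (π j)).1 (obs (π j)).2]
  refine Finset.prod_congr rfl fun j _ => ?_
  unfold splice
  split_ifs <;> rfl

/-- For each layer, the weighted terms are the visit probabilities under a genuine layer-dependent
policy (`splice`), so every layer contributes `1`. This keeps the compensators of all infosets
together at order `H`. -/
theorem IsOpponentWeight.sum_reach_mul_visit (hw : IsOpponentWeight 𝒯 obs w)
    {μ' φ μ : N → E → ℝ} (h1 : IsPolicy μ') (h2 : IsPolicy φ) (h3 : IsPolicy μ) :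
    ∑ n, ∑ e, 𝒯.reach μ' n * φ n e * counterfactual 𝒯 obs w μ (fun _ _ => 1) n e = H := by
  rw [hw.sum_reach_mul_counterfactual]
  simp only [prod_splice_obs, mul_one]
  rw [Finset.sum_congr rfl fun h _ => hw.total _ fun j => isPolicy_splice h1 h2 h3 h j]
  simp

/-- The counterfactual decomposition of the regret. -/
theorem IsOpponentWeight.expLoss_sub_expLoss (hw : IsOpponentWeight 𝒯 obs w) (g : Z → ℝ)
    {μ μ' : N → E → ℝ} (hμ : IsPolicy μ) (hμ' : IsPolicy μ') :
    expLoss obs w g μ - expLoss obs w g μ' = ∑ n, ∑ e, 𝒯.reach μ' n * (μ n e - μ' n e)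
      * counterfactual 𝒯 obs w μ (lossToGo g) n e := by
  rw [hw.sum_reach_mul_counterfactual μ' μ (fun n e => μ n e - μ' n e), expLoss, expLoss,
    ← Finset.sum_sub_distrib]
  have h1 : ∀ π, w π * (∏ h, μ (obs (π h)).1 (obs (π h)).2) * (∑ h, g (π h))
        - w π * (∏ h, μ' (obs (π h)).1 (obs (π h)).2) * (∑ h, g (π h))
      = ∑ h, w π * ((∏ j with j < h, μ' (obs (π j)).1 (obs (π j)).2)
          * (μ (obs (π h)).1 (obs (π h)).2 - μ' (obs (π h)).1 (obs (π h)).2)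
          * ∏ j with h < j, μ (obs (π j)).1 (obs (π j)).2) * (∑ h, g (π h)) := by
    intro π
    -- Telescoping of a difference of products: `μ'` before layer `h`, the difference in layer `h`,
    -- `μ` after it.
    have := Finset.prod_add_ordered Finset.univ (fun j => μ (obs (π j)).1 (obs (π j)).2)
      fun j => μ' (obs (π j)).1 (obs (π j)).2 - μ (obs (π j)).1 (obs (π j)).2
    simp only [add_sub_cancel] at this
    rw [← Finset.sum_mul, ← Finset.mul_sum, ← sub_mul, ← mul_sub, this, sub_add_cancel_left,
      ← Finset.sum_neg_distrib]
    congr 2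
    refine Finset.sum_congr rfl fun h _ => ?_
    ring
  rw [Finset.sum_congr rfl fun π _ => h1 π, Finset.sum_comm]
  refine Finset.sum_congr rfl fun h _ => ?_
  rw [← sub_eq_zero, ← Finset.sum_sub_distrib]
  have h2 : ∀ π : Fin H → Z, (∑ j, g (π j)) - lossToGo g h π = ∑ j with j < h, g (π j) := by
    intro π
    rw [← Finset.sum_filter_add_sum_filter_not Finset.univ (fun j => j < h), lossToGo]
    have : (Finset.univ.filter fun j => ¬ j < h) = Finset.Ici h := by ext j; simp
    rw [this, add_sub_cancel_right]
  -- The total loss may be replaced by the loss from layer `h` on. Earlier losses have the same mean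
  -- under both spliced policies, which agree before layer `h`, so they cancel by `marginal`.
  have h3 : ∀ π : Fin H → Z,
      w π * ((∏ j with j < h, μ' (obs (π j)).1 (obs (π j)).2)
          * (μ (obs (π h)).1 (obs (π h)).2 - μ' (obs (π h)).1 (obs (π h)).2)
          * ∏ j with h < j, μ (obs (π j)).1 (obs (π j)).2) * (∑ h, g (π h))
        - w π * ((∏ j with j < h, μ' (obs (π j)).1 (obs (π j)).2)
          * (μ (obs (π h)).1 (obs (π h)).2 - μ' (obs (π h)).1 (obs (π h)).2)
          * ∏ j with h < j, μ (obs (π j)).1 (obs (π j)).2) * lossToGo g h π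
      = ∑ k with k < h, (g (π k) * (w π * ∏ j, splice h μ' μ μ j (obs (π j)).1 (obs (π j)).2)
        - g (π k) * (w π * ∏ j, splice h μ' μ' μ j (obs (π j)).1 (obs (π j)).2)) := by
    intro π
    rw [← mul_sub, h2, Finset.mul_sum]
    refine Finset.sum_congr rfl fun k _ => ?_
    rw [← prod_splice_obs, ← prod_splice_obs]
    ring
  rw [Finset.sum_congr rfl fun π _ => h3 π, Finset.sum_comm]
  refine Finset.sum_eq_zero fun k hk => ?_
  rw [Finset.sum_sub_distrib, sub_eq_zero]
  refine hw.marginal _ _ (fun j => isPolicy_splice hμ' hμ hμ h j)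
    (fun j => isPolicy_splice hμ' hμ' hμ h j) k (fun j hj => ?_) g
  have hjh : j < h := hj.trans_lt (Finset.mem_filter.1 hk).2
  simp only [splice, if_pos hjh]

end OneSided

/-! ### The opponent weights of an actual game. -/

theorem sum_pmf_toReal {S : Type*} [Fintype S] (p : PMF S) : ∑ s, (p s).toReal = 1 := by
  have h := p.tsum_coe
  rw [tsum_fintype] at h
  rw [← ENNReal.toReal_sum fun s _ => p.apply_ne_top s, h, ENNReal.toReal_one]

namespace IIEFG

variable {H : ℕ} {S X Y A B : Type*}

/-- The infoset and the action of the max-player in a step. -/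
def obsX (G : IIEFG H S X Y A B) (z : S × A × B) : X × A := (G.infoX z.1, z.2.1)

/-- The infoset and the action of the min-player in a step. -/
def obsY (G : IIEFG H S X Y A B) (z : S × A × B) : Y × B := (G.infoY z.1, z.2.2)

/-- Probability of a step of a play under policies that depend on the step. -/
noncomputable def stepWeight (G : IIEFG H S X Y A B) (μ : Fin H → X → A → ℝ)
    (ν : Fin H → Y → B → ℝ) (h : Fin H) (π : Fin H → S × A × B) : ℝ :=
  (G.stepProb π h).toReal * μ h (G.obsX (π h)).1 (G.obsX (π h)).2
    * ν h (G.obsY (π h)).1 (G.obsY (π h)).2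

/-- The contribution of chance and of the min-player to the probability of a play. -/
noncomputable def weightX (G : IIEFG H S X Y A B) (ν : Y → B → ℝ) (π : Fin H → S × A × B) : ℝ :=
  ∏ h, (G.stepProb π h).toReal * ν (G.obsY (π h)).1 (G.obsY (π h)).2

/-- The contribution of chance and of the max-player to the probability of a play. -/
noncomputable def weightY (G : IIEFG H S X Y A B) (μ : X → A → ℝ) (π : Fin H → S × A × B) : ℝ :=
  ∏ h, (G.stepProb π h).toReal * μ (G.obsX (π h)).1 (G.obsX (π h)).2

theorem weightX_mul_prod (G : IIEFG H S X Y A B) (μ : Fin H → X → A → ℝ) (ν : Y → B → ℝ)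
    (π : Fin H → S × A × B) :
    G.weightX ν π * ∏ h, μ h (G.obsX (π h)).1 (G.obsX (π h)).2
      = ∏ h, G.stepWeight μ (fun _ => ν) h π := by
  rw [weightX, ← Finset.prod_mul_distrib]
  exact Finset.prod_congr rfl fun h _ => by rw [stepWeight]; ring

theorem weightY_mul_prod (G : IIEFG H S X Y A B) (μ : X → A → ℝ) (ν : Fin H → Y → B → ℝ)
    (π : Fin H → S × A × B) :
    G.weightY μ π * ∏ h, ν h (G.obsY (π h)).1 (G.obsY (π h)).2
      = ∏ h, G.stepWeight (fun _ => μ) ν h π := by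
  rw [weightY, ← Finset.prod_mul_distrib]
  exact Finset.prod_congr rfl fun h _ => by rw [stepWeight]

theorem toReal_playProb [Fintype A] [Fintype B] (G : IIEFG H S X Y A B) {μ : X → A → ℝ}
    {ν : Y → B → ℝ} (hμ : IsPolicy μ) (hν : IsPolicy ν) (π : Fin H → S × A × B) :
    (G.playProb μ ν π).toReal = ∏ h, G.stepWeight (fun _ => μ) (fun _ => ν) h π := by
  unfold playProb
  rw [ENNReal.toReal_prod]
  refine Finset.prod_congr rfl fun h _ => ?_
  rw [ENNReal.toReal_mul, ENNReal.toReal_mul, ENNReal.toReal_ofReal ((hμ _).1 _),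
    ENNReal.toReal_ofReal ((hν _).1 _)]
  rfl

theorem stepProb_congr (G : IIEFG H S X Y A B) (h : Fin H) {π π' : Fin H → S × A × B}
    (hπ : ∀ j ≤ h, π j = π' j) : G.stepProb π h = G.stepProb π' h := by
  unfold stepProb
  have h1 : π ⟨(h : ℕ) - 1, by omega⟩ = π' ⟨(h : ℕ) - 1, by omega⟩ :=
    hπ _ (by rw [Fin.le_def]; simp)
  rw [hπ h le_rfl]
  simp only [h1]

theorem stepWeight_congr (G : IIEFG H S X Y A B) (μ : Fin H → X → A → ℝ)
    (ν : Fin H → Y → B → ℝ) (h : Fin H) (π π' : Fin H → S × A × B)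
    (hπ : ∀ j ≤ h, π j = π' j) : G.stepWeight μ ν h π = G.stepWeight μ ν h π' := by
  rw [stepWeight, stepWeight, G.stepProb_congr h hπ, hπ h le_rfl]

theorem exists_stepProb_update (G : IIEFG H S X Y A B) (h : Fin H) (π : Fin H → S × A × B) :
    ∃ p : PMF S, ∀ z, G.stepProb (Function.update π h z) h = p z.1 := by
  unfold stepProb
  by_cases h0 : (h : ℕ) = 0
  · exact ⟨G.init, fun z => by simp [h0]⟩
  · have hne : (⟨(h : ℕ) - 1, by omega⟩ : Fin H) ≠ h := by
      rw [Ne, Fin.ext_iff]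
      simp only
      omega
    refine ⟨G.trans (π ⟨(h : ℕ) - 1, by omega⟩).1 (π ⟨(h : ℕ) - 1, by omega⟩).2.1
      (π ⟨(h : ℕ) - 1, by omega⟩).2.2, fun z => ?_⟩
    rw [if_neg h0]
    simp only [Function.update_self, Function.update_of_ne hne]

variable [Fintype S] [Fintype A] [Fintype B]

theorem sum_stepWeight_update (G : IIEFG H S X Y A B) {μ : Fin H → X → A → ℝ}
    {ν : Fin H → Y → B → ℝ} (hμ : ∀ h, IsPolicy (μ h)) (hν : ∀ h, IsPolicy (ν h)) (h : Fin H)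
    (π : Fin H → S × A × B) : ∑ z, G.stepWeight μ ν h (Function.update π h z) = 1 := by
  obtain ⟨p, hp⟩ := G.exists_stepProb_update h π
  simp only [stepWeight, hp, Function.update_self, obsX, obsY]
  rw [Fintype.sum_prod_type, ← sum_pmf_toReal p]
  refine Finset.sum_congr rfl fun s _ => ?_
  rw [Fintype.sum_prod_type]
  simp only
  simp only [← Finset.mul_sum, (hν h _).2, mul_one, (hμ h _).2]

theorem nonempty_state (G : IIEFG H S X Y A B) : Nonempty S :=
  ⟨G.init.support_nonempty.some⟩

/-- The supports of the initial law and of the transitions force the tree relation. The transition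
condition is available only once the layer of the previous state is known, hence the joint induction
on layers. -/
theorem isPath_stateTree (G : IIEFG H S X Y A B) {π : Fin H → S × A × B}
    (hπ : ∀ h, G.stepProb π h ≠ 0) : G.stateTree.IsPath π := by
  have hpar : ∀ (k : ℕ) (hk : k < H), G.stateTree.layer (π ⟨k, hk⟩).1 = ⟨k, hk⟩ →
      ∀ hk' : k + 1 < H, G.stateTree.parent (π ⟨k + 1, hk'⟩).1 = some (π ⟨k, hk⟩) := by
    intro k hk hlay hk'
    have h1 := hπ ⟨k + 1, hk'⟩
    simp only [stepProb, Nat.add_eq_zero_iff, one_ne_zero, and_false, if_false,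
      Nat.add_sub_cancel] at h1
    exact G.trans_support _ _ _ _ (by rw [hlay]; exact hk') h1
  have hl : ∀ (k : ℕ) (hk : k < H), G.stateTree.layer (π ⟨k, hk⟩).1 = ⟨k, hk⟩ := by
    intro k
    induction k with
    | zero =>
      intro hk
      have := hπ ⟨0, hk⟩
      simp only [stepProb, if_true] at this
      exact Fin.ext (G.init_support _ this)
    | succ k ih =>
      intro hk
      have h2 := ih (by omega)
      have := G.stateTree.layer_parent _ _ _ (hpar k _ h2 hk)
      rw [h2] at this
      exact Fin.ext this.symm
  refine ⟨fun h => hl h h.2, fun h h' hh => ?_⟩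
  have : h' = ⟨(h : ℕ) + 1, by omega⟩ := Fin.ext hh.symm
  rw [this]
  exact hpar h h.2 (hl h h.2) _

theorem isPath_obsX (G : IIEFG H S X Y A B) {π : Fin H → S × A × B}
    (hπ : ∀ h, G.stepProb π h ≠ 0) : G.maxTree.IsPath fun h => G.obsX (π h) := by
  have hp := G.isPath_stateTree hπ
  exact ⟨fun h => (G.layer_infoX _).trans (hp.layer_eq h),
    fun h h' hh => G.recallX _ _ _ _ (hp.parent_eq h h' hh)⟩

theorem isPath_obsY (G : IIEFG H S X Y A B) {π : Fin H → S × A × B}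
    (hπ : ∀ h, G.stepProb π h ≠ 0) : G.minTree.IsPath fun h => G.obsY (π h) := by
  have hp := G.isPath_stateTree hπ
  exact ⟨fun h => (G.layer_infoY _).trans (hp.layer_eq h),
    fun h h' hh => G.recallY _ _ _ _ (hp.parent_eq h h' hh)⟩

theorem isOpponentWeight_weightX [Nonempty A] [Nonempty B] (G : IIEFG H S X Y A B)
    {ν : Y → B → ℝ} (hν : IsPolicy ν) : IsOpponentWeight G.maxTree G.obsX (G.weightX ν) where
  nonneg π := Finset.prod_nonneg fun h _ => mul_nonneg ENNReal.toReal_nonneg ((hν _).1 _)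
  isPath π hπ := G.isPath_obsX fun h h0 =>
    hπ (Finset.prod_eq_zero (Finset.mem_univ h) (by simp [h0]))
  total μ hμ := by
    have := G.nonempty_state
    simp only [weightX_mul_prod]
    exact sum_prod_kernel _ (G.stepWeight_congr _ _) (G.sum_stepWeight_update hμ fun _ => hν)
  marginal μ μ' hμ hμ' k hk f := by
    have := G.nonempty_state
    simp only [weightX_mul_prod]
    refine sum_mul_prod_kernel_congr (G.stepWeight_congr _ _)
      (G.sum_stepWeight_update hμ fun _ => hν) (G.stepWeight_congr _ _)
      (G.sum_stepWeight_update hμ' fun _ => hν) k (fun h hh => ?_) f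
    funext π
    rw [stepWeight, stepWeight, hk h hh]

theorem isOpponentWeight_weightY [Nonempty A] [Nonempty B] (G : IIEFG H S X Y A B)
    {μ : X → A → ℝ} (hμ : IsPolicy μ) : IsOpponentWeight G.minTree G.obsY (G.weightY μ) where
  nonneg π := Finset.prod_nonneg fun h _ => mul_nonneg ENNReal.toReal_nonneg ((hμ _).1 _)
  isPath π hπ := G.isPath_obsY fun h h0 =>
    hπ (Finset.prod_eq_zero (Finset.mem_univ h) (by simp [h0]))
  total ν hν := by
    have := G.nonempty_state
    simp only [weightY_mul_prod]
    exact sum_prod_kernel _ (G.stepWeight_congr _ _) (G.sum_stepWeight_update (fun _ => hμ) hν)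
  marginal ν ν' hν hν' k hk f := by
    have := G.nonempty_state
    simp only [weightY_mul_prod]
    refine sum_mul_prod_kernel_congr (G.stepWeight_congr _ _)
      (G.sum_stepWeight_update (fun _ => hμ) hν) (G.stepWeight_congr _ _)
      (G.sum_stepWeight_update (fun _ => hμ) hν') k (fun h hh => ?_) f
    funext π
    rw [stepWeight, stepWeight, hk h hh]

/-- Some state lies over `x`; any successor of it in the support of a transition, with an arbitrary
action of the opponent, has a child infoset by perfect recall. This makes the balanced policies
genuine policies. -/
theorem exists_child_maxTree [Nonempty B] (G : IIEFG H S X Y A B) (x : X) (a : A)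
    (hx : (G.maxTree.layer x : ℕ) + 1 < H) : ∃ c, G.maxTree.parent c = some (x, a) := by
  obtain ⟨s, rfl⟩ := G.infoX_surjective x
  obtain ⟨s', hs'⟩ := (G.trans s a (Classical.arbitrary B)).support_nonempty
  rw [G.layer_infoX] at hx
  exact ⟨_, G.recallX _ _ _ _ (G.trans_support _ _ _ _ hx ((PMF.mem_support_iff _ _).1 hs'))⟩

theorem exists_child_minTree [Nonempty A] (G : IIEFG H S X Y A B) (y : Y) (b : B)
    (hy : (G.minTree.layer y : ℕ) + 1 < H) : ∃ c, G.minTree.parent c = some (y, b) := by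
  obtain ⟨s, rfl⟩ := G.infoY_surjective y
  obtain ⟨s', hs'⟩ := (G.trans s (Classical.arbitrary A) b).support_nonempty
  rw [G.layer_infoY] at hy
  exact ⟨_, G.recallY _ _ _ _ (G.trans_support _ _ _ _ hy ((PMF.mem_support_iff _ _).1 hs'))⟩

end IIEFG

/-! ### Exponential moment bounds for one episode. -/

theorem exp_le_one_add_add_sq {x : ℝ} (hx : x ≤ 1) : Real.exp x ≤ 1 + x + x ^ 2 := by
  rcases le_or_gt (-1) x with h | h
  · have := (abs_le.1 (Real.abs_exp_sub_one_sub_id_le (abs_le.2 ⟨h, hx⟩))).2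
    linarith
  · have h1 : Real.exp x ≤ 1 := Real.exp_le_one_iff.2 (by linarith)
    nlinarith

section ExponentialMoments

variable {Ω : Type*} [MeasurableSpace Ω] {M : Measure Ω} [IsProbabilityMeasure M]

/-- The one-step Freedman bound: `F` needs only an upper bound, and its square is replaced by a
dominating variable `U` whose mean can be computed. The conclusion follows from `1 + c ≤ exp c`. -/
theorem lintegral_exp_sub_le_one {F U : Ω → ℝ} {c : ℝ} (hF : Integrable F M) (hU : Integrable U M)
    (h1 : ∀ᵐ ω ∂M, F ω ≤ 1) (h2 : ∀ᵐ ω ∂M, F ω ^ 2 ≤ U ω) (hc : ∫ ω, F ω ∂M + ∫ ω, U ω ∂M ≤ c) :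
    ∫⁻ ω, ENNReal.ofReal (Real.exp (F ω - c)) ∂M ≤ 1 := by
  have hle : ∀ᵐ ω ∂M, Real.exp (F ω - c) ≤ Real.exp (-c) * (1 + F ω + U ω) := by
    filter_upwards [h1, h2] with ω hω1 hω2
    rw [sub_eq_add_neg, add_comm, Real.exp_add]
    have := exp_le_one_add_add_sq hω1
    exact mul_le_mul_of_nonneg_left (by linarith) (Real.exp_pos _).le
  have hint : Integrable (fun ω => Real.exp (-c) * (1 + F ω + U ω)) M :=
    (((integrable_const 1).add hF).add hU).const_mul _
  calc _ ≤ ∫⁻ ω, ENNReal.ofReal (Real.exp (-c) * (1 + F ω + U ω)) ∂M :=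
        lintegral_mono_ae (hle.mono fun ω h => ENNReal.ofReal_le_ofReal h)
    _ = ENNReal.ofReal (∫ ω, Real.exp (-c) * (1 + F ω + U ω) ∂M) :=
        (ofReal_integral_eq_lintegral_ofReal hint
          (hle.mono fun ω h => (Real.exp_pos _).le.trans h)).symm
    _ ≤ 1 := by
        rw [ENNReal.ofReal_le_one, integral_const_mul,
          integral_add (f := fun ω => 1 + F ω) ((integrable_const 1).add hF) hU,
          integral_add (f := fun _ => (1 : ℝ)) (integrable_const 1) hF, integral_const,
          probReal_univ, one_smul]
        calc _ ≤ Real.exp (-c) * (c + 1) :=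
              mul_le_mul_of_nonneg_left (by linarith) (Real.exp_pos _).le
          _ ≤ Real.exp (-c) * Real.exp c :=
              mul_le_mul_of_nonneg_left (Real.add_one_le_exp c) (Real.exp_pos _).le
          _ = 1 := by rw [← Real.exp_add, neg_add_cancel, Real.exp_zero]

/-- A nonnegative estimator, bounded by `b`, of a loss vector that is observed at one action at
most; action `a` is observed where `ind a = 1`. -/
structure IsBanditEstimator {E : Type*} [Fintype E] (M : Measure Ω) (ℓ ind : Ω → E → ℝ) (b : ℝ) :
    Prop where
  measurable : ∀ a, Measurable fun ω => ℓ ω a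
  measurable_ind : ∀ a, Measurable fun ω => ind ω a
  ind_nonneg : ∀ ω a, 0 ≤ ind ω a
  sum_ind_le : ∀ ω, ∑ a, ind ω a ≤ 1
  ind_sq : ∀ ω a, ind ω a ^ 2 = ind ω a
  nonneg : ∀ᵐ ω ∂M, ∀ a, 0 ≤ ℓ ω a
  le_mul_ind : ∀ᵐ ω ∂M, ∀ a, ℓ ω a ≤ b * ind ω a

namespace IsBanditEstimator

variable {E : Type*} [Fintype E] {ℓ ind : Ω → E → ℝ} {b : ℝ}

theorem ind_le_one (h : IsBanditEstimator M ℓ ind b) (ω : Ω) (a : E) : ind ω a ≤ 1 :=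
  (Finset.single_le_sum (fun a _ => h.ind_nonneg ω a) (Finset.mem_univ a)).trans (h.sum_ind_le ω)

theorem integrable_ind (h : IsBanditEstimator M ℓ ind b) (a : E) :
    Integrable (fun ω => ind ω a) M :=
  Integrable.of_mem_Icc 0 1 (h.measurable_ind a).aemeasurable
    (.of_forall fun ω => ⟨h.ind_nonneg ω a, h.ind_le_one ω a⟩)

theorem integrable (h : IsBanditEstimator M ℓ ind b) (hb : 0 ≤ b) (a : E) :
    Integrable (fun ω => ℓ ω a) M := by
  refine Integrable.of_mem_Icc 0 b (h.measurable a).aemeasurable ?_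
  filter_upwards [h.nonneg, h.le_mul_ind] with ω h0 h1
  exact ⟨h0 a, (h1 a).trans (mul_le_of_le_one_right hb (h.ind_le_one ω a))⟩

theorem sq_le (h : IsBanditEstimator M ℓ ind b) :
    ∀ᵐ ω ∂M, ∀ a, ℓ ω a ^ 2 ≤ b ^ 2 * ind ω a := by
  filter_upwards [h.nonneg, h.le_mul_ind] with ω h0 h1 a
  calc ℓ ω a ^ 2 ≤ (b * ind ω a) ^ 2 := pow_le_pow_left₀ (h0 a) (h1 a) 2
    _ = _ := by rw [mul_pow, h.ind_sq]

/-- The second moment is bounded by `b ^ 2` times the probability of a visit. The condition `c * b ≤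
1` is needed because overestimation can be as large as `b`. -/
theorem lintegral_exp_le (h : IsBanditEstimator M ℓ ind b) (hb : 0 ≤ b) {c : ℝ} (hc : 0 ≤ c)
    (hcb : c * b ≤ 1) (a : E) :
    ∫⁻ ω, ENNReal.ofReal (Real.exp (c * (ℓ ω a - ∫ ω, ℓ ω a ∂M)
      - c ^ 2 * b ^ 2 * ∫ ω, ind ω a ∂M)) ∂M ≤ 1 := by
  have := lintegral_exp_sub_le_one (M := M) (F := fun ω => c * ℓ ω a)
    (U := fun ω => c ^ 2 * b ^ 2 * ind ω a)
    (c := c * ∫ ω, ℓ ω a ∂M + c ^ 2 * b ^ 2 * ∫ ω, ind ω a ∂M)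
    ((h.integrable hb a).const_mul _) ((h.integrable_ind a).const_mul _) ?_ ?_ ?_
  · convert this using 5
    ring
  · filter_upwards [h.le_mul_ind] with ω h1
    have h2 := (h1 a).trans (mul_le_of_le_one_right hb (h.ind_le_one ω a))
    exact (mul_le_mul_of_nonneg_left h2 hc).trans hcb
  · filter_upwards [h.sq_le] with ω h1
    rw [mul_pow, mul_assoc]
    exact mul_le_mul_of_nonneg_left (h1 a) (sq_nonneg c)
  · rw [integral_const_mul, integral_const_mul]

theorem sq_mean_le {μ : E → ℝ} (hμ : μ ∈ stdSimplex ℝ E) (v : E → ℝ) :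
    (∑ a, μ a * v a) ^ 2 ≤ ∑ a, μ a * v a ^ 2 := by
  have h1 : ∑ a, μ a * (v a - ∑ a, μ a * v a) ^ 2
      = ∑ a, μ a * v a ^ 2 - (∑ a, μ a * v a) ^ 2 := by
    set s := ∑ a, μ a * v a
    have : ∀ a, μ a * (v a - s) ^ 2 = μ a * v a ^ 2 - 2 * s * (μ a * v a) + s ^ 2 * μ a :=
      fun a => by ring
    rw [Finset.sum_congr rfl fun a _ => this a, Finset.sum_add_distrib, Finset.sum_sub_distrib,
      ← Finset.mul_sum, ← Finset.mul_sum, hμ.2]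
    ring
  have h2 : 0 ≤ ∑ a, μ a * (v a - ∑ a, μ a * v a) ^ 2 :=
    Finset.sum_nonneg fun a _ => mul_nonneg (hμ.1 a) (sq_nonneg _)
  linarith

/-- Since the estimates are nonnegative, the exponent before centering is at most zero, so
underestimation requires no bound on `c * b`. Convexity of the square moves the average over `μ`
outside. -/
theorem lintegral_exp_mean_le (h : IsBanditEstimator M ℓ ind b) (hb : 0 ≤ b) {c : ℝ} (hc : 0 ≤ c)
    {μ : E → ℝ} (hμ : μ ∈ stdSimplex ℝ E) :
    ∫⁻ ω, ENNReal.ofReal (Real.exp (c * ∑ a, μ a * ((∫ ω, ℓ ω a ∂M) - ℓ ω a)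
      - c ^ 2 * b ^ 2 * ∑ a, μ a * ∫ ω, ind ω a ∂M)) ∂M ≤ 1 := by
  have hi := fun a (_ : a ∈ Finset.univ) => (h.integrable hb a).const_mul (μ a)
  have hi' := fun a (_ : a ∈ Finset.univ) => (h.integrable_ind a).const_mul (μ a)
  have := lintegral_exp_sub_le_one (M := M) (F := fun ω => -c * ∑ a, μ a * ℓ ω a)
    (U := fun ω => c ^ 2 * b ^ 2 * ∑ a, μ a * ind ω a)
    (c := -c * ∑ a, μ a * ∫ ω, ℓ ω a ∂M + c ^ 2 * b ^ 2 * ∑ a, μ a * ∫ ω, ind ω a ∂M)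
    ((integrable_finsetSum _ hi).const_mul _) ((integrable_finsetSum _ hi').const_mul _) ?_ ?_ ?_
  · convert this using 5
    simp only [mul_sub, Finset.sum_sub_distrib]
    ring
  · filter_upwards [h.nonneg] with ω h0
    have : 0 ≤ ∑ a, μ a * ℓ ω a := Finset.sum_nonneg fun a _ => mul_nonneg (hμ.1 a) (h0 a)
    nlinarith
  · filter_upwards [h.sq_le] with ω h1
    rw [mul_pow, neg_sq, mul_assoc]
    refine mul_le_mul_of_nonneg_left ((sq_mean_le hμ _).trans ?_) (sq_nonneg c)
    rw [Finset.mul_sum]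
    refine Finset.sum_le_sum fun a _ => ?_
    have := mul_le_mul_of_nonneg_left (h1 a) (hμ.1 a)
    linarith
  · rw [integral_const_mul, integral_const_mul, integral_finsetSum _ hi,
      integral_finsetSum _ hi']
    simp only [integral_const_mul, le_refl]

/-- The normalization brings the squared regrets into `[0, 1]`, where `F ^ 2 ≤ F ≤ U`; mean and
second moment are then both at most the mean of `U`, and the compensator is twice that mean. -/
theorem lintegral_exp_regret_sq_le [Nonempty E] (h : IsBanditEstimator M ℓ ind b) (hb : 0 < b)
    {μ : E → ℝ} (hμ : μ ∈ stdSimplex ℝ E) :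
    ∫⁻ ω, ENNReal.ofReal (Real.exp (
      1 / (2 * Fintype.card E * b ^ 2) * ∑ a, ((∑ a', μ a' * ℓ ω a') - ℓ ω a) ^ 2
      - 1 / Fintype.card E * ∑ a, (1 + Fintype.card E * μ a) * ∫ ω, ind ω a ∂M)) ∂M ≤ 1 := by
  set k : ℝ := (Fintype.card E : ℝ)
  have hk : 1 ≤ k := by
    simp only [k]
    exact_mod_cast Fintype.card_pos
  have hk0 : 0 < k := by linarith
  set F : Ω → ℝ := fun ω => 1 / (2 * k * b ^ 2) * ∑ a, ((∑ a', μ a' * ℓ ω a') - ℓ ω a) ^ 2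
  set U : Ω → ℝ := fun ω => 1 / (2 * k) * ∑ a, (1 + k * μ a) * ind ω a
  have hμ1 : ∀ a, μ a ≤ 1 := fun a =>
    hμ.2 ▸ Finset.single_le_sum (fun a _ => hμ.1 a) (Finset.mem_univ a)
  have hi' := fun a (_ : a ∈ Finset.univ) => (h.integrable_ind a).const_mul (1 + k * μ a)
  have hU : Integrable U M := (integrable_finsetSum _ hi').const_mul _
  have hF0 : ∀ ω, 0 ≤ F ω := fun ω =>
    mul_nonneg (by positivity) (Finset.sum_nonneg fun a _ => sq_nonneg _)
  have hFU : ∀ᵐ ω ∂M, F ω ≤ U ω := by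
    filter_upwards [h.sq_le, h.nonneg] with ω h1 h0
    have hs : ∑ a, ((∑ a', μ a' * ℓ ω a') - ℓ ω a) ^ 2
        ≤ b ^ 2 * ∑ a, (1 + k * μ a) * ind ω a := by
      have h2 := sq_mean_le hμ (ℓ ω)
      have h3 : 0 ≤ ∑ a, μ a * ℓ ω a := Finset.sum_nonneg fun a _ => mul_nonneg (hμ.1 a) (h0 a)
      set s := ∑ a, μ a * ℓ ω a
      have h4 : ∑ a, (s - ℓ ω a) ^ 2 = k * s ^ 2 - 2 * s * ∑ a, ℓ ω a + ∑ a, ℓ ω a ^ 2 := by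
        have : ∀ a, (s - ℓ ω a) ^ 2 = s ^ 2 - 2 * s * ℓ ω a + ℓ ω a ^ 2 := fun a => by ring
        rw [Finset.sum_congr rfl fun a _ => this a, Finset.sum_add_distrib,
          Finset.sum_sub_distrib, ← Finset.mul_sum]
        simp [k]
      -- The cross term `-2 * s * ∑ a, ℓ ω a` has a favourable sign and is dropped.
      have h5 : 0 ≤ ∑ a, ℓ ω a := Finset.sum_nonneg fun a _ => h0 a
      calc _ ≤ k * ∑ a, μ a * ℓ ω a ^ 2 + ∑ a, ℓ ω a ^ 2 := by
            rw [h4]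
            have := mul_le_mul_of_nonneg_left h2 hk0.le
            have := mul_nonneg h3 h5
            linarith
        _ = ∑ a, (1 + k * μ a) * ℓ ω a ^ 2 := by
            rw [Finset.mul_sum, ← Finset.sum_add_distrib]
            exact Finset.sum_congr rfl fun a _ => by ring
        _ ≤ _ := by
            rw [Finset.mul_sum]
            refine Finset.sum_le_sum fun a _ => ?_
            have := mul_le_mul_of_nonneg_left (h1 a)
              (show 0 ≤ 1 + k * μ a from by have := mul_nonneg hk0.le (hμ.1 a); linarith)
            linarith
    calc F ω ≤ 1 / (2 * k * b ^ 2) * (b ^ 2 * ∑ a, (1 + k * μ a) * ind ω a) :=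
          mul_le_mul_of_nonneg_left hs (by positivity)
      _ = U ω := by simp only [U]; field_simp
  -- Each coefficient `1 + k * μ a` is at most `2 * k`, and at most one action is observed.
  have hU1 : ∀ ω, U ω ≤ 1 := by
    intro ω
    calc U ω ≤ 1 / (2 * k) * ((2 * k) * ∑ a, ind ω a) := by
          refine mul_le_mul_of_nonneg_left ?_ (by positivity)
          rw [Finset.mul_sum]
          refine Finset.sum_le_sum fun a _ => mul_le_mul_of_nonneg_right ?_ (h.ind_nonneg ω a)
          have := mul_le_mul_of_nonneg_left (hμ1 a) hk0.le
          linarith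
      _ = ∑ a, ind ω a := by field_simp
      _ ≤ 1 := h.sum_ind_le ω
  have hFm : Measurable F := by
    have := h.measurable
    exact measurable_const.mul (Finset.measurable_sum _ fun a _ =>
      ((Finset.measurable_sum _ fun a' _ => measurable_const.mul (this a')).sub (this a)).pow_const 2)
  have hF : Integrable F M := Integrable.of_mem_Icc 0 1 hFm.aemeasurable
    (hFU.mono fun ω hω => ⟨hF0 ω, hω.trans (hU1 ω)⟩)
  refine lintegral_exp_sub_le_one hF hU (hFU.mono fun ω hω => hω.trans (hU1 ω)) ?_ ?_
  · filter_upwards [hFU] with ω hω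
    have := hω.trans (hU1 ω)
    nlinarith [hF0 ω]
  · have h1 := integral_mono_ae hF hU hFU
    have h2 : ∫ ω, U ω ∂M = 1 / (2 * k) * ∑ a, (1 + k * μ a) * ∫ ω, ind ω a ∂M := by
      simp only [U]
      rw [integral_const_mul, integral_finsetSum _ hi']
      simp only [integral_const_mul]
    have h3 : 1 / k * ∑ a, (1 + k * μ a) * ∫ ω, ind ω a ∂M
        = 2 * (1 / (2 * k) * ∑ a, (1 + k * μ a) * ∫ ω, ind ω a ∂M) := by field_simp
    linarith

end IsBanditEstimator

end ExponentialMoments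

/-! ### Integration against the law of an episode with independent rewards. -/

section PlayLaw

variable {H : ℕ} {S A B : Type*} [Fintype S] [Fintype A] [Fintype B]

/-- Law of the rewards of a play, drawn independently from `ρ`. -/
noncomputable def rewardLaw (ρ : S × A × B → Measure ℝ) (π : Play H S A B) :
    Measure (Fin H → ℝ) :=
  Measure.pi fun h => ρ (π h)

/-- Law of an episode whose play has law `p` and whose rewards are drawn independently from `ρ`. -/
noncomputable def playLaw (p : Play H S A B → ℝ≥0∞) (ρ : S × A × B → Measure ℝ) :
    Measure (Episode H S A B) :=
  ∑ π : Play H S A B, p π • (Measure.dirac π).prod (rewardLaw ρ π)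

variable {p : Play H S A B → ℝ≥0∞} {ρ : S × A × B → Measure ℝ} [∀ z, IsProbabilityMeasure (ρ z)]

instance (π : Play H S A B) : IsProbabilityMeasure (rewardLaw ρ π) := by
  have : ∀ h, IsProbabilityMeasure (ρ (π h)) := fun h => inferInstance
  unfold rewardLaw
  infer_instance

theorem measurePreserving_rewardLaw (π : Play H S A B) (j : Fin H) :
    MeasurePreserving (fun r : Fin H → ℝ => r j) (rewardLaw ρ π) (ρ (π j)) := by
  have : ∀ h, IsProbabilityMeasure (ρ (π h)) := fun h => inferInstance
  exact measurePreserving_eval (fun h => ρ (π h)) j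

theorem ae_playLaw {P : Play H S A B → (Fin H → ℝ) → Prop}
    (hP : ∀ π, ∀ᵐ r ∂(rewardLaw ρ π), P π r)
    (hm : MeasurableSet {e : Episode H S A B | P e.1 e.2}) : ∀ᵐ e ∂(playLaw p ρ), P e.1 e.2 := by
  unfold playLaw
  rw [ae_finsetSum_measure_iff]
  intro π _
  refine Measure.ae_smul_measure ?_ _
  rw [Measure.dirac_prod]
  exact (ae_map_iff measurable_prodMk_left.aemeasurable hm).2 (hP π)

theorem measurable_of_play {γ : Type*} [MeasurableSpace γ] (φ : Play H S A B → γ) :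
    Measurable fun e : Episode H S A B => φ e.1 := by
  have : Measurable φ := fun _ _ => trivial
  exact this.comp measurable_fst

theorem isProbabilityMeasure_playLaw (hp : ∑ π, p π = 1) : IsProbabilityMeasure (playLaw p ρ) := by
  refine ⟨?_⟩
  unfold playLaw
  rw [Measure.finsetSum_apply]
  simp [hp]

theorem integral_playLaw (hp : ∀ π, p π ≠ ⊤) (φ : Play H S A B → ℝ) {f : (Fin H → ℝ) → ℝ}
    (hf : Measurable f) (hi : ∀ π : Play H S A B, Integrable f (rewardLaw ρ π)) :
    ∫ e, φ e.1 * f e.2 ∂(playLaw p ρ)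
      = ∑ π : Play H S A B, (p π).toReal * (φ π * ∫ r, f r ∂(rewardLaw ρ π)) := by
  have hm : Measurable fun e : Episode H S A B => φ e.1 * f e.2 :=
    (measurable_of_play φ).mul (hf.comp measurable_snd)
  unfold playLaw
  rw [integral_finsetSum_measure]
  · refine Finset.sum_congr rfl fun π _ => ?_
    rw [integral_smul_measure, Measure.dirac_prod,
      integral_map measurable_prodMk_left.aemeasurable hm.aestronglyMeasurable, smul_eq_mul]
    exact congrArg _ (integral_const_mul (φ π) f)
  · intro π _
    refine Integrable.smul_measure ?_ (hp π)
    rw [Measure.dirac_prod,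
      integrable_map_measure hm.aestronglyMeasurable measurable_prodMk_left.aemeasurable]
    exact (hi π).const_mul (φ π)

/-- Losses in `[0, 1]` computed from rewards that lie in `[0, 1]` almost surely. -/
structure IsLoss (gf : ℝ → ℝ) (ρ : S × A × B → Measure ℝ) : Prop where
  measurable : Measurable gf
  mem_Icc : ∀ z, ∀ᵐ r ∂(ρ z), gf r ∈ Set.Icc (0 : ℝ) 1

variable {gf : ℝ → ℝ}

theorem IsLoss.integrable (hg : IsLoss gf ρ) (z : S × A × B) : Integrable gf (ρ z) :=
  Integrable.of_mem_Icc 0 1 hg.measurable.aemeasurable (hg.mem_Icc z)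

theorem IsLoss.integral_mem_Icc (hg : IsLoss gf ρ) (z : S × A × B) :
    ∫ r, gf r ∂(ρ z) ∈ Set.Icc (0 : ℝ) 1 := by
  refine ⟨integral_nonneg_of_ae ((hg.mem_Icc z).mono fun r hr => hr.1), ?_⟩
  have := integral_mono_ae (hg.integrable z) (integrable_const (1 : ℝ))
    ((hg.mem_Icc z).mono fun r hr => hr.2)
  simpa using this

theorem IsLoss.integrable_sum (hg : IsLoss gf ρ) (s : Finset (Fin H)) (π : Play H S A B) :
    Integrable (fun r : Fin H → ℝ => ∑ j ∈ s, gf (r j)) (rewardLaw ρ π) :=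
  integrable_finsetSum _ fun j _ =>
    ((measurePreserving_rewardLaw π j).integrable_comp
      (hg.integrable _).aestronglyMeasurable).2 (hg.integrable _)

theorem IsLoss.integral_sum (hg : IsLoss gf ρ) (s : Finset (Fin H)) (π : Play H S A B) :
    ∫ r : Fin H → ℝ, ∑ j ∈ s, gf (r j) ∂(rewardLaw ρ π)
      = ∑ j ∈ s, ∫ r, gf r ∂(ρ (π j)) := by
  rw [integral_finsetSum]
  · refine Finset.sum_congr rfl fun j _ => ?_
    have h := measurePreserving_rewardLaw (ρ := ρ) π j
    have h' := integral_map (μ := rewardLaw ρ π) (measurable_pi_apply j).aemeasurable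
      hg.measurable.aestronglyMeasurable
    rw [h.map_eq] at h'
    exact h'.symm
  · intro j _
    exact ((measurePreserving_rewardLaw π j).integrable_comp
      (hg.integrable _).aestronglyMeasurable).2 (hg.integrable _)

theorem IsLoss.measurable_sum (hg : IsLoss gf ρ) (s : Finset (Fin H)) :
    Measurable fun r : Fin H → ℝ => ∑ j ∈ s, gf (r j) :=
  Finset.measurable_sum _ fun j _ => hg.measurable.comp (measurable_pi_apply j)

end PlayLaw

/-! ### Unbiasedness and size of the importance-weighted estimator. -/

section Estimator

variable {H : ℕ} {N E : Type*} [Fintype N] [Fintype E]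

theorem LayeredTree.seqForm_balanced_self (𝒯 : LayeredTree H N E) (n : N) (e : E) :
    𝒯.seqForm (𝒯.balanced (𝒯.layer n)) n e
      = 𝒯.reach (𝒯.balanced (𝒯.layer n)) n / Fintype.card E := by
  have : 𝒯.balanced (𝒯.layer n) n e = 1 / Fintype.card E := if_neg (lt_irrefl _)
  rw [LayeredTree.seqForm, this, mul_one_div]

-- On a play through `(x, a)`, the exploring policy contributes the balanced reach of `x` before its
-- layer, `1 / Fintype.card E` in it, and `μ` afterwards. The first two factors are exactly the
-- importance weight, and what remains is counterfactual.
open Classical in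
theorem IsOpponentWeight.sum_mul_prod_explore {Z : Type*} [Fintype Z] {𝒯 : LayeredTree H N E}
    {obs : Z → N × E} {w : (Fin H → Z) → ℝ} (hw : IsOpponentWeight 𝒯 obs w) (μ : N → E → ℝ)
    (f : Fin H → (Fin H → Z) → ℝ) (x : N) (a : E) :
    ∑ π, w π * (∏ j, 𝒯.explore μ (𝒯.layer x) (obs (π j)).1 (obs (π j)).2)
        * ((if obs (π (𝒯.layer x)) = (x, a) then 1 else 0) * f (𝒯.layer x) π)
      = 𝒯.reach (𝒯.balanced (𝒯.layer x)) x / Fintype.card E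
        * counterfactual 𝒯 obs w μ f x a := by
  rw [counterfactual, Finset.mul_sum]
  refine Finset.sum_congr rfl fun π _ => ?_
  by_cases hπ : w π = 0
  · simp [hπ]
  have hp := hw.isPath π hπ
  split_ifs with hx
  · set h := 𝒯.layer x
    have h1 : ∏ j with j < h, 𝒯.explore μ h (obs (π j)).1 (obs (π j)).2
        = 𝒯.reach (𝒯.balanced h) x := by
      have := hp.reach_eq_prod (𝒯.balanced h) h
      rw [hx] at this
      rw [this]
      refine Finset.prod_congr rfl fun j hj => ?_
      rw [LayeredTree.explore, if_pos (by rw [hp.layer_eq j]; exact (Finset.mem_filter.1 hj).2.le)]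
    have h2 : ∏ j with h < j, 𝒯.explore μ h (obs (π j)).1 (obs (π j)).2
        = ∏ j with h < j, μ (obs (π j)).1 (obs (π j)).2 := by
      refine Finset.prod_congr rfl fun j hj => ?_
      rw [LayeredTree.explore, if_neg]
      rw [hp.layer_eq j]
      exact (Finset.mem_filter.1 hj).2.not_ge
    have h3 : 𝒯.explore μ h (obs (π h)).1 (obs (π h)).2 = 1 / Fintype.card E := by
      rw [hx, LayeredTree.explore, if_pos le_rfl, LayeredTree.balanced, if_neg (lt_irrefl _)]
    rw [prod_eq_prod_lt_mul_prod_gt h fun j => 𝒯.explore μ h (obs (π j)).1 (obs (π j)).2,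
      h1, h2, h3]
    ring
  · simp

variable {S A B : Type*} [Fintype S] [Fintype A] [Fintype B]
  {p : Play H S A B → ℝ≥0∞} {ρ : S × A × B → Measure ℝ} [∀ z, IsProbabilityMeasure (ρ z)]
  {gf : ℝ → ℝ} {𝒯 : LayeredTree H N E} {obs : S × A × B → N × E}
  {w : (Fin H → S × A × B) → ℝ} {μ : N → E → ℝ} {x : N}

/-- The estimator of the player in an episode. -/
noncomputable def episodeEst (𝒯 : LayeredTree H N E) (obs : S × A × B → N × E) (gf : ℝ → ℝ)
    (x : N) (e : Episode H S A B) (a : E) : ℝ :=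
  𝒯.lossEst (fun h => obs (e.1 h)) (fun h => gf (e.2 h)) x a

open Classical in
/-- Indicator of a visit to a node and an edge in an episode. -/
noncomputable def episodeInd (𝒯 : LayeredTree H N E) (obs : S × A × B → N × E)
    (x : N) (e : Episode H S A B) (a : E) : ℝ :=
  if obs (e.1 (𝒯.layer x)) = (x, a) then 1 else 0

theorem episodeEst_eq (x : N) (e : Episode H S A B) (a : E) :
    episodeEst 𝒯 obs gf x e a = Fintype.card E / 𝒯.reach (𝒯.balanced (𝒯.layer x)) x
      * (episodeInd 𝒯 obs x e a * ∑ h ∈ Finset.Ici (𝒯.layer x), gf (e.2 h)) := by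
  rw [episodeEst, LayeredTree.lossEst, LayeredTree.seqForm_balanced_self, episodeInd,
    div_div_eq_mul_div, div_mul_eq_mul_div, div_mul_eq_mul_div]
  ring

theorem isBanditEstimator_episodeEst (hg : IsLoss gf ρ) (x : N) :
    IsBanditEstimator (playLaw p ρ) (episodeEst 𝒯 obs gf x) (episodeInd 𝒯 obs x)
      (Fintype.card E * H / 𝒯.reach (𝒯.balanced (𝒯.layer x)) x) := by
  have hm : 0 < 𝒯.reach (𝒯.balanced (𝒯.layer x)) x := 𝒯.reach_balanced_pos rfl
  have hmi : ∀ a, Measurable fun e : Episode H S A B => episodeInd 𝒯 obs x e a := by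
    intro a
    classical
    exact measurable_of_play fun π : Play H S A B =>
      if obs (π (𝒯.layer x)) = (x, a) then (1 : ℝ) else 0
  have h0 : ∀ (e : Episode H S A B) a, 0 ≤ episodeInd 𝒯 obs x e a := by
    intro e a
    unfold episodeInd
    split_ifs <;> simp
  have hae : ∀ᵐ e ∂(playLaw p ρ), ∀ j, gf (e.2 j) ∈ Set.Icc (0 : ℝ) 1 := by
    refine ae_playLaw (P := fun _ r => ∀ j, gf (r j) ∈ Set.Icc (0 : ℝ) 1) (fun π => ?_) ?_
    · exact ae_all_iff.2 fun j => (measurePreserving_rewardLaw π j).quasiMeasurePreserving.ae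
        (hg.mem_Icc _)
    · simp only [Set.ofPred_forall]
      refine MeasurableSet.iInter fun j => ?_
      exact (hg.measurable.comp ((measurable_pi_apply j).comp measurable_snd)) measurableSet_Icc
  refine ⟨fun a => ?_, hmi, h0, fun e => ?_, fun e a => ?_, ?_, ?_⟩
  · simp only [episodeEst_eq]
    exact measurable_const.mul ((hmi a).mul ((hg.measurable_sum _).comp measurable_snd))
  · by_cases h : (obs (e.1 (𝒯.layer x))).1 = x
    · rw [Finset.sum_eq_single (obs (e.1 (𝒯.layer x))).2]
      · unfold episodeInd
        split_ifs <;> simp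
      · intro a _ ha
        rw [episodeInd, if_neg]
        intro h'
        exact ha (by rw [h'])
      · simp
    · rw [Finset.sum_eq_zero]
      · exact zero_le_one
      · intro a _
        rw [episodeInd, if_neg]
        intro h'
        exact h (by rw [h'])
  · unfold episodeInd
    split_ifs <;> simp
  · filter_upwards [hae] with e he a
    rw [episodeEst_eq]
    have := h0 e a
    have := Finset.sum_nonneg fun h (_ : h ∈ Finset.Ici (𝒯.layer x)) => (he h).1
    positivity
  · filter_upwards [hae] with e he a
    rw [episodeEst_eq]
    have h1 : ∑ h ∈ Finset.Ici (𝒯.layer x), gf (e.2 h) ≤ H := by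
      calc _ ≤ ∑ h ∈ Finset.Ici (𝒯.layer x), (1 : ℝ) := Finset.sum_le_sum fun h _ => (he h).2
        _ ≤ ∑ h : Fin H, (1 : ℝ) :=
            Finset.sum_le_sum_of_subset_of_nonneg (Finset.subset_univ _) fun _ _ _ => zero_le_one
        _ = H := by simp
    calc _ ≤ Fintype.card E / 𝒯.reach (𝒯.balanced (𝒯.layer x)) x
          * (episodeInd 𝒯 obs x e a * H) := by
          have := h0 e a
          gcongr
      _ = _ := by ring

theorem integral_episodeInd (hw : IsOpponentWeight 𝒯 obs w) (hp : ∀ π, p π ≠ ⊤)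
    (hpw : ∀ π : Fin H → S × A × B, (p π).toReal
      = w π * ∏ j, 𝒯.explore μ (𝒯.layer x) (obs (π j)).1 (obs (π j)).2) (a : E) :
    ∫ e, episodeInd 𝒯 obs x e a ∂(playLaw p ρ)
      = 𝒯.reach (𝒯.balanced (𝒯.layer x)) x / Fintype.card E
        * counterfactual 𝒯 obs w μ (fun _ _ => 1) x a := by
  classical
  rw [← hw.sum_mul_prod_explore]
  have := integral_playLaw (ρ := ρ) hp
    (fun π => if obs (π (𝒯.layer x)) = (x, a) then (1 : ℝ) else 0) (f := fun _ => 1)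
    measurable_const fun π => integrable_const 1
  simp only [mul_one, integral_const, probReal_univ, smul_eq_mul] at this
  simp only [episodeInd, mul_one]
  rw [this]
  exact Finset.sum_congr rfl fun π _ => by rw [← hpw π]

theorem integral_episodeEst [Nonempty E] (hw : IsOpponentWeight 𝒯 obs w) (hp : ∀ π, p π ≠ ⊤)
    (hpw : ∀ π : Fin H → S × A × B, (p π).toReal
      = w π * ∏ j, 𝒯.explore μ (𝒯.layer x) (obs (π j)).1 (obs (π j)).2) (hg : IsLoss gf ρ) (a : E) :
    ∫ e, episodeEst 𝒯 obs gf x e a ∂(playLaw p ρ)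
      = counterfactual 𝒯 obs w μ (lossToGo fun z => ∫ r, gf r ∂(ρ z)) x a := by
  classical
  have hm : 0 < 𝒯.reach (𝒯.balanced (𝒯.layer x)) x := 𝒯.reach_balanced_pos rfl
  have h1 := hw.sum_mul_prod_explore μ (lossToGo fun z => ∫ r, gf r ∂(ρ z)) x a
  have h2 := integral_playLaw (ρ := ρ) hp
    (fun π => if obs (π (𝒯.layer x)) = (x, a) then (1 : ℝ) else 0)
    (hg.measurable_sum (Finset.Ici (𝒯.layer x))) fun π => hg.integrable_sum _ π
  simp only [hg.integral_sum] at h2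
  have h3 : ∫ e, episodeInd 𝒯 obs x e a * ∑ h ∈ Finset.Ici (𝒯.layer x), gf (e.2 h)
        ∂(playLaw p ρ)
      = 𝒯.reach (𝒯.balanced (𝒯.layer x)) x / Fintype.card E
        * counterfactual 𝒯 obs w μ (lossToGo fun z => ∫ r, gf r ∂(ρ z)) x a := by
    rw [← h1]
    refine h2.trans (Finset.sum_congr rfl fun π _ => ?_)
    rw [hpw π]
    rfl
  simp only [episodeEst_eq]
  rw [integral_const_mul, h3]
  have : (Fintype.card E : ℝ) ≠ 0 := by positivity
  field_simp

end Estimator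

/-! ### The compensated statistics of one round. -/

section Deviation

variable {H : ℕ} {N E : Type*} [Fintype N] [Fintype E]

/-- Compensated statistics of one round at an infoset that the exploration policy reaches with
probability `m`: `some (some a)` measures the overestimation of the loss of `a`, `some none` the
underestimation of the loss of the policy `μ`, and `none` the squared estimated regrets. Here `ℓ`
estimates `L`, and `q a` is the counterfactual probability of the action `a`. -/
noncomputable def deviation (H : ℕ) (lam m : ℝ) (μ L q ℓ : E → ℝ) : Option (Option E) → ℝ
  | some (some a) => lam * m * (ℓ a - L a) - lam ^ 2 * m * Fintype.card E * H ^ 2 * q a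
  | some none => lam * m * ∑ a, μ a * (L a - ℓ a)
      - lam ^ 2 * m * Fintype.card E * H ^ 2 * ∑ a, μ a * q a
  | none => m ^ 2 / (2 * Fintype.card E ^ 3 * H ^ 2) * ∑ a, ((∑ a', μ a' * ℓ a') - ℓ a) ^ 2
      - m / Fintype.card E * ∑ a, (1 / Fintype.card E + μ a) * q a

theorem measurable_deviation {Ω : Type*} [MeasurableSpace Ω] (lam m : ℝ) {μ L q ℓ : Ω → E → ℝ}
    (hμ : ∀ a, Measurable fun ω => μ ω a) (hL : ∀ a, Measurable fun ω => L ω a)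
    (hq : ∀ a, Measurable fun ω => q ω a) (hℓ : ∀ a, Measurable fun ω => ℓ ω a)
    (i : Option (Option E)) :
    Measurable fun ω => deviation H lam m (μ ω) (L ω) (q ω) (ℓ ω) i := by
  match i with
  | some (some a) => unfold deviation; fun_prop
  | some none => unfold deviation; fun_prop
  | none => unfold deviation; fun_prop

theorem measurable_counterfactual {Ω Z : Type*} [MeasurableSpace Ω] [Fintype Z]
    (𝒯 : LayeredTree H N E) (obs : Z → N × E) {w : Ω → (Fin H → Z) → ℝ} {μ : Ω → N → E → ℝ}
    (hw : ∀ π, Measurable fun ω => w ω π) (hμ : ∀ n e, Measurable fun ω => μ ω n e)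
    (f : Fin H → (Fin H → Z) → ℝ) (n : N) (e : E) :
    Measurable fun ω => counterfactual 𝒯 obs (w ω) (μ ω) f n e := by
  unfold counterfactual
  refine Finset.measurable_sum _ fun π _ => ?_
  split_ifs
  · exact ((hw π).mul (Finset.measurable_prod _ fun j _ => hμ _ _)).mul_const _
  · exact measurable_const

variable {S A B : Type*} [Fintype S] [Fintype A] [Fintype B]
  {p : Play H S A B → ℝ≥0∞} {ρ : S × A × B → Measure ℝ} [∀ z, IsProbabilityMeasure (ρ z)]
  {gf : ℝ → ℝ} {𝒯 : LayeredTree H N E} {obs : S × A × B → N × E}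
  {w : (Fin H → S × A × B) → ℝ} {μ : N → E → ℝ} {x : N}

/-- The statistics of an episode in which the player explores the layer of `x`. -/
noncomputable def episodeDeviation (𝒯 : LayeredTree H N E) (obs : S × A × B → N × E)
    (gf : ℝ → ℝ) (ρ : S × A × B → Measure ℝ) (lam : ℝ) (w : (Fin H → S × A × B) → ℝ)
    (μ : N → E → ℝ) (x : N) (i : Option (Option E)) (e : Episode H S A B) : ℝ :=
  deviation H lam (𝒯.reach (𝒯.balanced (𝒯.layer x)) x) (μ x)
    (counterfactual 𝒯 obs w μ (lossToGo fun z => ∫ r, gf r ∂(ρ z)) x)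
    (counterfactual 𝒯 obs w μ (fun _ _ => 1) x) (episodeEst 𝒯 obs gf x e) i

theorem measurable_episodeEst (𝒯 : LayeredTree H N E) (obs : S × A × B → N × E)
    (hg : Measurable gf) (x : N) (a : E) :
    Measurable fun e : Episode H S A B => episodeEst 𝒯 obs gf x e a := by
  classical
  simp only [episodeEst_eq]
  refine measurable_const.mul ((measurable_of_play fun π : Play H S A B =>
    if obs (π (𝒯.layer x)) = (x, a) then (1 : ℝ) else 0).mul
    (Finset.measurable_sum _ fun j _ => ?_))
  exact hg.comp ((measurable_pi_apply j).comp measurable_snd)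

theorem measurable_episodeDeviation {Ω : Type*} [MeasurableSpace Ω] (hg : Measurable gf) (lam : ℝ)
    {w : Ω → (Fin H → S × A × B) → ℝ} {μ : Ω → N → E → ℝ}
    (hw : ∀ π, Measurable fun ω => w ω π) (hμ : ∀ n e, Measurable fun ω => μ ω n e) (x : N)
    (i : Option (Option E)) {e : Ω → Episode H S A B} (he : Measurable e) :
    Measurable fun ω => episodeDeviation 𝒯 obs gf ρ lam (w ω) (μ ω) x i (e ω) :=
  measurable_deviation _ _ (hμ x) (fun _ => measurable_counterfactual _ _ hw hμ _ _ _)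
    (fun _ => measurable_counterfactual _ _ hw hμ _ _ _)
    (fun a => (measurable_episodeEst 𝒯 obs hg x a).comp he) i

/-- The step size `lam * m` is proportional to the exploration probability `m`, the inverse scale of
the estimator. Thus `lam * m * (Fintype.card E * H / m) = lam * Fintype.card E * H`, which makes the
admissible `lam` independent of the infoset. The visit probability `m / Fintype.card E * q a`
supplies the factor `m` in the compensators. -/
theorem lintegral_exp_deviation_le [Nonempty E] (hw : IsOpponentWeight 𝒯 obs w)
    (hp : ∀ π, p π ≠ ⊤) (hp1 : ∑ π, p π = 1)
    (hpw : ∀ π : Fin H → S × A × B, (p π).toReal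
      = w π * ∏ j, 𝒯.explore μ (𝒯.layer x) (obs (π j)).1 (obs (π j)).2) (hg : IsLoss gf ρ)
    (hμ : IsPolicy μ) {lam : ℝ} (hlam : 0 ≤ lam) (hlam1 : lam * Fintype.card E * H ≤ 1)
    (i : Option (Option E)) :
    ∫⁻ e, ENNReal.ofReal (Real.exp (episodeDeviation 𝒯 obs gf ρ lam w μ x i e)) ∂(playLaw p ρ)
      ≤ 1 := by
  simp only [episodeDeviation]
  have := isProbabilityMeasure_playLaw (ρ := ρ) hp1
  have hm : 0 < 𝒯.reach (𝒯.balanced (𝒯.layer x)) x := 𝒯.reach_balanced_pos rfl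
  have hH : (0 : ℝ) < H := by exact_mod_cast (𝒯.layer x).pos
  have hE : (0 : ℝ) < Fintype.card E := by exact_mod_cast Fintype.card_pos
  have hest := isBanditEstimator_episodeEst (p := p) (𝒯 := 𝒯) (obs := obs) hg x
  have hint := integral_episodeEst (x := x) hw hp hpw hg
  have hind := integral_episodeInd (ρ := ρ) (x := x) hw hp hpw
  set m := 𝒯.reach (𝒯.balanced (𝒯.layer x)) x
  have hb : 0 < Fintype.card E * H / m := by positivity
  match i with
  | some (some a) =>
    have h := hest.lintegral_exp_le hb.le (c := lam * m) (by positivity) ?_ a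
    · rw [hint, hind] at h
      convert h using 5
      simp only [deviation]
      field_simp
    · calc lam * m * (Fintype.card E * H / m) = lam * Fintype.card E * H := by field_simp
        _ ≤ 1 := hlam1
  | some none =>
    have h := hest.lintegral_exp_mean_le hb.le (c := lam * m) (by positivity) (hμ x)
    simp only [hint, hind] at h
    convert h using 5
    simp only [deviation]
    congr 1
    rw [Finset.mul_sum, Finset.mul_sum]
    refine Finset.sum_congr rfl fun a _ => ?_
    field_simp
  | none =>
    have h := hest.lintegral_exp_regret_sq_le hb (hμ x)
    simp only [hind] at h
    convert h using 5
    simp only [deviation]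
    congr 1
    · congr 1
      field_simp
    · rw [Finset.mul_sum, Finset.mul_sum]
      refine Finset.sum_congr rfl fun a _ => ?_
      field_simp

end Deviation

/-! ### Concentration along the run of self-play. -/

namespace IIEFG

variable {H : ℕ} {S X Y A B : Type*} [Fintype S] [Fintype X] [Fintype Y] [Fintype A] [Fintype B]
  [Nonempty A] [Nonempty B]

theorem isPolicy_maxPolicy (G : IIEFG H S X Y A B) (t : ℕ) (ω : Fin t → Round H S A B) :
    IsPolicy (G.maxPolicy t ω) := fun _ => rmDist_mem_stdSimplex _

theorem isPolicy_minPolicy (G : IIEFG H S X Y A B) (t : ℕ) (ω : Fin t → Round H S A B) :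
    IsPolicy (G.minPolicy t ω) := fun _ => rmDist_mem_stdSimplex _

theorem isPolicy_maxPlayed (G : IIEFG H S X Y A B) {μ : X → A → ℝ} (hμ : IsPolicy μ)
    (i : Fin H ⊕ Fin H) : IsPolicy (G.maxPlayed μ i) := by
  rcases i with h | h
  · exact G.maxTree.isPolicy_explore G.exists_child_maxTree hμ h
  · exact hμ

theorem isPolicy_minPlayed (G : IIEFG H S X Y A B) {ν : Y → B → ℝ} (hν : IsPolicy ν)
    (i : Fin H ⊕ Fin H) : IsPolicy (G.minPlayed ν i) := by
  rcases i with h | h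
  · exact hν
  · exact G.minTree.isPolicy_explore G.exists_child_minTree hν h

/-- The reward distribution of a step. -/
def stepReward (G : IIEFG H S X Y A B) (z : S × A × B) : Measure ℝ := G.reward z.1 z.2.1 z.2.2

instance (G : IIEFG H S X Y A B) (z : S × A × B) : IsProbabilityMeasure (G.stepReward z) :=
  G.reward_prob _ _ _

theorem isLoss_max (G : IIEFG H S X Y A B) : IsLoss (fun r => 1 - r) G.stepReward where
  measurable := measurable_const.sub measurable_id
  mem_Icc z := (G.reward_mem z.1 z.2.1 z.2.2).mono fun r hr =>
    ⟨by linarith [hr.2], by linarith [hr.1]⟩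

theorem isLoss_min (G : IIEFG H S X Y A B) : IsLoss (fun r => r) G.stepReward where
  measurable := measurable_id
  mem_Icc z := G.reward_mem z.1 z.2.1 z.2.2

theorem episodeLaw_eq_playLaw (G : IIEFG H S X Y A B) (μ : X → A → ℝ) (ν : Y → B → ℝ) :
    G.episodeLaw μ ν = playLaw (G.playProb μ ν) G.stepReward := rfl

theorem sum_playProb (G : IIEFG H S X Y A B) {μ : X → A → ℝ} {ν : Y → B → ℝ} (hμ : IsPolicy μ)
    (hν : IsPolicy ν) : ∑ π, G.playProb μ ν π = 1 := by
  rw [← ENNReal.toReal_eq_one_iff, ENNReal.toReal_sum fun π _ => G.playProb_ne_top μ ν π,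
    ← (G.isOpponentWeight_weightX hν).total (fun _ => μ) fun _ => hμ]
  refine Finset.sum_congr rfl fun π _ => ?_
  exact (G.toReal_playProb hμ hν π).trans (G.weightX_mul_prod (fun _ => μ) ν π).symm

theorem isProbabilityMeasure_episodeLaw (G : IIEFG H S X Y A B) {μ : X → A → ℝ} {ν : Y → B → ℝ}
    (hμ : IsPolicy μ) (hν : IsPolicy ν) : IsProbabilityMeasure (G.episodeLaw μ ν) := by
  rw [episodeLaw_eq_playLaw]
  exact isProbabilityMeasure_playLaw (G.sum_playProb hμ hν)

theorem measurePreserving_roundLaw (G : IIEFG H S X Y A B) {μ : X → A → ℝ} {ν : Y → B → ℝ}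
    (hμ : IsPolicy μ) (hν : IsPolicy ν) (i : Fin H ⊕ Fin H) :
    MeasurePreserving (fun r : Round H S A B => r i) (G.roundLaw μ ν)
      (G.episodeLaw (G.maxPlayed μ i) (G.minPlayed ν i)) := by
  have := fun i => G.isProbabilityMeasure_episodeLaw (G.isPolicy_maxPlayed hμ i)
    (G.isPolicy_minPlayed hν i)
  exact measurePreserving_eval _ i

instance (G : IIEFG H S X Y A B) (t : ℕ) : IsMarkovKernel (G.roundKernel t) := by
  refine ⟨fun ω => ?_⟩
  have := fun i => G.isProbabilityMeasure_episodeLaw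
    (G.isPolicy_maxPlayed (G.isPolicy_maxPolicy t ω) i)
    (G.isPolicy_minPlayed (G.isPolicy_minPolicy t ω) i)
  change IsProbabilityMeasure (G.roundLaw (G.maxPolicy t ω) (G.minPolicy t ω))
  unfold roundLaw
  infer_instance

theorem measurable_snoc (T : ℕ) : Measurable fun q : (Fin T → Round H S A B) × Round H S A B =>
    (Fin.snoc (α := fun _ => Round H S A B) q.1 q.2 : Fin (T + 1) → Round H S A B) := by
  refine measurable_pi_iff.2 fun t => ?_
  induction t using Fin.lastCases with
  | last => simpa using measurable_snd
  | cast t =>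
    simp only [Fin.snoc_castSucc]
    exact (measurable_pi_apply t).comp measurable_fst

instance (G : IIEFG H S X Y A B) (T : ℕ) : IsProbabilityMeasure (G.selfPlayLaw T) := by
  induction T with
  | zero => unfold selfPlayLaw; infer_instance
  | succ T ih =>
    unfold selfPlayLaw
    exact Measure.isProbabilityMeasure_map (measurable_snoc T).aemeasurable

theorem measurable_history {T : ℕ} (t : Fin T) : Measurable fun ω : Fin T → Round H S A B =>
    ((fun τ : Fin t => ω (Fin.castLE t.isLt.le τ)), ω t) :=
  (measurable_pi_lambda _ fun τ => measurable_pi_apply (Fin.castLE t.isLt.le τ)).prodMk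
    (measurable_pi_apply t)

/-- The exponential supermartingale of self-play. -/
theorem lintegral_exp_sum_le_one (G : IIEFG H S X Y A B)
    {f : (t : ℕ) → (Fin t → Round H S A B) → Round H S A B → ℝ}
    (hf : ∀ t, Measurable fun q : (Fin t → Round H S A B) × Round H S A B => f t q.1 q.2)
    (h1 : ∀ t ω, ∫⁻ r, ENNReal.ofReal (Real.exp (f t ω r)) ∂(G.roundKernel t ω) ≤ 1) (T : ℕ) :
    ∫⁻ ω, ENNReal.ofReal (Real.exp (∑ t : Fin T,
      f t (fun τ => ω (Fin.castLE t.isLt.le τ)) (ω t))) ∂(G.selfPlayLaw T) ≤ 1 := by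
  have hm : ∀ T : ℕ, Measurable fun ω : Fin T → Round H S A B => ENNReal.ofReal (Real.exp
      (∑ t : Fin T, f t (fun τ => ω (Fin.castLE t.isLt.le τ)) (ω t))) := by
    intro T
    refine (Real.measurable_exp.comp (Finset.measurable_sum _ fun t _ => ?_)).ennreal_ofReal
    exact (hf t).comp (measurable_history t)
  induction T with
  | zero =>
    unfold selfPlayLaw
    simp
  | succ T ih =>
    unfold selfPlayLaw
    rw [lintegral_map (hm _) (measurable_snoc T)]
    -- Integrating out the last round first: given the history its factor has mean at most one, and
    -- the other factors do not depend on it.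
    refine (Measure.lintegral_compProd ((hm _).comp (measurable_snoc T))).le.trans
      (le_trans (lintegral_mono fun ω => ?_) ih)
    have hs : ∀ r : Round H S A B, ENNReal.ofReal (Real.exp (∑ t : Fin (T + 1),
          f t (fun τ => (Fin.snoc (α := fun _ => Round H S A B) ω r : Fin (T + 1) → _)
            (Fin.castLE t.isLt.le τ))
          ((Fin.snoc (α := fun _ => Round H S A B) ω r : Fin (T + 1) → _) t)))
        = ENNReal.ofReal (Real.exp (∑ t : Fin T, f t (fun τ => ω (Fin.castLE t.isLt.le τ)) (ω t)))
          * ENNReal.ofReal (Real.exp (f T ω r)) := by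
      intro r
      rw [← ENNReal.ofReal_mul (Real.exp_pos _).le, ← Real.exp_add, Fin.sum_univ_castSucc]
      have h2 : ∀ τ : Fin T, (Fin.snoc (α := fun _ => Round H S A B) ω r : Fin (T + 1) → _)
          τ.castSucc = ω τ := fun τ => Fin.snoc_castSucc _ _ _
      have h3 : (Fin.snoc (α := fun _ => Round H S A B) ω r : Fin (T + 1) → _) (Fin.last T) = r :=
        Fin.snoc_last _ _
      have h4 : ∀ t : Fin T, (fun τ => (Fin.snoc (α := fun _ => Round H S A B) ω r :
          Fin (T + 1) → _) (Fin.castLE t.castSucc.isLt.le τ))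
          = fun τ => ω (Fin.castLE t.isLt.le τ) := fun t =>
            funext fun τ => h2 (Fin.castLE t.isLt.le τ)
      have h5 : (fun τ => (Fin.snoc (α := fun _ => Round H S A B) ω r :
          Fin (T + 1) → _) (Fin.castLE (Fin.last T).isLt.le τ)) = ω := funext fun τ => h2 _
      rw [h3]
      refine congrArg (fun u => ENNReal.ofReal (Real.exp u)) (congrArg₂ (· + ·)
        (Finset.sum_congr rfl fun t _ => ?_) (congrArg (fun u => f T u r) h5))
      rw [h2]
      exact congrArg (fun u => f t u (ω t)) (h4 t)
    refine (lintegral_congr hs).le.trans ?_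
    rw [lintegral_const_mul' _ _ ENNReal.ofReal_ne_top]
    exact mul_le_of_le_one_right zero_le (h1 T ω)

theorem selfPlayLaw_real_sum_ge_le (G : IIEFG H S X Y A B)
    {f : (t : ℕ) → (Fin t → Round H S A B) → Round H S A B → ℝ}
    (hf : ∀ t, Measurable fun q : (Fin t → Round H S A B) × Round H S A B => f t q.1 q.2)
    (h1 : ∀ t ω, ∫⁻ r, ENNReal.ofReal (Real.exp (f t ω r)) ∂(G.roundKernel t ω) ≤ 1) (T : ℕ)
    (c : ℝ) :
    (G.selfPlayLaw T).real {ω | c < ∑ t : Fin T, f t (fun τ => ω (Fin.castLE t.isLt.le τ)) (ω t)}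
      ≤ Real.exp (-c) := by
  set F := fun ω : Fin T → Round H S A B =>
    ∑ t : Fin T, f t (fun τ => ω (Fin.castLE t.isLt.le τ)) (ω t)
  have hm : Measurable F := Finset.measurable_sum _ fun t _ =>
    (hf t).comp (measurable_history t)
  have h2 := mul_meas_ge_le_lintegral (μ := G.selfPlayLaw T)
    (Real.measurable_exp.comp hm).ennreal_ofReal (ENNReal.ofReal (Real.exp c))
  have h3 := h2.trans (G.lintegral_exp_sum_le_one hf h1 T)
  have h4 : (G.selfPlayLaw T) {ω | c < F ω} ≤ ENNReal.ofReal (Real.exp (-c)) := by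
    have hsub : {ω | c < F ω} ⊆ {ω | ENNReal.ofReal (Real.exp c)
        ≤ ENNReal.ofReal ((Real.exp ∘ F) ω)} := fun ω hω =>
      ENNReal.ofReal_le_ofReal (Real.exp_le_exp.2 (le_of_lt hω))
    refine (measure_mono hsub).trans ?_
    rw [Real.exp_neg, ENNReal.ofReal_inv_of_pos (Real.exp_pos c), ENNReal.le_inv_iff_mul_le,
      mul_comm]
    exact h3
  exact ENNReal.toReal_le_of_le_ofReal (Real.exp_pos _).le h4

/-- The statistics of the max-player in a round. -/
noncomputable def maxDeviation (G : IIEFG H S X Y A B) (lam : ℝ) (x : X) (i : Option (Option A))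
    (μ : X → A → ℝ) (ν : Y → B → ℝ) (r : Round H S A B) : ℝ :=
  episodeDeviation G.maxTree G.obsX (fun r => 1 - r) G.stepReward lam (G.weightX ν) μ x i
    (r (Sum.inl (G.maxTree.layer x)))

/-- Given the history, both policies are fixed, and the episode in which the layer of `x` is
explored has the law assumed by `lintegral_exp_deviation_le`. -/
theorem selfPlayLaw_real_maxDeviation (G : IIEFG H S X Y A B) {lam : ℝ} (hlam : 0 ≤ lam)
    (hlam1 : lam * Fintype.card A * H ≤ 1) (x : X) (i : Option (Option A)) (T : ℕ) (c : ℝ) :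
    (G.selfPlayLaw T).real {ω | c < ∑ t : Fin T,
      G.maxDeviation lam x i (G.maxIterate ω t) (G.minIterate ω t) (ω t)} ≤ Real.exp (-c) := by
  refine G.selfPlayLaw_real_sum_ge_le
    (f := fun t ω r => G.maxDeviation lam x i (G.maxPolicy t ω) (G.minPolicy t ω) r)
    (fun t => ?_) (fun t ω => ?_) T c
  · refine measurable_episodeDeviation G.isLoss_max.measurable lam
      (fun π => Finset.measurable_prod _ fun h _ => ?_)
      (fun x a => (G.measurable_maxPolicy t x a).comp measurable_fst) x i
      ((measurable_pi_apply _).comp measurable_snd)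
    exact ((G.measurable_minPolicy t _ _).comp measurable_fst).const_mul _
  · have hμ := G.isPolicy_maxPolicy t ω
    have hν := G.isPolicy_minPolicy t ω
    have hμ' := G.isPolicy_maxPlayed hμ (Sum.inl (G.maxTree.layer x))
    have hpw : ∀ π : Fin H → S × A × B, (G.playProb (G.maxPlayed (G.maxPolicy t ω)
          (Sum.inl (G.maxTree.layer x))) (G.minPolicy t ω) π).toReal
        = G.weightX (G.minPolicy t ω) π * ∏ j, G.maxTree.explore (G.maxPolicy t ω)
          (G.maxTree.layer x) (G.obsX (π j)).1 (G.obsX (π j)).2 := fun π =>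
      (G.toReal_playProb hμ' hν π).trans (G.weightX_mul_prod
        (fun _ => G.maxPlayed (G.maxPolicy t ω) (Sum.inl (G.maxTree.layer x))) (G.minPolicy t ω) π).symm
    have h := lintegral_exp_deviation_le (x := x) (G.isOpponentWeight_weightX hν)
      (G.playProb_ne_top _ _) (G.sum_playProb hμ' hν) hpw G.isLoss_max hμ hlam hlam1 i
    refine le_trans (le_of_eq ?_) h
    exact (G.measurePreserving_roundLaw hμ hν (Sum.inl (G.maxTree.layer x))).lintegral_comp
      (f := fun e => ENNReal.ofReal (Real.exp (episodeDeviation G.maxTree G.obsX (fun r => 1 - r)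
        G.stepReward lam (G.weightX (G.minPolicy t ω)) (G.maxPolicy t ω) x i e)))
      (Real.measurable_exp.comp (measurable_episodeDeviation (𝒯 := G.maxTree)
        (obs := G.obsX) (ρ := G.stepReward) G.isLoss_max.measurable lam
        (w := fun _ => G.weightX (G.minPolicy t ω)) (μ := fun _ => G.maxPolicy t ω)
        (fun _ => measurable_const) (fun _ _ => measurable_const) x i measurable_id)).ennreal_ofReal

/-- The statistics of the min-player in a round. -/
noncomputable def minDeviation (G : IIEFG H S X Y A B) (lam : ℝ) (y : Y) (i : Option (Option B))
    (μ : X → A → ℝ) (ν : Y → B → ℝ) (r : Round H S A B) : ℝ :=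
  episodeDeviation G.minTree G.obsY (fun r => r) G.stepReward lam (G.weightY μ) ν y i
    (r (Sum.inr (G.minTree.layer y)))

theorem selfPlayLaw_real_minDeviation (G : IIEFG H S X Y A B) {lam : ℝ} (hlam : 0 ≤ lam)
    (hlam1 : lam * Fintype.card B * H ≤ 1) (y : Y) (i : Option (Option B)) (T : ℕ) (c : ℝ) :
    (G.selfPlayLaw T).real {ω | c < ∑ t : Fin T,
      G.minDeviation lam y i (G.maxIterate ω t) (G.minIterate ω t) (ω t)} ≤ Real.exp (-c) := by
  refine G.selfPlayLaw_real_sum_ge_le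
    (f := fun t ω r => G.minDeviation lam y i (G.maxPolicy t ω) (G.minPolicy t ω) r)
    (fun t => ?_) (fun t ω => ?_) T c
  · refine measurable_episodeDeviation G.isLoss_min.measurable lam
      (fun π => Finset.measurable_prod _ fun h _ => ?_)
      (fun x a => (G.measurable_minPolicy t x a).comp measurable_fst) y i
      ((measurable_pi_apply _).comp measurable_snd)
    exact ((G.measurable_maxPolicy t _ _).comp measurable_fst).const_mul _
  · have hμ := G.isPolicy_maxPolicy t ω
    have hν := G.isPolicy_minPolicy t ω
    have hν' := G.isPolicy_minPlayed hν (Sum.inr (G.minTree.layer y))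
    have hpw : ∀ π : Fin H → S × A × B, (G.playProb (G.maxPolicy t ω)
          (G.minPlayed (G.minPolicy t ω) (Sum.inr (G.minTree.layer y))) π).toReal
        = G.weightY (G.maxPolicy t ω) π * ∏ j, G.minTree.explore (G.minPolicy t ω)
          (G.minTree.layer y) (G.obsY (π j)).1 (G.obsY (π j)).2 := fun π =>
      (G.toReal_playProb hμ hν' π).trans (G.weightY_mul_prod
        (G.maxPolicy t ω) (fun _ => G.minPlayed (G.minPolicy t ω) (Sum.inr (G.minTree.layer y))) π).symm
    have h := lintegral_exp_deviation_le (x := y) (G.isOpponentWeight_weightY hμ)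
      (G.playProb_ne_top _ _) (G.sum_playProb hμ hν') hpw G.isLoss_min hν hlam hlam1 i
    refine le_trans (le_of_eq ?_) h
    exact (G.measurePreserving_roundLaw hμ hν (Sum.inr (G.minTree.layer y))).lintegral_comp
      (f := fun e => ENNReal.ofReal (Real.exp (episodeDeviation G.minTree G.obsY (fun r => r)
        G.stepReward lam (G.weightY (G.maxPolicy t ω)) (G.minPolicy t ω) y i e)))
      (Real.measurable_exp.comp (measurable_episodeDeviation (𝒯 := G.minTree)
        (obs := G.obsY) (ρ := G.stepReward) G.isLoss_min.measurable lam
        (w := fun _ => G.weightY (G.maxPolicy t ω)) (μ := fun _ => G.minPolicy t ω)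
        (fun _ => measurable_const) (fun _ _ => measurable_const) y i measurable_id)).ennreal_ofReal

end IIEFG

/-! ### From the deviation bounds to the regret of one player. -/

section Regret

variable {H : ℕ} {N E : Type*} [Fintype N] [Fintype E] [Nonempty E]

/-- The bound separates a part proportional to `1 / m`, which does not involve the visit
probabilities, from a part in the visit probabilities that does not involve `m`. These are summable
over infosets by the balancing property and by the visit identity, respectively. -/
theorem sum_regret_le_of_deviation_le {T : ℕ} {μ L q ℓ : Fin T → E → ℝ} {lam κ m c : ℝ}
    (hlam : 0 < lam) (hκ : 0 < κ) (hm : 0 < m) (hH : 0 < H)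
    (hrm : ∀ t, μ t = rmDist (rmRegret t fun τ => ℓ (Fin.castLE t.isLt.le τ)))
    (hdev : ∀ i, ∑ t, deviation H lam m (μ t) (L t) (q t) (ℓ t) i ≤ c) (a : E) :
    ∑ t, ((∑ a', μ t a' * L t a') - L t a)
      ≤ (2 * c / lam + κ * Fintype.card E ^ 2 * H * c + Fintype.card E * H / (2 * κ)) / m
        + ∑ t, (lam * Fintype.card E * H ^ 2 * ∑ a', μ t a' * q t a'
          + κ * Fintype.card E * H * ∑ a', (1 / Fintype.card E + μ t a') * q t a')
        + lam * Fintype.card E * H ^ 2 * ∑ t, q t a := by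
  set k : ℝ := (Fintype.card E : ℝ) with hk
  have hk0 : 0 < k := by simp only [k]; exact_mod_cast Fintype.card_pos
  have hH0 : (0 : ℝ) < H := by exact_mod_cast hH
  have h1 := hdev (some (some a))
  have h2 := hdev (some none)
  have h3 := hdev none
  simp only [deviation, Finset.sum_sub_distrib, ← Finset.mul_sum] at h1 h2 h3
  simp only [← hk] at h1 h2 h3
  -- The parameter of regret matching is scaled by `m`: the compensator of the sum of squared
  -- regrets is of order `1 / m`, so its contribution becomes free of `m`, and the remaining term is
  -- of order `1 / m`.
  have h4 := rmRegret_le T ℓ a (κ := κ * m / (k * H)) (by positivity)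
  rw [rmRegret_eq_sum] at h4
  simp only [← hrm] at h4
  have hsplit : ∑ t, ((∑ a', μ t a' * L t a') - L t a)
      = ∑ t, ∑ a', μ t a' * (L t a' - ℓ t a') + ∑ t, ((∑ a', μ t a' * ℓ t a') - ℓ t a)
        + (∑ t, ℓ t a - ∑ t, L t a) := by
    rw [← Finset.sum_sub_distrib, ← Finset.sum_add_distrib, ← Finset.sum_add_distrib]
    refine Finset.sum_congr rfl fun t _ => ?_
    simp only [mul_sub, Finset.sum_sub_distrib]
    ring
  set V := ∑ t, ∑ a', μ t a' * q t a'
  set U := ∑ t, ∑ a', (1 / k + μ t a') * q t a'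
  set Q := ∑ t, ∑ a', ((∑ a'', μ t a'' * ℓ t a'') - ℓ t a') ^ 2
  set D1 := ∑ t, ∑ a', μ t a' * (L t a' - ℓ t a')
  set D2 := ∑ t, ℓ t a - ∑ t, L t a
  have e1 : D2 ≤ c / lam / m + lam * k * H ^ 2 * ∑ t, q t a := by
    have : D2 = (lam * m * D2) / (lam * m) := by field_simp
    rw [this, div_le_iff₀ (by positivity)]
    calc lam * m * D2 ≤ c + lam ^ 2 * m * k * H ^ 2 * ∑ t, q t a := by linarith
      _ = _ := by field_simp
  have e2 : D1 ≤ c / lam / m + lam * k * H ^ 2 * V := by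
    have : D1 = (lam * m * D1) / (lam * m) := by field_simp
    rw [this, div_le_iff₀ (by positivity)]
    calc lam * m * D1 ≤ c + lam ^ 2 * m * k * H ^ 2 * V := by linarith
      _ = _ := by field_simp
  have e3 : κ * m / (k * H) / 2 * Q ≤ κ * k ^ 2 * H * c / m + κ * k * H * U := by
    have : Q = (2 * k ^ 3 * H ^ 2 / m ^ 2) * (m ^ 2 / (2 * k ^ 3 * H ^ 2) * Q) := by field_simp
    rw [this, ← mul_assoc]
    calc _ ≤ κ * m / (k * H) / 2 * (2 * k ^ 3 * H ^ 2 / m ^ 2) * (c + m / k * U) :=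
          mul_le_mul_of_nonneg_left (by linarith) (by positivity)
      _ = _ := by field_simp
  have e4 : 1 / (2 * (κ * m / (k * H))) = k * H / (2 * κ) / m := by field_simp
  rw [e4] at h4
  rw [hsplit, Finset.sum_add_distrib, ← Finset.mul_sum, ← Finset.mul_sum]
  have e5 : (2 * c / lam + κ * k ^ 2 * H * c + k * H / (2 * κ)) / m
      = c / lam / m + c / lam / m + κ * k ^ 2 * H * c / m + k * H / (2 * κ) / m := by ring
  rw [e5]
  linarith

theorem isPolicy_uniform : IsPolicy fun (_ : N) (_ : E) => 1 / (Fintype.card E : ℝ) := fun _ =>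
  ⟨fun _ => by positivity, by simp⟩

/-- Regret of counterfactual regret minimization by regret matching with estimated losses. -/
theorem sum_expLoss_sub_le {Z : Type*} [Fintype Z] {𝒯 : LayeredTree H N E} {obs : Z → N × E}
    {T : ℕ} {w : Fin T → (Fin H → Z) → ℝ} (hw : ∀ t, IsOpponentWeight 𝒯 obs (w t)) (g : Z → ℝ)
    {μ ℓ : Fin T → N → E → ℝ} {lam κ c : ℝ} (hlam : 0 < lam) (hκ : 0 < κ) (hc : 0 ≤ c)
    (hH : 0 < H)
    (hrm : ∀ t x, μ t x = rmDist (rmRegret t fun τ => ℓ (Fin.castLE t.isLt.le τ) x))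
    (hdev : ∀ x i, ∑ t, deviation H lam (𝒯.reach (𝒯.balanced (𝒯.layer x)) x) (μ t x)
      (counterfactual 𝒯 obs (w t) (μ t) (lossToGo g) x)
      (counterfactual 𝒯 obs (w t) (μ t) (fun _ _ => 1) x) (ℓ t x) i ≤ c)
    {μ' : N → E → ℝ} (hμ' : IsPolicy μ') :
    ∑ t, (expLoss obs (w t) g (μ t) - expLoss obs (w t) g μ')
      ≤ Fintype.card N * (2 * c / lam + κ * Fintype.card E ^ 2 * H * c
          + Fintype.card E * H / (2 * κ))
        + 2 * lam * Fintype.card E * H ^ 3 * T + 2 * κ * Fintype.card E * H ^ 2 * T := by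
  have hμ : ∀ t, IsPolicy (μ t) := fun t x => hrm t x ▸ rmDist_mem_stdSimplex _
  set k : ℝ := (Fintype.card E : ℝ) with hk
  have hk0 : 0 < k := by simp only [k]; exact_mod_cast Fintype.card_pos
  set D := 2 * c / lam + κ * k ^ 2 * H * c + k * H / (2 * κ)
  have hD : 0 ≤ D := by positivity
  set m := fun x => 𝒯.reach (𝒯.balanced (𝒯.layer x)) x
  set r := fun x => 𝒯.reach μ' x
  have hr : ∀ x, 0 ≤ r x := 𝒯.reach_nonneg fun n e => (hμ' n).1 e
  set L := fun t x => counterfactual 𝒯 obs (w t) (μ t) (lossToGo g) x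
  set q := fun t x => counterfactual 𝒯 obs (w t) (μ t) (fun _ _ => 1) x
  have hq : ∀ t (φ : N → E → ℝ), IsPolicy φ → ∑ x, ∑ a, r x * φ x a * q t x a = H := fun t φ hφ =>
    (hw t).sum_reach_mul_visit hμ' hφ (hμ t)
  have hV : ∀ t, ∑ x, r x * ∑ a, μ t x a * q t x a = H := by
    intro t
    rw [← hq t (μ t) (hμ t)]
    simp only [Finset.mul_sum, mul_assoc]
  -- One `H` comes from the uniform policy and one from `μ t`.
  have hU : ∀ t, ∑ x, r x * ∑ a, (1 / k + μ t x a) * q t x a = 2 * H := by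
    intro t
    have h1 := hq t _ isPolicy_uniform
    have h2 := hq t (μ t) (hμ t)
    rw [two_mul]
    nth_rw 1 [← h1]
    rw [← h2, ← Finset.sum_add_distrib]
    refine Finset.sum_congr rfl fun x _ => ?_
    rw [← Finset.sum_add_distrib, Finset.mul_sum]
    refine Finset.sum_congr rfl fun a _ => ?_
    ring
  have hloc : ∀ x, ∑ a, r x * μ' x a * ∑ t, ((∑ a', μ t x a' * L t x a') - L t x a)
      ≤ r x / m x * D + ∑ t, (lam * k * H ^ 2 * (r x * ∑ a, μ t x a * q t x a)
          + κ * k * H * (r x * ∑ a, (1 / k + μ t x a) * q t x a)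
          + lam * k * H ^ 2 * ∑ a, r x * μ' x a * q t x a) := by
    intro x
    have h1 := fun a => sum_regret_le_of_deviation_le (μ := fun t => μ t x) (L := fun t => L t x)
      (q := fun t => q t x) (ℓ := fun t => ℓ t x) hlam hκ (𝒯.reach_balanced_pos rfl) hH
      (fun t => hrm t x) (hdev x) a
    refine (Finset.sum_le_sum fun a _ => mul_le_mul_of_nonneg_left (h1 a)
      (mul_nonneg (hr x) ((hμ' x).1 a))).trans (le_of_eq ?_)
    have h2 : ∀ (P : ℝ) (Q : E → ℝ), ∑ a, r x * μ' x a * (P + Q a)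
        = r x * P + ∑ a, r x * μ' x a * Q a := by
      intro P Q
      simp only [mul_add, Finset.sum_add_distrib]
      rw [← Finset.sum_mul, ← Finset.mul_sum, (hμ' x).2, mul_one]
    have h3 : ∑ a, r x * μ' x a * (lam * k * H ^ 2 * ∑ t, q t x a)
        = ∑ t, lam * k * H ^ 2 * ∑ a, r x * μ' x a * q t x a := by
      simp only [Finset.mul_sum]
      rw [Finset.sum_comm]
      exact Finset.sum_congr rfl fun t _ => Finset.sum_congr rfl fun a _ => by ring
    rw [h2, h3, mul_add, Finset.mul_sum, add_assoc, ← Finset.sum_add_distrib]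
    congr 1
    · simp only [m, D, hk]
      ring
    · exact Finset.sum_congr rfl fun t _ => by simp only [hk]; ring
  calc ∑ t, (expLoss obs (w t) g (μ t) - expLoss obs (w t) g μ')
      = ∑ x, ∑ a, r x * μ' x a * ∑ t, ((∑ a', μ t x a' * L t x a') - L t x a) := by
        rw [Finset.sum_congr rfl fun t _ => (hw t).expLoss_sub_expLoss g (hμ t) hμ',
          Finset.sum_comm]
        refine Finset.sum_congr rfl fun x _ => ?_
        simp only [Finset.mul_sum]
        rw [Finset.sum_comm (s := (Finset.univ : Finset E))]
        refine Finset.sum_congr rfl fun t _ => ?_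
        simp only [mul_sub, sub_mul, Finset.sum_sub_distrib]
        congr 1
        rw [← Finset.sum_mul, ← Finset.mul_sum, (hμ' x).2, mul_one, Finset.mul_sum]
        refine Finset.sum_congr rfl fun a _ => ?_
        ring
    _ ≤ ∑ x, (r x / m x * D + ∑ t, (lam * k * H ^ 2 * (r x * ∑ a, μ t x a * q t x a)
          + κ * k * H * (r x * ∑ a, (1 / k + μ t x a) * q t x a)
          + lam * k * H ^ 2 * ∑ a, r x * μ' x a * q t x a)) :=
        Finset.sum_le_sum fun x _ => hloc x
    _ = (∑ x, r x / m x) * D + ∑ t : Fin T, (lam * k * H ^ 2 * H + κ * k * H * (2 * H)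
          + lam * k * H ^ 2 * H) := by
        rw [Finset.sum_add_distrib, ← Finset.sum_mul, Finset.sum_comm]
        congr 1
        refine Finset.sum_congr rfl fun t _ => ?_
        rw [Finset.sum_add_distrib, Finset.sum_add_distrib, ← Finset.mul_sum, ← Finset.mul_sum,
          ← Finset.mul_sum, hV, hU, hq t μ' hμ']
    _ ≤ _ := by
        rw [Finset.sum_const, Finset.card_univ, Fintype.card_fin, nsmul_eq_mul]
        have h1 := mul_le_mul_of_nonneg_right (𝒯.sum_reach_div_balanced_le hμ') hD
        have h2 : (T : ℝ) * (lam * k * H ^ 2 * H + κ * k * H * (2 * H) + lam * k * H ^ 2 * H)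
          = 2 * lam * k * H ^ 3 * T + 2 * κ * k * H ^ 2 * T := by ring
        linarith

/-- The regret bound for a number of rounds that is large enough for an accuracy of `ε`. -/
theorem regret_bound_le {h k n ε ι T : ℝ} (hh : 1 ≤ h) (hk : 1 ≤ k) (hn : 0 ≤ n) (hε : 0 < ε)
    (hεh : ε ≤ h) (hι : 1 ≤ ι) (hT : 1000 * (h ^ 3 * (n * k ^ 2) * ι / ε ^ 2) ≤ T) :
    n * (2 * ι / (ε / (16 * k * h ^ 3)) + ε / (16 * k * h ^ 2) * k ^ 2 * h * ι
        + k * h / (2 * (ε / (16 * k * h ^ 2))))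
      + 2 * (ε / (16 * k * h ^ 3)) * k * h ^ 3 * T + 2 * (ε / (16 * k * h ^ 2)) * k * h ^ 2 * T
      ≤ ε * T / 2 := by
  have hh0 : 0 < h := by linarith
  have hk0 : 0 < k := by linarith
  have hι0 : 0 < ι := by linarith
  set P := h ^ 3 * n * k ^ 2 * ι / ε
  have hP0 : 0 ≤ P := by positivity
  have hP : 1000 * P ≤ ε * T := by
    calc 1000 * P = ε * (1000 * (h ^ 3 * (n * k ^ 2) * ι / ε ^ 2)) := by
          simp only [P]; field_simp
      _ ≤ ε * T := mul_le_mul_of_nonneg_left hT hε.le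
  -- The three terms that carry the number of infosets use `1 ≤ k`, `ε ≤ h` and `1 ≤ ι` in turn, and
  -- add up to `41 * P`, while `1000 * P ≤ ε * T`. The two terms linear in `T` give `ε * T / 4`.
  have e1 : n * (2 * ι / (ε / (16 * k * h ^ 3))) ≤ 32 * P := by
    calc _ = 32 * (h ^ 3 * n * k * ι / ε) * 1 := by field_simp; ring
      _ ≤ 32 * (h ^ 3 * n * k * ι / ε) * k := mul_le_mul_of_nonneg_left hk (by positivity)
      _ = 32 * P := by simp only [P]; ring
  have e2 : n * (ε / (16 * k * h ^ 2) * k ^ 2 * h * ι) ≤ P := by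
    have h1 : ε * ε ≤ h * h := mul_le_mul hεh hεh hε.le hh0.le
    have h2 : h * h ≤ 16 * h ^ 4 * k := by
      have : 1 ≤ h ^ 2 * k := by nlinarith [one_le_pow₀ (n := 2) hh]
      nlinarith [mul_pos hh0 hh0]
    calc _ = n * k * ι / (16 * h * ε) * (ε * ε) := by field_simp
      _ ≤ n * k * ι / (16 * h * ε) * (16 * h ^ 4 * k) :=
          mul_le_mul_of_nonneg_left (h1.trans h2) (by positivity)
      _ = P := by simp only [P]; field_simp
  have e3 : n * (k * h / (2 * (ε / (16 * k * h ^ 2)))) ≤ 8 * P := by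
    calc _ = 8 * (h ^ 3 * n * k ^ 2 / ε) * 1 := by field_simp; ring
      _ ≤ 8 * (h ^ 3 * n * k ^ 2 / ε) * ι := mul_le_mul_of_nonneg_left hι (by positivity)
      _ = 8 * P := by simp only [P]; ring
  have e4 : 2 * (ε / (16 * k * h ^ 3)) * k * h ^ 3 * T = ε * T / 8 := by field_simp; ring
  have e5 : 2 * (ε / (16 * k * h ^ 2)) * k * h ^ 2 * T = ε * T / 8 := by field_simp; ring
  rw [e4, e5, mul_add, mul_add]
  linarith

end Regret

/-! ### Linearity of the loss, and the duality gap of the averages. -/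

section ExpLoss

variable {H : ℕ} {Z N E : Type*} [Fintype Z] [Fintype E] {𝒯 : LayeredTree H N E}
  {obs : Z → N × E} {w : (Fin H → Z) → ℝ}

theorem IsOpponentWeight.expLoss_avgPolicy (hw : IsOpponentWeight 𝒯 obs w) (g : Z → ℝ) {T : ℕ}
    (hT : 0 < T) {μ : Fin T → N → E → ℝ} (hμ : ∀ n, 0 < ∑ t, 𝒯.reach (μ t) n) :
    expLoss obs w g (𝒯.avgPolicy μ) = (∑ t, expLoss obs w g (μ t)) / T := by
  simp only [expLoss]
  rw [Finset.sum_comm, Finset.sum_div]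
  refine Finset.sum_congr rfl fun π _ => ?_
  by_cases hπ : w π = 0
  · simp [hπ]
  rw [(hw.isPath π hπ).prod_avgPolicy hT hμ, ← Finset.sum_mul, ← Finset.mul_sum]
  ring

theorem IsOpponentWeight.expLoss_mem_Icc (hw : IsOpponentWeight 𝒯 obs w) {g : Z → ℝ}
    (hg : ∀ z, g z ∈ Set.Icc (0 : ℝ) 1) {μ : N → E → ℝ} (hμ : IsPolicy μ) :
    expLoss obs w g μ ∈ Set.Icc (0 : ℝ) H := by
  have hp : ∀ π, 0 ≤ w π * ∏ h, μ (obs (π h)).1 (obs (π h)).2 := fun π =>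
    mul_nonneg (hw.nonneg π) (Finset.prod_nonneg fun h _ => (hμ _).1 _)
  refine ⟨Finset.sum_nonneg fun π _ => mul_nonneg (hp π)
    (Finset.sum_nonneg fun h _ => (hg _).1), ?_⟩
  calc expLoss obs w g μ ≤ ∑ π, w π * (∏ h, μ (obs (π h)).1 (obs (π h)).2) * H := by
        refine Finset.sum_le_sum fun π _ => mul_le_mul_of_nonneg_left ?_ (hp π)
        exact (Finset.sum_le_sum fun h _ => (hg (π h)).2).trans (by simp)
    _ = H := by rw [← Finset.sum_mul, hw.total (fun _ => μ) fun _ => hμ, one_mul]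

end ExpLoss

namespace IIEFG

variable {H : ℕ} {S X Y A B : Type*} [Fintype S] [Fintype X] [Fintype Y] [Fintype A] [Fintype B]
  [Nonempty A] [Nonempty B]

theorem value_eq_expLoss_min (G : IIEFG H S X Y A B) {μ : X → A → ℝ} {ν : Y → B → ℝ}
    (hμ : IsPolicy μ) (hν : IsPolicy ν) :
    G.value μ ν = expLoss G.obsY (G.weightY μ) (fun z => ∫ r, r ∂(G.stepReward z)) ν := by
  have h := integral_playLaw (ρ := G.stepReward) (G.playProb_ne_top μ ν) (fun _ => 1)
    (G.isLoss_min.measurable_sum Finset.univ) fun π => G.isLoss_min.integrable_sum _ π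
  simp only [one_mul] at h
  rw [value, episodeLaw_eq_playLaw, h]
  refine Finset.sum_congr rfl fun π _ => ?_
  rw [G.isLoss_min.integral_sum]
  refine congrArg (· * _) ?_
  exact (G.toReal_playProb hμ hν π).trans (G.weightY_mul_prod μ (fun _ => ν) π).symm

theorem value_eq_sub_expLoss_max (G : IIEFG H S X Y A B) {μ : X → A → ℝ} {ν : Y → B → ℝ}
    (hμ : IsPolicy μ) (hν : IsPolicy ν) :
    G.value μ ν = H - expLoss G.obsX (G.weightX ν) (fun z => ∫ r, 1 - r ∂(G.stepReward z)) μ := by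
  have h1 : ∀ z, ∫ r, 1 - r ∂(G.stepReward z) = 1 - ∫ r, r ∂(G.stepReward z) := by
    intro z
    rw [integral_sub (integrable_const 1) (G.isLoss_min.integrable z)]
    simp
  have h2 := (G.isOpponentWeight_weightX hν).total (fun _ => μ) fun _ => hμ
  rw [G.value_eq_expLoss_min hμ hν]
  simp only [expLoss, h1, Finset.sum_sub_distrib, mul_sub]
  rw [← Finset.sum_mul, h2]
  simp only [Finset.sum_const, Finset.card_univ, Fintype.card_fin, nsmul_eq_mul, mul_one, one_mul,
    sub_sub_cancel]
  refine Finset.sum_congr rfl fun π _ => ?_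
  rw [G.weightX_mul_prod (fun _ => μ) ν π, G.weightY_mul_prod μ (fun _ => ν) π]

theorem isPolicy_maxIterate (G : IIEFG H S X Y A B) {T : ℕ} (ω : Fin T → Round H S A B)
    (t : Fin T) : IsPolicy (G.maxIterate ω t) := G.isPolicy_maxPolicy _ _

theorem isPolicy_minIterate (G : IIEFG H S X Y A B) {T : ℕ} (ω : Fin T → Round H S A B)
    (t : Fin T) : IsPolicy (G.minIterate ω t) := G.isPolicy_minPolicy _ _

/-- The first iterate is uniform, so every infoset has positive total reach and the averaged
policies never divide by zero. -/
theorem rmDist_zero_pos {A : Type*} [Fintype A] [Nonempty A] (a : A) :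
    0 < rmDist (0 : A → ℝ) a := by
  simp only [rmDist, Pi.zero_apply, max_self, Finset.sum_const_zero, if_true]
  have : (0 : ℝ) < Fintype.card A := by exact_mod_cast Fintype.card_pos
  positivity

theorem sum_reach_maxIterate_pos (G : IIEFG H S X Y A B) {T : ℕ} (hT : 0 < T)
    (ω : Fin T → Round H S A B) (x : X) : 0 < ∑ t, G.maxTree.reach (G.maxIterate ω t) x := by
  refine Finset.sum_pos' (fun t _ => G.maxTree.reach_nonneg
    (fun x a => (G.isPolicy_maxIterate ω t x).1 a) x) ⟨⟨0, hT⟩, Finset.mem_univ _, ?_⟩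
  exact G.maxTree.reach_pos (fun x a => rmDist_zero_pos a) x

theorem sum_reach_minIterate_pos (G : IIEFG H S X Y A B) {T : ℕ} (hT : 0 < T)
    (ω : Fin T → Round H S A B) (y : Y) : 0 < ∑ t, G.minTree.reach (G.minIterate ω t) y := by
  refine Finset.sum_pos' (fun t _ => G.minTree.reach_nonneg
    (fun y b => (G.isPolicy_minIterate ω t y).1 b) y) ⟨⟨0, hT⟩, Finset.mem_univ _, ?_⟩
  exact G.minTree.reach_pos (fun y b => rmDist_zero_pos b) y

theorem NEGap_le (G : IIEFG H S X Y A B) {μ : X → A → ℝ} {ν : Y → B → ℝ} {ε : ℝ}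
    (h : ∀ μ' ν', IsPolicy μ' → IsPolicy ν' → G.value μ' ν - G.value μ ν' ≤ ε) :
    G.NEGap μ ν ≤ ε := by
  have : Nonempty {μ' : X → A → ℝ // IsPolicy μ'} := ⟨⟨_, isPolicy_uniform⟩⟩
  have : Nonempty {ν' : Y → B → ℝ // IsPolicy ν'} := ⟨⟨_, isPolicy_uniform⟩⟩
  unfold NEGap
  rw [sub_le_iff_le_add]
  refine ciSup_le fun μ' => ?_
  rw [← sub_le_iff_le_add']
  refine le_ciInf fun ν' => ?_
  have := h μ' ν' μ'.2 ν'.2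
  linarith

/-- By linearity the left side is the sum of `V(μ', ν^t) - V(μ^t, ν')`. Inserting `V(μ^t, ν^t)`
splits it into the two regrets; the losses `1 - r` of the max-player only change the sign and add
the constant `H`. -/
theorem card_mul_value_sub_value_eq (G : IIEFG H S X Y A B) {T : ℕ} (hT : 0 < T)
    (ω : Fin T → Round H S A B) {μ' : X → A → ℝ} {ν' : Y → B → ℝ} (hμ' : IsPolicy μ')
    (hν' : IsPolicy ν') :
    T * (G.value μ' (G.minTree.avgPolicy (G.minIterate ω))
        - G.value (G.maxTree.avgPolicy (G.maxIterate ω)) ν')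
      = ∑ t, (expLoss G.obsX (G.weightX (G.minIterate ω t))
            (fun z => ∫ r, 1 - r ∂(G.stepReward z)) (G.maxIterate ω t)
          - expLoss G.obsX (G.weightX (G.minIterate ω t))
            (fun z => ∫ r, 1 - r ∂(G.stepReward z)) μ')
        + ∑ t, (expLoss G.obsY (G.weightY (G.maxIterate ω t))
            (fun z => ∫ r, r ∂(G.stepReward z)) (G.minIterate ω t)
          - expLoss G.obsY (G.weightY (G.maxIterate ω t))
            (fun z => ∫ r, r ∂(G.stepReward z)) ν') := by
  have hT' : (T : ℝ) ≠ 0 := by positivity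
  have hX := G.sum_reach_maxIterate_pos hT ω
  have hY := G.sum_reach_minIterate_pos hT ω
  have hpX := G.isPolicy_maxIterate ω
  have hpY := G.isPolicy_minIterate ω
  have h1 : G.value μ' (G.minTree.avgPolicy (G.minIterate ω))
      = (∑ t, G.value μ' (G.minIterate ω t)) / T := by
    rw [G.value_eq_expLoss_min hμ' (G.minTree.isPolicy_avgPolicy hpY hY),
      (G.isOpponentWeight_weightY hμ').expLoss_avgPolicy _ hT hY]
    simp only [G.value_eq_expLoss_min hμ' (hpY _)]
  have h2 : G.value (G.maxTree.avgPolicy (G.maxIterate ω)) ν'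
      = (∑ t, G.value (G.maxIterate ω t) ν') / T := by
    rw [G.value_eq_sub_expLoss_max (G.maxTree.isPolicy_avgPolicy hpX hX) hν',
      (G.isOpponentWeight_weightX hν').expLoss_avgPolicy _ hT hX]
    simp only [G.value_eq_sub_expLoss_max (hpX _) hν', Finset.sum_sub_distrib, Finset.sum_const,
      Finset.card_univ, Fintype.card_fin, nsmul_eq_mul]
    field_simp
  rw [h1, h2, ← sub_div, mul_div_cancel₀ _ hT', ← Finset.sum_sub_distrib,
    ← Finset.sum_add_distrib]
  refine Finset.sum_congr rfl fun t _ => ?_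
  have h3 := G.value_eq_sub_expLoss_max hμ' (hpY t)
  have h4 := G.value_eq_sub_expLoss_max (hpX t) (hpY t)
  have h5 := G.value_eq_expLoss_min (hpX t) (hpY t)
  have h6 := G.value_eq_expLoss_min (hpX t) hν'
  linarith

theorem isApproxNE_of_le (G : IIEFG H S X Y A B) {ε : ℝ} (hε : (H : ℝ) ≤ ε) {μ : X → A → ℝ}
    {ν : Y → B → ℝ} (hμ : IsPolicy μ) (hν : IsPolicy ν) : G.IsApproxNE ε μ ν := by
  refine ⟨hμ, hν, G.NEGap_le fun μ' ν' hμ' hν' => ?_⟩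
  have hr : ∀ z, ∫ r, r ∂(G.stepReward z) ∈ Set.Icc (0 : ℝ) 1 := fun z =>
    G.isLoss_min.integral_mem_Icc z
  rw [G.value_eq_expLoss_min hμ' hν, G.value_eq_expLoss_min hμ hν']
  have h1 := ((G.isOpponentWeight_weightY hμ').expLoss_mem_Icc hr hν).2
  have h2 := ((G.isOpponentWeight_weightY hμ).expLoss_mem_Icc hr hν').1
  linarith

theorem isApproxNE_of_deviation_le (G : IIEFG H S X Y A B) (hH : 0 < H) {ε ι : ℝ} (hε : 0 < ε)
    (hεH : ε ≤ H) (hι : 1 ≤ ι) {T : ℕ} (hT0 : 0 < T)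
    (hT : 1000 * ((H : ℝ) ^ 3 * (Fintype.card X * (Fintype.card A : ℝ) ^ 2
      + Fintype.card Y * (Fintype.card B : ℝ) ^ 2) * ι / ε ^ 2) ≤ T) {ω : Fin T → Round H S A B}
    (hX : ∀ x i, ∑ t : Fin T, G.maxDeviation (ε / (16 * Fintype.card A * (H : ℝ) ^ 3)) x i
      (G.maxIterate ω t) (G.minIterate ω t) (ω t) ≤ ι)
    (hY : ∀ y i, ∑ t : Fin T, G.minDeviation (ε / (16 * Fintype.card B * (H : ℝ) ^ 3)) y i
      (G.maxIterate ω t) (G.minIterate ω t) (ω t) ≤ ι) :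
    G.IsApproxNE ε (G.maxTree.avgPolicy (G.maxIterate ω))
      (G.minTree.avgPolicy (G.minIterate ω)) := by
  have hpX := G.isPolicy_maxIterate ω
  have hpY := G.isPolicy_minIterate ω
  refine ⟨G.maxTree.isPolicy_avgPolicy hpX (G.sum_reach_maxIterate_pos hT0 ω),
    G.minTree.isPolicy_avgPolicy hpY (G.sum_reach_minIterate_pos hT0 ω),
    G.NEGap_le fun μ' ν' hμ' hν' => ?_⟩
  have hH1 : (1 : ℝ) ≤ H := by exact_mod_cast hH
  have hA1 : (1 : ℝ) ≤ Fintype.card A := by exact_mod_cast Fintype.card_pos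
  have hB1 : (1 : ℝ) ≤ Fintype.card B := by exact_mod_cast Fintype.card_pos
  have hTX : 1000 * ((H : ℝ) ^ 3 * (Fintype.card X * (Fintype.card A : ℝ) ^ 2) * ι / ε ^ 2)
      ≤ T := by
    refine le_trans ?_ hT
    gcongr
    exact le_add_of_nonneg_right (by positivity)
  have hTY : 1000 * ((H : ℝ) ^ 3 * (Fintype.card Y * (Fintype.card B : ℝ) ^ 2) * ι / ε ^ 2)
      ≤ T := by
    refine le_trans ?_ hT
    gcongr
    exact le_add_of_nonneg_left (by positivity)
  have h1 := sum_expLoss_sub_le (fun t => G.isOpponentWeight_weightX (hpY t))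
    (fun z => ∫ r, 1 - r ∂(G.stepReward z)) (μ := G.maxIterate ω)
    (ℓ := fun t => G.maxLossEst (ω t)) (lam := ε / (16 * Fintype.card A * (H : ℝ) ^ 3))
    (κ := ε / (16 * Fintype.card A * (H : ℝ) ^ 2)) (c := ι) (by positivity) (by positivity)
    (by linarith) hH (fun t x => rfl) hX hμ'
  have h2 := sum_expLoss_sub_le (fun t => G.isOpponentWeight_weightY (hpX t))
    (fun z => ∫ r, r ∂(G.stepReward z)) (μ := G.minIterate ω)
    (ℓ := fun t => G.minLossEst (ω t)) (lam := ε / (16 * Fintype.card B * (H : ℝ) ^ 3))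
    (κ := ε / (16 * Fintype.card B * (H : ℝ) ^ 2)) (c := ι) (by positivity) (by positivity)
    (by linarith) hH (fun t y => rfl) hY hν'
  have h3 := h1.trans (regret_bound_le hH1 hA1 (Nat.cast_nonneg _) hε hεH hι hTX)
  have h4 := h2.trans (regret_bound_le hH1 hB1 (Nat.cast_nonneg _) hε hεH hι hTY)
  have h5 := G.card_mul_value_sub_value_eq hT0 ω hμ' hν'
  have hT' : (0 : ℝ) < T := by exact_mod_cast hT0
  refine le_of_mul_le_mul_left ?_ hT'
  rw [h5]
  linarith

theorem layers_pos (G : IIEFG H S X Y A B) : 0 < H :=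
  (G.stateTree.layer G.nonempty_state.some).pos

/-- A union bound over `A + 2` statistics at each infoset of the max-player and `B + 2` at each one
of the min-player. The comparators enter only afterwards, deterministically. -/
theorem one_sub_le_selfPlayLaw_isApproxNE (G : IIEFG H S X Y A B) {δ ε : ℝ} (hδ : 0 < δ)
    (hε : 0 < ε) (hεH : ε ≤ H) {ι : ℝ} (hι1 : 1 ≤ ι)
    (hι : ι = Real.log (10 * ((Fintype.card X : ℝ) * (Fintype.card A : ℝ)
      + (Fintype.card Y : ℝ) * (Fintype.card B : ℝ)) / δ)) {T : ℕ} (hT0 : 0 < T)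
    (hT : 1000 * ((H : ℝ) ^ 3 * (Fintype.card X * (Fintype.card A : ℝ) ^ 2
      + Fintype.card Y * (Fintype.card B : ℝ) ^ 2) * ι / ε ^ 2) ≤ T) :
    1 - δ ≤ (G.selfPlayLaw T).real {ω | G.IsApproxNE ε (G.maxTree.avgPolicy (G.maxIterate ω))
      (G.minTree.avgPolicy (G.minIterate ω))} := by
  have hH := G.layers_pos
  have hH1 : (1 : ℝ) ≤ H := by exact_mod_cast hH
  have hA1 : (1 : ℝ) ≤ Fintype.card A := by exact_mod_cast Fintype.card_pos
  have hB1 : (1 : ℝ) ≤ Fintype.card B := by exact_mod_cast Fintype.card_pos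
  have hX1 : (1 : ℝ) ≤ Fintype.card X := by
    have : Nonempty X := ⟨G.infoX G.nonempty_state.some⟩
    exact_mod_cast Fintype.card_pos
  have hlam : ∀ k : ℝ, 1 ≤ k → 0 ≤ ε / (16 * k * (H : ℝ) ^ 3)
      ∧ ε / (16 * k * (H : ℝ) ^ 3) * k * H ≤ 1 := by
    intro k hk
    have hk0 : 0 < k := by linarith
    refine ⟨by positivity, ?_⟩
    calc ε / (16 * k * (H : ℝ) ^ 3) * k * H = ε / (16 * (H : ℝ) ^ 2) := by field_simp
      _ ≤ 1 := by
        rw [div_le_one (by positivity)]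
        nlinarith
  set bX := fun (x : X) (i : Option (Option A)) => {ω : Fin T → Round H S A B |
    ι < ∑ t : Fin T, G.maxDeviation (ε / (16 * Fintype.card A * (H : ℝ) ^ 3)) x i
      (G.maxIterate ω t) (G.minIterate ω t) (ω t)}
  set bY := fun (y : Y) (i : Option (Option B)) => {ω : Fin T → Round H S A B |
    ι < ∑ t : Fin T, G.minDeviation (ε / (16 * Fintype.card B * (H : ℝ) ^ 3)) y i
      (G.maxIterate ω t) (G.minIterate ω t) (ω t)}
  set good := {ω | G.IsApproxNE ε (G.maxTree.avgPolicy (G.maxIterate ω))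
      (G.minTree.avgPolicy (G.minIterate ω))}
  -- Covering the whole space and using subadditivity gives the lower bound on the probability of
  -- `good` without its measurability.
  have hcover : Set.univ ⊆ good ∪ ((⋃ p : X × Option (Option A), bX p.1 p.2)
      ∪ ⋃ p : Y × Option (Option B), bY p.1 p.2) := by
    intro ω _
    by_contra hω
    simp only [Set.mem_union, Set.mem_iUnion, not_or, not_exists, Prod.forall] at hω
    obtain ⟨h0, hx, hy⟩ := hω
    exact h0 (G.isApproxNE_of_deviation_le hH hε hεH hι1 hT0 hT
      (fun x i => not_lt.1 (hx x i)) fun y i => not_lt.1 (hy y i))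
  have hbX : (G.selfPlayLaw T).real (⋃ p : X × Option (Option A), bX p.1 p.2)
      ≤ Fintype.card X * (Fintype.card A + 2) * Real.exp (-ι) := by
    refine (measureReal_iUnion_fintype_le _).trans ((Finset.sum_le_sum fun p _ =>
      G.selfPlayLaw_real_maxDeviation (hlam _ hA1).1 (hlam _ hA1).2 p.1 p.2 T ι).trans
      (le_of_eq ?_))
    simp only [Finset.sum_const, Finset.card_univ, Fintype.card_prod, Fintype.card_option,
      nsmul_eq_mul]
    push_cast
    ring
  have hbY : (G.selfPlayLaw T).real (⋃ p : Y × Option (Option B), bY p.1 p.2)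
      ≤ Fintype.card Y * (Fintype.card B + 2) * Real.exp (-ι) := by
    refine (measureReal_iUnion_fintype_le _).trans ((Finset.sum_le_sum fun p _ =>
      G.selfPlayLaw_real_minDeviation (hlam _ hB1).1 (hlam _ hB1).2 p.1 p.2 T ι).trans
      (le_of_eq ?_))
    simp only [Finset.sum_const, Finset.card_univ, Fintype.card_prod, Fintype.card_option,
      nsmul_eq_mul]
    push_cast
    ring
  set M : ℝ := (Fintype.card X : ℝ) * Fintype.card A + (Fintype.card Y : ℝ) * Fintype.card B
  have hM : 0 < M := by positivity
  have hexp : Real.exp (-ι) = δ / (10 * M) := by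
    rw [hι, Real.exp_neg, Real.exp_log (by positivity), inv_div]
  -- Since `A + 2 ≤ 3 * A` and likewise for `B`, the constant `3` would do; the `10` in `ι` also
  -- yields `1 ≤ ι`.
  have hle : (Fintype.card X * (Fintype.card A + 2) : ℝ)
      + Fintype.card Y * (Fintype.card B + 2) ≤ 10 * M := by
    have h1 := mul_le_mul_of_nonneg_left hA1 (Nat.cast_nonneg (α := ℝ) (Fintype.card X))
    have h2 := mul_le_mul_of_nonneg_left hB1 (Nat.cast_nonneg (α := ℝ) (Fintype.card Y))
    simp only [M]
    have h3 : (0 : ℝ) ≤ (Fintype.card X : ℝ) * Fintype.card A := by positivity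
    have h4 : (0 : ℝ) ≤ (Fintype.card Y : ℝ) * Fintype.card B := by positivity
    linarith
  have h1 := measureReal_mono (μ := G.selfPlayLaw T) hcover
  have h2 := measureReal_union_le (μ := G.selfPlayLaw T) good
    ((⋃ p : X × Option (Option A), bX p.1 p.2) ∪ ⋃ p : Y × Option (Option B), bY p.1 p.2)
  have h3 := measureReal_union_le (μ := G.selfPlayLaw T)
    (⋃ p : X × Option (Option A), bX p.1 p.2) (⋃ p : Y × Option (Option B), bY p.1 p.2)
  rw [probReal_univ] at h1
  have h4 : (Fintype.card X * (Fintype.card A + 2) : ℝ) * Real.exp (-ι)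
      + Fintype.card Y * (Fintype.card B + 2) * Real.exp (-ι) ≤ δ := by
    rw [← add_mul, hexp]
    calc _ ≤ 10 * M * (δ / (10 * M)) := mul_le_mul_of_nonneg_right hle (by positivity)
      _ = δ := by field_simp
  linarith

end IIEFG

/-! ### The sample complexity bound. -/

theorem corollary8 :
    ∃ C C' : ℝ, 0 < C ∧ 0 < C' ∧
      ∀ (H : ℕ) (S X Y A B : Type*) [Fintype S] [Fintype X] [Fintype Y] [Fintype A] [Fintype B]
        [Nonempty A] [Nonempty B] (G : IIEFG H S X Y A B) (δ ε : ℝ),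
        0 < δ → δ < 1 → 0 < ε →
        ∀ K ι : ℝ,
          K = (Fintype.card X : ℝ) * (Fintype.card A : ℝ) ^ 2
            + (Fintype.card Y : ℝ) * (Fintype.card B : ℝ) ^ 2 →
          ι = Real.log (10 * ((Fintype.card X : ℝ) * (Fintype.card A : ℝ)
            + (Fintype.card Y : ℝ) * (Fintype.card B : ℝ)) / δ) →
          (∀ T : ℕ, C * ((H : ℝ) ^ 3 * K * ι / ε ^ 2) ≤ (T : ℝ) →
            1 - δ ≤ (G.selfPlayLaw T).real
              {ω | G.IsApproxNE ε (G.maxTree.avgPolicy (G.maxIterate ω))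
                (G.minTree.avgPolicy (G.minIterate ω))}) ∧
          (∀ T : ℕ, numEpisodes H T = 2 * H * T) ∧
          (ε ≤ (H : ℝ) →
            (numEpisodes H ⌈C * ((H : ℝ) ^ 3 * K * ι / ε ^ 2)⌉₊ : ℝ)
              ≤ C' * ((H : ℝ) ^ 4 * K * ι / ε ^ 2)) := by
  -- The second constant is `2 * 2 * 1000`: there are `2 * H` episodes per round, and rounding up at
  -- most doubles a number that is at least one.
  refine ⟨1000, 4000, by norm_num, by norm_num, ?_⟩
  intro H S X Y A B _ _ _ _ _ _ _ G δ ε hδ hδ1 hε K ι hK hι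
  have hnum : ∀ T : ℕ, numEpisodes H T = 2 * H * T := by
    intro T
    simp only [numEpisodes, Fintype.card_prod, Fintype.card_sum, Fintype.card_fin]
    ring
  have hH1 : (1 : ℝ) ≤ H := by exact_mod_cast G.layers_pos
  have hA1 : (1 : ℝ) ≤ Fintype.card A := by exact_mod_cast Fintype.card_pos
  have hB1 : (1 : ℝ) ≤ Fintype.card B := by exact_mod_cast Fintype.card_pos
  have hX1 : (1 : ℝ) ≤ Fintype.card X := by
    have : Nonempty X := ⟨G.infoX G.nonempty_state.some⟩
    exact_mod_cast Fintype.card_pos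
  have hK1 : 1 ≤ K := by
    rw [hK]
    have h1 := one_le_mul_of_one_le_of_one_le hX1 (one_le_pow₀ (n := 2) hA1)
    have h2 : (0 : ℝ) ≤ (Fintype.card Y : ℝ) * (Fintype.card B : ℝ) ^ 2 := by positivity
    linarith
  have hι1 : 1 ≤ ι := by
    have h1 := one_le_mul_of_one_le_of_one_le hX1 hA1
    have h2 : (0 : ℝ) ≤ (Fintype.card Y : ℝ) * (Fintype.card B : ℝ) := by positivity
    have h3 : (10 : ℝ) ≤ 10 * ((Fintype.card X : ℝ) * (Fintype.card A : ℝ)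
        + (Fintype.card Y : ℝ) * (Fintype.card B : ℝ)) / δ := by
      rw [le_div_iff₀ hδ]
      linarith
    rw [hι, Real.le_log_iff_exp_le (by linarith)]
    linarith [Real.exp_one_lt_d9]
  have hpos : 0 < (H : ℝ) ^ 3 * K * ι / ε ^ 2 := by positivity
  refine ⟨fun T hT => ?_, hnum, fun hεH => ?_⟩
  · have hT0 : 0 < T := by
      have : (0 : ℝ) < T := by linarith
      exact_mod_cast this
    -- For `H ≤ ε` every pair of policies qualifies, since values lie in `[0, H]`; the tuning of the
    -- other case needs `ε ≤ H`.
    rcases le_total ε H with hεH | hεH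
    · rw [hK] at hT
      exact G.one_sub_le_selfPlayLaw_isApproxNE hδ hε hεH hι1 hι hT0 hT
    · have huniv : {ω : Fin T → Round H S A B | G.IsApproxNE ε
          (G.maxTree.avgPolicy (G.maxIterate ω)) (G.minTree.avgPolicy (G.minIterate ω))}
          = Set.univ := Set.eq_univ_of_forall fun ω => G.isApproxNE_of_le hεH
        (G.maxTree.isPolicy_avgPolicy (G.isPolicy_maxIterate ω) (G.sum_reach_maxIterate_pos hT0 ω))
        (G.minTree.isPolicy_avgPolicy (G.isPolicy_minIterate ω) (G.sum_reach_minIterate_pos hT0 ω))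
      rw [huniv, probReal_univ]
      linarith
  · rw [hnum]
    have hz : 1 ≤ 1000 * ((H : ℝ) ^ 3 * K * ι / ε ^ 2) := by
      have h1 : 1 ≤ (H : ℝ) ^ 3 * K * ι / ε ^ 2 := by
        rw [one_le_div (by positivity)]
        calc ε ^ 2 ≤ (H : ℝ) ^ 2 := pow_le_pow_left₀ hε.le hεH 2
          _ ≤ (H : ℝ) ^ 3 := pow_le_pow_right₀ hH1 (by norm_num)
          _ ≤ (H : ℝ) ^ 3 * K := le_mul_of_one_le_right (by positivity) hK1
          _ ≤ (H : ℝ) ^ 3 * K * ι := le_mul_of_one_le_right (by positivity) hι1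
      linarith
    have hceil := (Nat.ceil_lt_add_one (zero_le_one.trans hz)).le
    push_cast
    calc 2 * (H : ℝ) * ⌈1000 * ((H : ℝ) ^ 3 * K * ι / ε ^ 2)⌉₊
        ≤ 2 * (H : ℝ) * (2 * (1000 * ((H : ℝ) ^ 3 * K * ι / ε ^ 2))) :=
          mul_le_mul_of_nonneg_left (by linarith) (by positivity)
      _ = 4000 * ((H : ℝ) ^ 4 * K * ι / ε ^ 2) := by ring
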